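/- Theories are one-sorted theories of first-order predicate logic with identity in a finite signature. A theory is recursively enumerable if it is axiomatised by a recursively enumerable set of sentences, and it is essentially undecidable if all its consistent extensions in the same language are undecidable. A theory $V$ interprets a theory $U$, written $V \rhd U$, if there is a piecewise, multidimensional (with dimensions varying over the pieces), relative, not necessarily identity-preserving translation with parameters of the language of $U$ into the language of $V$, with a formula $\alpha(\vec p\,)$ that says which parameters $\vec p$ are admissible, such that $V \vdash \exists \vec p\, \alpha(\vec p\,)$ and, for every sentence $\varphi$ with $U \vdash \varphi$, the theory $V$ proves that the translation of $\varphi$ holds for all $\vec p$ with $\alpha(\vec p\,)$. There is no recursively enumerable essentially undecidable theory that is the interpretability-minimum among such theories. That is, there is no recursively enumerable essentially undecidable theory $U$ such that $V \rhd U$ for every recursively enumerable essentially undecidable theory $V$. -/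

import Mathlib

namespace Interp

open FirstOrder FirstOrder.Language

/-! ### Finite signatures, Gödel numbers, recursively enumerable and decidable theories -/

/-- A finite signature: finitely many function symbols (constants are 0-ary function symbols) and
finitely many relation symbols. -/
class FiniteSignature (L : FirstOrder.Language.{0, 0}) : Prop where
  finite_functions : Finite (Σ n, L.Functions n)
  finite_relations : Finite (Σ n, L.Relations n)

attribute [instance] FiniteSignature.finite_functions FiniteSignature.finite_relations

section Coding

variable {L : FirstOrder.Language.{0, 0}} [FiniteSignature L]

/-- A fixed numbering of the finitely many function symbols. As the signature is finite, any two
numberings lead to the same computable and the same recursively enumerable sets of sentences. -/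
noncomputable def functionNumber (s : Σ n, L.Functions n) : ℕ := (Finite.equivFin _ s : Fin _)

/-- A fixed numbering of the finitely many relation symbols. -/
noncomputable def relationNumber (s : Σ n, L.Relations n) : ℕ := (Finite.equivFin _ s : Fin _)

/-- The Gödel number of a term. -/
noncomputable def termCode {α : Type} [Encodable α] : L.Term α → ℕ
  | .var x => Nat.pair 0 (Encodable.encode x)
  | @Term.func _ _ l f ts =>
      Nat.pair 1 (Nat.pair (functionNumber ⟨l, f⟩)
        (Encodable.encode (List.ofFn fun i => termCode (ts i))))

/-- The Gödel number of a formula. -/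
noncomputable def formulaCode {α : Type} [Encodable α] :
    {n : ℕ} → L.BoundedFormula α n → ℕ
  | _, .falsum => Nat.pair 0 0
  | _, .equal t s => Nat.pair 1 (Nat.pair (termCode t) (termCode s))
  | _, @BoundedFormula.rel _ _ _ l R ts =>
      Nat.pair 2 (Nat.pair (relationNumber ⟨l, R⟩)
        (Encodable.encode (List.ofFn fun i => termCode (ts i))))
  | _, .imp φ ψ => Nat.pair 3 (Nat.pair (formulaCode φ) (formulaCode ψ))
  | _, .all φ => Nat.pair 4 (formulaCode φ)

/-- The set of Gödel numbers of a set of sentences. -/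
def codes (A : L.Theory) : Set ℕ := {k | ∃ φ ∈ A, formulaCode φ = k}

/-- The set of theorems of a theory. -/
def theorems {L : FirstOrder.Language.{0, 0}} (T : L.Theory) : L.Theory :=
  {φ | T.ModelsBoundedFormula φ}

/-- A theory is recursively enumerable if its set of theorems is the set of theorems of a
recursively enumerable set of sentences. -/
def IsRE (T : L.Theory) : Prop :=
  ∃ A : L.Theory, REPred (fun k => k ∈ codes A) ∧ theorems A = theorems T

/-- A theory is decidable if its set of theorems is decidable. -/
def IsDecidable (T : L.Theory) : Prop := ComputablePred fun k => k ∈ codes (theorems T)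

/-- A theory is essentially undecidable if all its consistent extensions in the same language are
undecidable. -/
def EssentiallyUndecidable (T : L.Theory) : Prop :=
  ∀ T' : L.Theory, theorems T ⊆ theorems T' → T'.IsSatisfiable → ¬ IsDecidable T'

end Coding

/-! ### Piecewise, multidimensional, relative, non-identity-preserving translations with
parameters -/

/-- A translation of the language `L` into the language `K`. The objects of the interpreted domain
are divided over finitely many pieces; an object in piece `a` is given by a tuple of length
`dim a`. All formulas of the translation may contain the parameters, which are the free variables
indexed by `Fin npar`. -/
structure Translation (L K : FirstOrder.Language.{0, 0}) where
  /-- the number of pieces -/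
  npieces : ℕ
  /-- the dimension of each piece -/
  dim : Fin npieces → ℕ
  /-- the number of parameters -/
  npar : ℕ
  /-- the formula that says which tuples of parameters are admissible -/
  par : K.Formula (Fin npar)
  /-- the domain of each piece -/
  dom : (a : Fin npieces) → K.Formula (Fin npar ⊕ Fin (dim a))
  /-- the translation of identity, between objects in the pieces `a` and `b` -/
  eq : (a b : Fin npieces) → K.Formula (Fin npar ⊕ (Fin (dim a) ⊕ Fin (dim b)))
  /-- the translation of a relation symbol, for arguments in the pieces `a i` -/
  rel : {l : ℕ} → (R : L.Relations l) → (a : Fin l → Fin npieces) →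
    K.Formula (Fin npar ⊕ (Σ i, Fin (dim (a i))))
  /-- the translation of the graph of a function symbol, for arguments in the pieces `a i` and a
  value in the piece `b` -/
  fn : {l : ℕ} → (f : L.Functions l) → (a : Fin l → Fin npieces) → (b : Fin npieces) →
    K.Formula (Fin npar ⊕ ((Σ i, Fin (dim (a i))) ⊕ Fin (dim b)))

namespace Translation

variable {L K : FirstOrder.Language.{0, 0}} (τ : Translation L K)

/-- A variable for an object of the interpreted domain: a piece together with a tuple of (bound)
variables of the language `K`. -/
abbrev Obj (m : ℕ) : Type := Σ a : Fin τ.npieces, (Fin (τ.dim a) → Fin m)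

variable {τ} in
/-- The same variable, after `k` further variables have been bound. -/
def Obj.lift {m : ℕ} (x : τ.Obj m) (k : ℕ) : τ.Obj (m + k) :=
  ⟨x.1, fun j => Fin.castAdd k (x.2 j)⟩

/-- A formula of the translation with variables `g` substituted; parameters are left alone. -/
def inst {m : ℕ} {X : Type} (φ : K.Formula (Fin τ.npar ⊕ X)) (g : X → Fin m) :
    K.BoundedFormula (Fin τ.npar) m :=
  BoundedFormula.relabel (k := 0) (Sum.map id g) φ

/-- `x` is in the domain. -/
def domF {m : ℕ} (x : τ.Obj m) : K.BoundedFormula (Fin τ.npar) m :=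
  τ.inst (τ.dom x.1) x.2

/-- `x` and `y` are identical in the interpreted sense. -/
def eqF {m : ℕ} (x y : τ.Obj m) : K.BoundedFormula (Fin τ.npar) m :=
  τ.inst (τ.eq x.1 y.1) (Sum.elim x.2 y.2)

/-- `R` holds of `x` in the interpreted sense. -/
def relF {l m : ℕ} (R : L.Relations l) (x : Fin l → τ.Obj m) :
    K.BoundedFormula (Fin τ.npar) m :=
  τ.inst (τ.rel R fun i => (x i).1) fun p => (x p.1).2 p.2

/-- `f` takes the value `y` at `x` in the interpreted sense. -/
def fnF {l m : ℕ} (f : L.Functions l) (x : Fin l → τ.Obj m) (y : τ.Obj m) :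
    K.BoundedFormula (Fin τ.npar) m :=
  τ.inst (τ.fn f (fun i => (x i).1) y.1) (Sum.elim (fun p => (x p.1).2 p.2) y.2)

end Translation

section Blocks

variable {K : FirstOrder.Language.{0, 0}} {α : Type}

/-- A finite conjunction. -/
def conj {m : ℕ} (φs : List (K.BoundedFormula α m)) : K.BoundedFormula α m :=
  φs.foldr (· ⊓ ·) ⊤

/-- A finite disjunction. -/
def disj {m : ℕ} (φs : List (K.BoundedFormula α m)) : K.BoundedFormula α m :=
  φs.foldr (· ⊔ ·) ⊥

/-- Universal quantification over the last `k` variables. -/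
def allBlock {m : ℕ} : (k : ℕ) → K.BoundedFormula α (m + k) → K.BoundedFormula α m
  | 0, φ => φ
  | k + 1, φ => allBlock k φ.all

/-- Existential quantification over the last `k` variables. -/
def exBlock {m : ℕ} : (k : ℕ) → K.BoundedFormula α (m + k) → K.BoundedFormula α m
  | 0, φ => φ
  | k + 1, φ => exBlock k φ.ex

end Blocks

namespace Translation

variable {L K : FirstOrder.Language.{0, 0}} (τ : Translation L K)

/-- The variable for an object in piece `a` given by the last `dim a` variables. -/
def fresh (m : ℕ) (a : Fin τ.npieces) : τ.Obj (m + τ.dim a) := ⟨a, fun j => Fin.natAdd m j⟩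

/-- For all `y` in the domain, `φ`: a conjunction over the pieces. -/
def allObj {m : ℕ} (φ : (a : Fin τ.npieces) → K.BoundedFormula (Fin τ.npar) (m + τ.dim a)) :
    K.BoundedFormula (Fin τ.npar) m :=
  conj ((List.finRange τ.npieces).map fun a =>
    allBlock (τ.dim a) ((τ.domF (τ.fresh m a)).imp (φ a)))

/-- For some `y` in the domain, `φ`: a disjunction over the pieces. -/
def exObj {m : ℕ} (φ : (a : Fin τ.npieces) → K.BoundedFormula (Fin τ.npar) (m + τ.dim a)) :
    K.BoundedFormula (Fin τ.npar) m :=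
  disj ((List.finRange τ.npieces).map fun a =>
    exBlock (τ.dim a) (τ.domF (τ.fresh m a) ⊓ φ a))

/-- Variables for objects in the pieces `a 0, …, a (l - 1)`, given by consecutive tuples of
variables at the end. -/
def freshes (m : ℕ) {l : ℕ} (a : Fin l → Fin τ.npieces) (i : Fin l) :
    τ.Obj (m + ∑ i, τ.dim (a i)) :=
  ⟨a i, fun j => Fin.natAdd m (finSigmaFinEquiv ⟨i, j⟩)⟩

/-- For some `x 0, …, x (l - 1)` in the domain, `φ`: a disjunction over all the ways to choose
pieces for these objects. -/
def exObjs {m : ℕ} (l : ℕ)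
    (φ : (a : Fin l → Fin τ.npieces) →
      K.BoundedFormula (Fin τ.npar) (m + ∑ i, τ.dim (a i))) :
    K.BoundedFormula (Fin τ.npar) m :=
  disj ((List.finRange (τ.npieces ^ l)).map fun c =>
    let a : Fin l → Fin τ.npieces := finFunctionFinEquiv.symm c
    exBlock (∑ i, τ.dim (a i))
      (conj (List.ofFn fun i => τ.domF (τ.freshes m a i)) ⊓ φ a))

/-- The translation of `t = y` for a term `t`, where `env` says which objects the variables of `t`
stand for. Nested terms are unravelled: `f (t 0, …, t (l - 1)) = y` becomes
`∃ x 0 … x (l - 1), t 0 = x 0 ∧ … ∧ t (l - 1) = x (l - 1) ∧ f (x 0, …, x (l - 1)) = y`. -/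
def termGraph {n : ℕ} :
    L.Term (Empty ⊕ Fin n) → {m : ℕ} → (env : Fin n → τ.Obj m) → (y : τ.Obj m) →
      K.BoundedFormula (Fin τ.npar) m
  | .var (.inl e), _, _, _ => e.elim
  | .var (.inr x), _, env, y => τ.eqF (env x) y
  | @Term.func _ _ l f ts, m, env, y =>
      τ.exObjs l fun a =>
        conj (List.ofFn fun i =>
          termGraph (ts i) (fun x => (env x).lift (∑ i, τ.dim (a i))) (τ.freshes m a i)) ⊓
        τ.fnF f (τ.freshes m a) (y.lift (∑ i, τ.dim (a i)))

/-- The translation of `t = s`: if `s` is a variable this is the preceding definition, and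
otherwise it becomes `∃ y, t = y ∧ s = y`. -/
def equalTr {n m : ℕ} (t s : L.Term (Empty ⊕ Fin n)) (env : Fin n → τ.Obj m) :
    K.BoundedFormula (Fin τ.npar) m :=
  match s with
  | .var (.inr x) => τ.termGraph t env (env x)
  | s => τ.exObj fun a =>
      τ.termGraph t (fun x => (env x).lift (τ.dim a)) (τ.fresh m a) ⊓
      τ.termGraph s (fun x => (env x).lift (τ.dim a)) (τ.fresh m a)

/-- The translation of `R (t 0, …, t (l - 1))`:
`∃ x 0 … x (l - 1), t 0 = x 0 ∧ … ∧ t (l - 1) = x (l - 1) ∧ R (x 0, …, x (l - 1))`. -/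
def relTr {n m l : ℕ} (R : L.Relations l) (ts : Fin l → L.Term (Empty ⊕ Fin n))
    (env : Fin n → τ.Obj m) : K.BoundedFormula (Fin τ.npar) m :=
  τ.exObjs l fun a =>
    conj (List.ofFn fun i =>
      τ.termGraph (ts i) (fun x => (env x).lift (∑ i, τ.dim (a i))) (τ.freshes m a i)) ⊓
    τ.relF R (τ.freshes m a)

/-- The translation of a formula, where `env` says which objects its variables stand for.
It commutes with the propositional connectives and relativises the quantifiers. -/
def formulaTr : {n : ℕ} → L.BoundedFormula Empty n → {m : ℕ} → (env : Fin n → τ.Obj m) →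
    K.BoundedFormula (Fin τ.npar) m
  | _, .falsum, _, _ => ⊥
  | _, .equal t s, _, env => τ.equalTr t s env
  | _, .rel R ts, _, env => τ.relTr R ts env
  | _, .imp φ ψ, _, env => (formulaTr φ env).imp (formulaTr ψ env)
  | _, .all φ, m, env => τ.allObj fun a =>
      formulaTr φ (Fin.snoc (α := fun _ => τ.Obj (m + τ.dim a))
        (fun x => (env x).lift (τ.dim a)) (τ.fresh m a))

/-- The translation of a sentence: a formula in which only the parameters are free. -/
def sentenceTr (φ : L.Sentence) : K.Formula (Fin τ.npar) :=
  τ.formulaTr φ (m := 0) Fin.elim0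

/-- The sentence saying that there are admissible parameters. -/
def parExists : K.Sentence :=
  (BoundedFormula.relabel (k := 0) (Sum.inr : Fin τ.npar → Empty ⊕ Fin τ.npar) τ.par).exs

end Translation

/-- `V` interprets `U`: for some translation, `V` proves that there are admissible parameters, and
`V` proves the translations of all theorems of `U` for all admissible parameters. (A formula with
free variables follows from a theory iff its universal closure does.) -/
def Interprets {K L : FirstOrder.Language.{0, 0}} (V : K.Theory) (U : L.Theory) : Prop :=
  ∃ τ : Translation L K, V.ModelsBoundedFormula τ.parExists ∧
    ∀ φ ∈ theorems U, V.ModelsBoundedFormula (τ.par.imp (τ.sentenceTr φ))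

/-- `U` is the interpretability-minimum among the recursively enumerable essentially undecidable
theories: it is such a theory and it is interpretable in every such theory. -/
def IsInterpretabilityMinimum {L : FirstOrder.Language.{0, 0}} [FiniteSignature L] (U : L.Theory) : Prop :=
  IsRE U ∧ EssentiallyUndecidable U ∧
    ∀ (K : FirstOrder.Language.{0, 0}) [FiniteSignature K] (V : K.Theory),
      IsRE V → EssentiallyUndecidable V → Interprets V U

end Interp

namespace Interp

/-! ### Recursively enumerable predicates -/

section Recursion

/-! Fix a recursively enumerable essentially undecidable theory `U`. The proof diagonalises against
all translations and produces a theory `V = sizeTheory u`, in a language with one binary relation,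
that does not interpret `U`. Let `selfOutputs 0` and `selfOutputs 1` be the usual recursively
inseparable sets. In terms of equivalence classes, `V` says that some class has `u j + 1` elements
for `j` in the first set, and that none has for `j` in the second. A decidable consistent extension
of `V` would decide a set separating the two, so `V` is essentially undecidable for every computable
`u` (`essentiallyUndecidable_sizeTheory`). The freedom lies in `u`, which is made to grow so fast
that any given translation sees too little of `V`.

The structure that refutes an interpretation is `points (u '' selfOutputs 0)`. In `points Y` the
class number `n` has `n + 1` elements if `n ∈ Y` and is infinite otherwise. Two facts about these
structures are needed.

Locality: an Ehrenfeucht–Fraïssé game shows that a formula of bounded depth sees only an initial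
segment of `Y`. For a coded translation `e` and a sentence with code `k`, the truth of the
translated sentence depends only on `Y` below `e.use k` (`TrCode.hold_congr`). It can be computed in
a finite part of the structure (`TrCode.primrecPred_hold`).

Failure on finite sets: for finite `X`, locality makes the set of sentences whose translations are
true in `points X` decidable. If it contained axioms for `U`, it would be a decidable, deductively
closed, consistent extension of `U`. So every translation makes some axiom false in `points X`
(`exists_not_hold`). Translated identity need not be an equivalence relation or respect functions.
The axioms of identity, which `U` proves anyway, are therefore counted among the axioms, and they
allow an honest structure to be formed as a quotient.

Diagonalisation (`exists_sparse`): choose `u (n + 1)` so large that, for each `X ⊆ {0, …, u n}`, a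
search below `u (n + 1)` finds an axiom that fails in `points X` under translation number `n`, with
its use also below `u (n + 1)`. Below `u (n + 1)` the set `u '' selfOutputs 0` coincides with one
such `X`, so by locality the same axiom fails in `points (u '' selfOutputs 0)`. That structure is a
model of `V`, so translation number `n` cannot interpret `U` in `V` (`Interprets.exists_hold`,
`exists_not_interprets`). -/

theorem rePred_exists {α : Type*} [Primcodable α] {P : α × ℕ → Prop} (h : ComputablePred P) :
    REPred fun a => ∃ n, P (a, n) := by
  classical
  have h1 : Partrec fun a : α => Nat.rfind fun n => Part.some (decide (P (a, n))) :=
    Partrec.rfind (Computable.partrec (h.decide))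
  refine h1.dom_re.of_eq fun a => ?_
  refine Nat.rfind_dom.trans ?_
  constructor
  · rintro ⟨n, h, -⟩
    exact ⟨n, by simpa using h⟩
  · rintro ⟨n, h⟩
    exact ⟨n, by simpa using h, fun _ => trivial⟩

/-- Kleene's normal form: `R (k, s)` says that a program with domain `p` halts on `k` within the
bound `s`. A primitive recursive matrix, rather than a merely computable one, is what the later
closure under bounded quantifiers requires. -/
theorem exists_primrecPred_of_rePred {p : ℕ → Prop} (h : REPred p) :
    ∃ R : ℕ × ℕ → Prop, PrimrecPred R ∧ ∀ k, p k ↔ ∃ s, R (k, s) := by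
  have h1 : Partrec fun k : ℕ => (Part.assert (p k) fun _ => Part.some ()).map fun _ => (0 : ℕ) :=
    Partrec.map h (Computable.const 0).to₂
  obtain ⟨c, hc⟩ := Nat.Partrec.Code.exists_code.1 (Partrec.nat_iff.1 h1)
  refine ⟨fun q => (Nat.Partrec.Code.evaln q.2 c q.1).isSome = true, ?_, fun k => ?_⟩
  · refine Primrec.eq.comp ?_ (Primrec.const true)
    exact Primrec.option_isSome.comp (Nat.Partrec.Code.primrec_evaln.comp
      ((Primrec.snd.pair (Primrec.const c)).pair Primrec.fst))
  · have h2 : p k ↔ (Nat.Partrec.Code.eval c k).Dom := by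
      rw [hc]
      simp [Part.assert]
    rw [h2, Part.dom_iff_mem]
    simp only [Option.isSome_iff_exists, Nat.Partrec.Code.evaln_complete]
    exact exists_comm

/-- The union of two recursively enumerable predicates on `ℕ`. -/
theorem rePred_or {p q : ℕ → Prop} (hp : REPred p) (hq : REPred q) :
    REPred fun k => p k ∨ q k := by
  obtain ⟨R, hR, h1⟩ := exists_primrecPred_of_rePred hp
  obtain ⟨S, hS, h2⟩ := exists_primrecPred_of_rePred hq
  refine (rePred_exists (hR.or hS).computablePred).of_eq fun k => ?_
  rw [h1, h2]
  exact exists_or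

/-- The image of a recursively enumerable set under a computable function. -/
theorem rePred_image {p : ℕ → Prop} (hp : REPred p) {f : ℕ → ℕ} (hf : Computable f) :
    REPred fun k => ∃ n, p n ∧ f n = k := by
  classical
  obtain ⟨R, hR, h1⟩ := exists_primrecPred_of_rePred hp
  -- One search variable has to carry both a candidate preimage and a witness that `p` holds of it,
  -- hence the pairing.
  have : ComputablePred fun q : ℕ × ℕ => R (q.2.unpair.1, q.2.unpair.2) ∧ f q.2.unpair.1 = q.1 := by
    have e1 : Computable fun q : ℕ × ℕ => q.2.unpair.1 :=
      (Primrec.fst.comp (Primrec.unpair.comp Primrec.snd)).to_comp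
    have e2 : Computable fun q : ℕ × ℕ => decide (R (q.2.unpair.1, q.2.unpair.2)) :=
      ((hR.comp (Primrec.unpair.comp Primrec.snd) :
        PrimrecPred fun q : ℕ × ℕ => R q.2.unpair).decide.to_comp)
    have e3 : Computable fun q : ℕ × ℕ => decide (f q.2.unpair.1 = q.1) :=
      (Primrec.eq (α := ℕ)).decide.to_comp.comp (hf.comp e1) Computable.fst
    refine ⟨inferInstance, ((Primrec.and.to_comp).comp e2 e3).of_eq fun q => ?_⟩
    simp
  refine (rePred_exists this).of_eq fun k => ?_
  constructor
  · rintro ⟨n, h, h'⟩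
    exact ⟨_, (h1 _).2 ⟨_, h⟩, h'⟩
  · rintro ⟨n, h, h'⟩
    obtain ⟨s, hs⟩ := (h1 _).1 h
    exact ⟨Nat.pair n s, by simpa using ⟨hs, h'⟩⟩

/-! ### Two recursively inseparable sets -/

/-- The programs that output `i` on their own code. -/
def selfOutputs (i : ℕ) : Set ℕ :=
  {j | i ∈ Nat.Partrec.Code.eval (Denumerable.ofNat Nat.Partrec.Code j) j}

theorem rePred_selfOutputs (i : ℕ) : REPred fun j => j ∈ selfOutputs i := by
  have : ComputablePred fun q : ℕ × ℕ => Nat.Partrec.Code.evaln q.2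
      (Denumerable.ofNat Nat.Partrec.Code q.1) q.1 = some i := by
    refine PrimrecPred.computablePred (Primrec.eq.comp ?_ (Primrec.const (some i)))
    exact Nat.Partrec.Code.primrec_evaln.comp ((Primrec.snd.pair ((Primrec.ofNat _).comp
      Primrec.fst)).pair Primrec.fst)
  refine (rePred_exists this).of_eq fun j => ?_
  exact (Nat.Partrec.Code.evaln_complete (c := Denumerable.ofNat Nat.Partrec.Code j)).symm

theorem not_mem_selfOutputs_one {j : ℕ} (h : j ∈ selfOutputs 0) : j ∉ selfOutputs 1 :=
  fun h' => by simpa using Part.mem_unique h h'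

/-- Diagonalisation: a program that outputs `1` on `C` and `0` off `C`, run on its own code, lands
in the set that `C` should have put on the other side. -/
theorem not_separates_selfOutputs {C : ℕ → Prop} (hC : ComputablePred C)
    (h0 : ∀ j ∈ selfOutputs 0, C j) (h1 : ∀ j ∈ selfOutputs 1, ¬ C j) : False := by
  classical
  have hf : Computable fun j => if C j then 1 else 0 :=
    (Computable.cond hC.decide (Computable.const 1) (Computable.const 0)).of_eq fun j => by
      by_cases h : C j <;> simp [h]
  obtain ⟨c, hc⟩ := Nat.Partrec.Code.exists_code.1 (Partrec.nat_iff.1 hf.partrec)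
  have key : ∀ i, (if C (Encodable.encode c) then 1 else 0) = i →
      Encodable.encode c ∈ selfOutputs i := by
    intro i hi
    simp [selfOutputs, hc, hi]
  by_cases h : C (Encodable.encode c)
  · exact h1 _ (key 1 (by simp [h])) h
  · exact h (h0 _ (key 0 (by simp [h])))

/-! ### Sparse computable sequences -/

/-- A list of lists that enumerates the subsets of `{0, …, m - 1}`. -/
def subsetsBelow (m : ℕ) : List (List ℕ) :=
  Nat.rec [[]] (fun i acc => acc ++ acc.map (i :: ·)) m

theorem primrec_subsetsBelow : Primrec subsetsBelow := by
  refine Primrec.nat_rec₁ _ ?_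
  refine Primrec.list_append.comp₂ Primrec₂.right ?_
  exact Primrec.list_map Primrec.snd
    (Primrec.list_cons.comp₂ (Primrec.fst.comp₂ Primrec₂.left) Primrec₂.right)

theorem exists_mem_subsetsBelow (Y : Set ℕ) (m : ℕ) :
    ∃ X ∈ subsetsBelow m, ∀ x, x ∈ X ↔ x < m ∧ x ∈ Y := by
  induction m with
  | zero => exact ⟨[], by simp [subsetsBelow], by simp⟩
  | succ m ih =>
    obtain ⟨X, hX, h⟩ := ih
    have e : subsetsBelow (m + 1) = subsetsBelow m ++ (subsetsBelow m).map (m :: ·) := rfl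
    by_cases hm : m ∈ Y
    · refine ⟨m :: X, by rw [e]; simp [hX], fun x => ?_⟩
      simp only [List.mem_cons, h]
      constructor
      · rintro (rfl | ⟨h1, h2⟩)
        · exact ⟨by omega, hm⟩
        · exact ⟨by omega, h2⟩
      · rintro ⟨h1, h2⟩
        by_cases hx : x = m
        · exact .inl hx
        · exact .inr ⟨by omega, h2⟩
    · refine ⟨X, by rw [e]; simp [hX], fun x => ?_⟩
      rw [h]
      refine ⟨fun ⟨h1, h2⟩ => ⟨by omega, h2⟩, fun ⟨h1, h2⟩ => ⟨?_, h2⟩⟩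
      have : x ≠ m := fun h => hm (h ▸ h2)
      omega

/-- A computable sequence that grows so fast that it leaves, above any of its initial segments, a
gap in which a given search succeeds. -/
theorem exists_sparse {B : (ℕ × List ℕ) × ℕ → Prop} (hB : PrimrecPred B)
    (hex : ∀ n X, ∃ q, B ((n, X), q)) :
    ∃ u : ℕ → ℕ, Computable u ∧ StrictMono u ∧ ∀ Y ⊆ Set.range u, ∀ n,
      ∃ X : List ℕ, ∃ q < u (n + 1), B ((n, X), q) ∧ ∀ y < u (n + 1), y ∈ X ↔ y ∈ Y := by
  classical
  -- For `a = (n, v)`, the number `t` exceeds a successful `q` for stage `n` and every subset of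
  -- `{0, …, v}`. There are finitely many subsets, so such a `t` exists.
  let P : ℕ × ℕ → ℕ → Prop := fun a t => ∀ X ∈ subsetsBelow (a.2 + 1), ∃ q < t, B ((a.1, X), q)
  have hP : ComputablePred fun p : (ℕ × ℕ) × ℕ => P p.1 p.2 := by
    have h1 : PrimrecRel fun (q : ℕ) (r : ℕ × List ℕ) => B (r, q) :=
      PrimrecPred.comp hB (Primrec.pair Primrec.snd Primrec.fst)
    have h2 : PrimrecRel fun (X : List ℕ) (p : (ℕ × ℕ) × ℕ) =>
        ∃ q ∈ List.range p.2, B ((p.1.1, X), q) :=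
      h1.exists_mem_list.comp
        (Primrec.list_range.comp (Primrec.snd.comp Primrec.snd))
        ((Primrec.fst.comp (Primrec.fst.comp Primrec.snd)).pair Primrec.fst)
    have h3 := h2.forall_mem_list.comp
      (primrec_subsetsBelow.comp (Primrec.succ.comp (Primrec.snd.comp Primrec.fst)))
      (Primrec.id (α := (ℕ × ℕ) × ℕ))
    refine (h3.of_eq fun p => ?_).computablePred
    simp [P]
  have hPex : ∀ a, ∃ t, P a t := by
    intro a
    suffices ∀ L : List (List ℕ), ∃ t, ∀ X ∈ L, ∃ q < t, B ((a.1, X), q) from this _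
    intro L
    induction L with
    | nil => exact ⟨0, by simp⟩
    | cons X L ih =>
      obtain ⟨t, ht⟩ := ih
      obtain ⟨q, hq⟩ := hex a.1 X
      refine ⟨max t (q + 1), ?_⟩
      simp only [List.mem_cons, forall_eq_or_imp]
      refine ⟨⟨q, by omega, hq⟩, fun Z hZ => ?_⟩
      obtain ⟨q', h1, h2⟩ := ht Z hZ
      exact ⟨q', by omega, h2⟩
  have hfind := Computable.find hP hPex
  -- The argument `v` is the previous value of the sequence. The maximum with `v + 1` only serves
  -- strict monotonicity.
  let u : ℕ → ℕ := fun n => Nat.rec 0 (fun n v => max (Nat.find (hPex (n, v))) (v + 1)) n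
  have hu : ∀ n, u (n + 1) = max (Nat.find (hPex (n, u n))) (u n + 1) := fun n => rfl
  have humono : StrictMono u := strictMono_nat_of_lt_succ fun n => by rw [hu]; omega
  refine ⟨u, ?_, humono, fun Y hY n => ?_⟩
  · refine Computable.of_eq (Computable.nat_rec Computable.id (Computable.const 0)
      (h := fun _ p => max (Nat.find (hPex p)) (p.2 + 1)) ?_) fun n => rfl
    refine (Primrec.nat_max.to_comp).comp₂ ?_ ?_
    · exact hfind.comp₂ Computable.snd
    · exact (Primrec.succ.to_comp.comp (Computable.snd.comp Computable.snd)).to₂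
  -- Between `u n` and `u (n + 1)` the sequence has no values, so the part of `Y` below `u (n + 1)`
  -- is a subset of `{0, …, u n}` and was considered when `u (n + 1)` was chosen.
  · obtain ⟨X, hX, hXY⟩ := exists_mem_subsetsBelow Y (u n + 1)
    obtain ⟨q, hq, hB'⟩ := Nat.find_spec (hPex (n, u n)) X hX
    refine ⟨X, q, by rw [hu]; omega, hB', fun y hy => ?_⟩
    rw [hXY]
    refine ⟨fun h => h.2, fun h => ⟨?_, h⟩⟩
    obtain ⟨j, rfl⟩ := hY h
    have : j < n + 1 := humono.lt_iff_lt.1 hy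
    have := humono.monotone (show j ≤ n by omega)
    omega

end Recursion

end Interp

namespace Interp

/-! ### Evaluation of coded formulas in equivalence structures -/

section Evaluation

/-- A number, read as a point of an equivalence structure, lies in the class given by its first
component. -/
def cls (x : ℕ) : ℕ := x.unpair.1

@[simp] theorem cls_pair (n j : ℕ) : cls (Nat.pair n j) = n := by simp [cls]

theorem unpair_snd_lt {c : ℕ} (h : c.unpair.1 ≠ 0) : c.unpair.2 < c := by
  have := Nat.add_le_pair c.unpair.1 c.unpair.2
  rw [Nat.pair_unpair] at this
  omega

theorem unpair_snd_fst_lt {c : ℕ} (h : c.unpair.1 ≠ 0) : c.unpair.2.unpair.1 < c :=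
  (Nat.unpair_left_le _).trans_lt (unpair_snd_lt h)

theorem unpair_snd_snd_lt {c : ℕ} (h : c.unpair.1 ≠ 0) : c.unpair.2.unpair.2 < c :=
  (Nat.unpair_right_le _).trans_lt (unpair_snd_lt h)

/-- Truth of a coded formula in the set `S` with the equivalence relation of being in the same
class, where `v` lists the values of the variables. Every number codes a formula. -/
def satK (S : Set ℕ) (c : ℕ) (v : List ℕ) : Prop :=
  if c.unpair.1 = 0 then v[c.unpair.2.unpair.1]? = v[c.unpair.2.unpair.2]?
  else if c.unpair.1 = 1 then
    v[c.unpair.2.unpair.1]?.map cls = v[c.unpair.2.unpair.2]?.map cls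
  else if _h : c.unpair.1 = 2 then satK S c.unpair.2.unpair.1 v → satK S c.unpair.2.unpair.2 v
  else if _h : c.unpair.1 = 3 then ∀ x ∈ S, satK S c.unpair.2 (v ++ [x])
  else False
termination_by c
decreasing_by
  · exact unpair_snd_fst_lt (by omega)
  · exact unpair_snd_snd_lt (by omega)
  · exact unpair_snd_lt (by omega)

/-! ### The back-and-forth game between good sets -/

/-- All classes of `S` that are below `d` and in `X` have the size given by their number, all the
others have at least `d` elements, and there are at least `d` classes that are not below `d`. -/
structure Good (d : ℕ) (X S : Set ℕ) : Prop where
  small : ∀ n < d, n ∈ X → ∀ j, Nat.pair n j ∈ S ↔ j ≤ n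
  large : ∀ x ∈ S, ¬ (cls x < d ∧ cls x ∈ X) → ∀ j < d, Nat.pair (cls x) j ∈ S
  zero : ∀ n < 2 * d, Nat.pair n 0 ∈ S

/-- The positions that can be won in the back-and-forth game between two good sets. -/
structure Position (d : ℕ) (X S S' : Set ℕ) (W : List (ℕ × ℕ)) : Prop where
  mem : ∀ a ∈ W, a.1 ∈ S ∧ a.2 ∈ S'
  eq_iff : ∀ a ∈ W, ∀ b ∈ W, a.1 = b.1 ↔ a.2 = b.2
  cls_iff : ∀ a ∈ W, ∀ b ∈ W, cls a.1 = cls b.1 ↔ cls a.2 = cls b.2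
  lt : ∀ a ∈ W, cls a.1 < d ∨ cls a.2 < d → cls a.1 = cls a.2
  small : ∀ a ∈ W, cls a.1 < d → cls a.1 ∈ X → a.1 = a.2

variable {d : ℕ} {X S S' : Set ℕ} {W : List (ℕ × ℕ)}

theorem Position.nil : Position d X S S' [] := by
  constructor <;> simp

theorem Position.symm (h : Position d X S S' W) : Position d X S' S (W.map Prod.swap) := by
  constructor <;> simp only [List.mem_map, forall_exists_index, and_imp, forall_apply_eq_imp_iff₂,
    Prod.fst_swap, Prod.snd_swap]
  · exact fun a ha => (h.mem a ha).symm
  · exact fun a ha b hb => (h.eq_iff a ha b hb).symm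
  · exact fun a ha b hb => (h.cls_iff a ha b hb).symm
  · exact fun a ha h' => (h.lt a ha h'.symm).symm
  · intro a ha h1 h2
    have := h.lt a ha (.inr h1)
    exact (h.small a ha (this ▸ h1) (this ▸ h2)).symm

theorem Position.cons (h : Position d X S S' W) {b b' : ℕ} (hb : b ∈ S) (hb' : b' ∈ S')
    (heq : ∀ a ∈ W, b = a.1 ↔ b' = a.2) (hcls : ∀ a ∈ W, cls b = cls a.1 ↔
      cls b' = cls a.2)
    (hlt : cls b < d ∨ cls b' < d → cls b = cls b')
    (hsmall : cls b < d → cls b ∈ X → b = b') : Position d X S S' ((b, b') :: W) := by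
  constructor <;> simp only [List.forall_mem_cons]
  · exact ⟨⟨hb, hb'⟩, h.mem⟩
  · exact ⟨⟨trivial, heq⟩, fun a ha => ⟨by rw [eq_comm, heq a ha, eq_comm], h.eq_iff a ha⟩⟩
  · exact ⟨⟨trivial, hcls⟩, fun a ha => ⟨by rw [eq_comm, hcls a ha, eq_comm], h.cls_iff a ha⟩⟩
  · exact ⟨hlt, h.lt⟩
  · exact ⟨hsmall, h.small⟩

theorem exists_notMem_of_length_lt {L : List ℕ} (m : ℕ) (h : L.length < d) :
    ∃ j, m ≤ j ∧ j < m + d ∧ j ∉ L := by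
  have : L.toFinset.card < (Finset.Ico m (m + d)).card := by
    rw [Nat.card_Ico]
    have := L.toFinset_card_le
    omega
  obtain ⟨j, h1, h2⟩ := Finset.exists_mem_notMem_of_card_lt_card this
  rw [Finset.mem_Ico] at h1
  exact ⟨j, h1.1, h1.2, by simpa using h2⟩

/-- A point already played gets its old answer, and a point of a small class in `X` answers itself.
Any other point of a visited class gets an unused point of the matching class, which is large. A new
class below `d` is answered by the class of the same number, and a new class from `d` on by an
unused one among `d, …, 2 * d - 1`. Fewer than `d` moves have been made, so there is always room. -/
theorem Position.forth (hS : Good d X S) (hS' : Good d X S') (h : Position d X S S' W)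
    (hW : W.length < d)
    {b : ℕ} (hb : b ∈ S) : ∃ b' ∈ S', Position d X S S' ((b, b') :: W) := by
  by_cases h1 : ∃ a ∈ W, a.1 = b
  · obtain ⟨a, ha, rfl⟩ := h1
    exact ⟨a.2, (h.mem a ha).2, h.cons hb (h.mem a ha).2 (h.eq_iff a ha) (h.cls_iff a ha)
        (h.lt a ha)
      (h.small a ha)⟩
  push Not at h1
  by_cases h2 : cls b < d ∧ cls b ∈ X
  · have hb' : b ∈ S' := by
      have e : Nat.pair (cls b) b.unpair.2 = b := Nat.pair_unpair b
      rw [← e, hS'.small _ h2.1 h2.2, ← hS.small _ h2.1 h2.2, e]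
      exact hb
    refine ⟨b, hb', h.cons hb hb' (fun a ha => ?_) (fun a ha => ?_) (fun _ => rfl)
      (fun _ _ => rfl)⟩
    · refine ⟨fun e => absurd e.symm (h1 a ha), fun e => ?_⟩
      have e1 := h.lt a ha (.inr (e ▸ h2.1))
      exact e.trans (h.small a ha (e1 ▸ e ▸ h2.1) (e1 ▸ e ▸ h2.2)).symm
    · constructor <;> intro e
      · exact e.trans (h.lt a ha (.inl (e ▸ h2.1)))
      · exact e.trans (h.lt a ha (.inr (e ▸ h2.1))).symm
  by_cases h3 : ∃ a ∈ W, cls b = cls a.1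
  · obtain ⟨a, ha, hab⟩ := h3
    obtain ⟨j, -, hj, hjW⟩ := exists_notMem_of_length_lt (L := W.map fun c => c.2.unpair.2) 0
      (by simpa using hW)
    have hlt : cls b < d ∨ cls a.2 < d → cls b = cls a.2 :=
      fun h' => hab.trans (h.lt a ha (hab ▸ h'))
    have hb' : Nat.pair (cls a.2) j ∈ S' := by
      -- If the answering class were small, it would have the same number as the class of `b`, which
      -- is excluded by `h2`.
      refine hS'.large _ (h.mem a ha).2 (fun h' => h2 ?_) j (by omega)
      rwa [hlt (.inr h'.1)]
    refine ⟨_, hb', h.cons hb hb' (fun c hc => ?_) (fun c hc => ?_) (by simpa using hlt)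
      fun h4 h5 => absurd ⟨h4, h5⟩ h2⟩
    · refine ⟨fun e => absurd e.symm (h1 c hc), fun e => absurd ?_ hjW⟩
      exact List.mem_map.2 ⟨c, hc, by simp [← e]⟩
    · rw [hab, h.cls_iff a ha c hc, cls_pair]
  · push Not at h3
    by_cases h4 : cls b < d
    · have hb' : Nat.pair (cls b) 0 ∈ S' := hS'.zero _ (by omega)
      have hcls : ∀ a ∈ W, cls b ≠ cls a.2 := fun a ha e =>
        h3 a ha (e.trans (h.lt a ha (.inr (e ▸ h4))).symm)
      refine ⟨_, hb', h.cons hb hb' (fun c hc => ?_) (fun c hc => ?_) (by simp)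
        fun h4 h5 => absurd ⟨h4, h5⟩ h2⟩
      · refine ⟨fun e => absurd e.symm (h1 c hc), fun e => absurd ?_ (hcls c hc)⟩
        simp [← e]
      · exact ⟨fun e => absurd e (h3 c hc), fun e => absurd (by simpa using e) (hcls c hc)⟩
    -- Classes numbered `d` or more need not keep their number, so any unvisited one will do. The
    -- bound `2 * d` in the `zero` field of `Good` provides it.
    · obtain ⟨n, hn, hn', hnW⟩ := exists_notMem_of_length_lt
        (L := W.map fun c => cls c.2) d (by simpa using hW)
      have hb' : Nat.pair n 0 ∈ S' := hS'.zero _ (by omega)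
      have hcls : ∀ a ∈ W, n ≠ cls a.2 := fun a ha e =>
        hnW (List.mem_map.2 ⟨a, ha, e.symm⟩)
      refine ⟨_, hb', h.cons hb hb' (fun c hc => ?_) (fun c hc => ?_) ?_
        fun h4 h5 => absurd ⟨h4, h5⟩ h2⟩
      · refine ⟨fun e => absurd e.symm (h1 c hc), fun e => absurd ?_ (hcls c hc)⟩
        simp [← e]
      · exact ⟨fun e => absurd e (h3 c hc), fun e => absurd (by simpa using e) (hcls c hc)⟩
      · rw [cls_pair]
        omega

theorem Position.back (hS : Good d X S) (hS' : Good d X S') (h : Position d X S S' W)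
    (hW : W.length < d)
    {b : ℕ} (hb : b ∈ S') : ∃ b' ∈ S, Position d X S S' ((b', b) :: W) := by
  obtain ⟨b', h1, h2⟩ := h.symm.forth hS' hS (by simpa using hW) hb
  exact ⟨b', h1, by simpa [Function.comp_def] using h2.symm⟩

/-! ### Truth is preserved along positions -/

theorem getElem?_of_forall₂ {α β : Type*} {R : α → β → Prop} {l : List α} {l' : List β}
    (h : List.Forall₂ R l l') (i : ℕ) : l[i]? = none ∧ l'[i]? = none ∨
      ∃ a b, l[i]? = some a ∧ l'[i]? = some b ∧ R a b := by
  induction h generalizing i with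
  | nil => simp
  | cons h1 _ ih =>
    cases i with
    | zero => exact .inr ⟨_, _, rfl, rfl, h1⟩
    | succ i => simpa using ih i

theorem forall₂_snoc {α β : Type*} {R : α → β → Prop} {l : List α} {l' : List β}
    (h : List.Forall₂ R l l') {a : α} {b : β} (hab : R a b) :
    List.Forall₂ R (l ++ [a]) (l' ++ [b]) :=
  List.rel_append h (.cons hab .nil)

theorem forall₂_mem_mono {l l' : List ℕ} {W' : List (ℕ × ℕ)}
    (h : List.Forall₂ (fun a b => (a, b) ∈ W) l l') (hW : W ⊆ W') :
    List.Forall₂ (fun a b => (a, b) ∈ W') l l' :=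
  h.imp fun _ _ h => hW h

/-- The code `c` serves as a crude bound on the quantifier depth: entering a quantifier costs one
move and lowers the code by at least one, so `W.length + c ≤ d` is maintained. -/
theorem satK_congr (hS : Good d X S) (hS' : Good d X S') (c : ℕ) :
    ∀ {W : List (ℕ × ℕ)} {v v' : List ℕ}, Position d X S S' W →
      List.Forall₂ (fun a b => (a, b) ∈ W) v v' → W.length + c ≤ d →
      (satK S c v ↔ satK S' c v') := by
  induction c using Nat.strong_induction_on with
  | _ c ih =>
    intro W v v' hW hv hd
    rw [satK.eq_def S c, satK.eq_def S' c]
    split_ifs with h0 h1 h2 h3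
    · obtain ⟨e1, e2⟩ | ⟨a, b, e1, e2, hab⟩ := getElem?_of_forall₂ hv c.unpair.2.unpair.1 <;>
      obtain ⟨e3, e4⟩ | ⟨a', b', e3, e4, hab'⟩ := getElem?_of_forall₂ hv c.unpair.2.unpair.2 <;>
      simp only [e1, e2, e3, e4, reduceCtorEq, Option.some.injEq]
      exact hW.eq_iff _ hab _ hab'
    · obtain ⟨e1, e2⟩ | ⟨a, b, e1, e2, hab⟩ := getElem?_of_forall₂ hv c.unpair.2.unpair.1 <;>
      obtain ⟨e3, e4⟩ | ⟨a', b', e3, e4, hab'⟩ := getElem?_of_forall₂ hv c.unpair.2.unpair.2 <;>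
      simp only [e1, e2, e3, e4, reduceCtorEq, Option.some.injEq, Option.map_some, Option.map_none]
      exact hW.cls_iff _ hab _ hab'
    · have l1 := unpair_snd_fst_lt h0
      have l2 := unpair_snd_snd_lt h0
      rw [ih _ l1 hW hv (by omega), ih _ l2 hW hv (by omega)]
    · have l1 := unpair_snd_lt h0
      have step : ∀ {x x'}, Position d X S S' ((x, x') :: W) →
          (satK S c.unpair.2 (v ++ [x]) ↔ satK S' c.unpair.2 (v' ++ [x'])) := fun h =>
        ih _ l1 h (forall₂_snoc (forall₂_mem_mono hv (List.subset_cons_self _ _)) (by simp))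
          (by simp only [List.length_cons]; omega)
      constructor
      · intro H x' hx'
        obtain ⟨x, hx, h⟩ := hW.back hS hS' (by omega) hx'
        exact (step h).1 (H x hx)
      · intro H x hx
        obtain ⟨x', hx', h⟩ := hW.forth hS hS' (by omega) hx
        exact (step h).2 (H x' hx')
    · rfl

/-- An object of an interpreted domain is a tuple of points, so answering one object takes as many
moves as its dimension. -/
theorem Position.forth_list (hS : Good d X S) (hS' : Good d X S') (xs : List ℕ) :
    ∀ {W : List (ℕ × ℕ)}, Position d X S S' W → W.length + xs.length ≤ d → (∀ x ∈ xs, x ∈ S) →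
    ∃ xs' W', W ⊆ W' ∧ W'.length = W.length + xs.length ∧ Position d X S S' W' ∧ (∀ x ∈ xs', x ∈ S')
        ∧
      List.Forall₂ (fun a b => (a, b) ∈ W') xs xs' := by
  induction xs with
  | nil => exact fun h _ _ => ⟨[], _, List.Subset.refl _, rfl, h, by simp, .nil⟩
  | cons x xs ih =>
    intro W hW hd hxs
    rw [List.length_cons] at hd
    obtain ⟨x', hx', h⟩ := hW.forth hS hS' (by omega) (hxs x (by simp))
    obtain ⟨xs', W', h1, h2, h3, h4, h5⟩ := ih h (by rw [List.length_cons]; omega)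
      fun y hy => hxs y (by simp [hy])
    refine ⟨x' :: xs', W', fun _ hy => h1 (by simp [hy]), ?_, h3, ?_, .cons (h1 (by simp)) h5⟩
    · simp only [List.length_cons] at h2 ⊢
      omega
    · simpa [hx'] using h4

theorem Position.back_list (hS : Good d X S) (hS' : Good d X S') (xs' : List ℕ)
    {W : List (ℕ × ℕ)} (hW : Position d X S S' W) (hd : W.length + xs'.length ≤ d)
    (hxs : ∀ x ∈ xs', x ∈ S') :
    ∃ xs W', W ⊆ W' ∧ W'.length = W.length + xs'.length ∧ Position d X S S' W' ∧ (∀ x ∈ xs, x ∈ S) ∧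
      List.Forall₂ (fun a b => (a, b) ∈ W') xs xs' := by
  obtain ⟨xs, W', h1, h2, h3, h4, h5⟩ := hW.symm.forth_list hS' hS xs' (by simpa using hd) hxs
  refine ⟨xs, W'.map Prod.swap, fun a ha => ?_, by simpa using h2, h3.symm, h4, ?_⟩
  · exact List.mem_map.2 ⟨a.swap, h1 (List.mem_map_of_mem ha), by simp⟩
  · refine List.Forall₂.imp (fun a b h => ?_) h5.flip
    exact List.mem_map.2 ⟨(b, a), h, rfl⟩

/-! ### Evaluation of coded formulas in prestructures -/

/-- The data that give truth values to the formulas of a language: a domain, a relation that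
interprets identity, and for every symbol with number `h` a relation (the second argument is `none`
for relation symbols, and the value for function symbols). -/
structure PreStr (O : Type*) where
  /-- the domain -/
  Ob : O → Prop
  /-- identity -/
  EQ : O → O → Prop
  /-- relation symbols and graphs of function symbols -/
  HD : ℕ → List O → Option O → Prop

namespace PreStr

variable {O O' : Type*} (P : PreStr O)

theorem term_args_lt (c : ℕ) : c.unpair.1.unpair.2.unpair.2 < c + 1 :=
  Nat.lt_succ_of_le ((Nat.unpair_right_le _).trans ((Nat.unpair_right_le _).trans
    (Nat.unpair_left_le _)))

/-- `satArgs c env acc h y` says that some objects are the values of the terms coded by the list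
`c`, and that the symbol `h` holds of `acc` followed by these objects. -/
def satArgs (c : ℕ) (env acc : List O) (h : ℕ) (y : Option O) : Prop :=
  match c with
  | 0 => P.HD h acc y
  | c + 1 => ∃ x, P.Ob x ∧
      (if c.unpair.1.unpair.1 = 0 then ∃ z ∈ env[c.unpair.1.unpair.2 / 2]?, P.EQ z x
        else satArgs c.unpair.1.unpair.2.unpair.2 env [] c.unpair.1.unpair.2.unpair.1 (some x)) ∧
      satArgs c.unpair.2 env (acc ++ [x]) h y
termination_by c
decreasing_by
  · exact term_args_lt c
  · exact Nat.lt_succ_of_le (Nat.unpair_right_le _)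

/-- The object `x` is the value of the term with code `a`. -/
def satTerm (a : ℕ) (env : List O) (x : O) : Prop :=
  if a.unpair.1 = 0 then ∃ z ∈ env[a.unpair.2 / 2]?, P.EQ z x
  else P.satArgs a.unpair.2.unpair.2 env [] a.unpair.2.unpair.1 (some x)

theorem satArgs_zero (env acc : List O) (h : ℕ) (y : Option O) :
    P.satArgs 0 env acc h y ↔ P.HD h acc y := by
  rw [satArgs]

theorem satArgs_succ (c : ℕ) (env acc : List O) (h : ℕ) (y : Option O) :
    P.satArgs (c + 1) env acc h y ↔ ∃ x, P.Ob x ∧ P.satTerm c.unpair.1 env x ∧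
      P.satArgs c.unpair.2 env (acc ++ [x]) h y := by
  rw [satArgs]
  rfl

/-- Truth of the formula with code `k`. -/
def satForm (k : ℕ) (env : List O) : Prop :=
  if k.unpair.1 = 1 then
    if k.unpair.2.unpair.2.unpair.1 = 0 then
      ∃ y ∈ env[k.unpair.2.unpair.2.unpair.2 / 2]?, P.satTerm k.unpair.2.unpair.1 env y
    else ∃ y, P.Ob y ∧ P.satTerm k.unpair.2.unpair.1 env y ∧ P.satTerm k.unpair.2.unpair.2 env y
  else if k.unpair.1 = 2 then P.satArgs k.unpair.2.unpair.2 env [] k.unpair.2.unpair.1 none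
  else if _h : k.unpair.1 = 3 then satForm k.unpair.2.unpair.1 env → satForm k.unpair.2.unpair.2 env
  else if _h : k.unpair.1 = 4 then ∀ x, P.Ob x → satForm k.unpair.2 (env ++ [x])
  else False
termination_by k
decreasing_by
  · exact unpair_snd_fst_lt (by omega)
  · exact unpair_snd_snd_lt (by omega)
  · exact unpair_snd_lt (by omega)

/-- A back-and-forth system between two prestructures: `B r l` says that the game can be continued
for `r` rounds from the position in which the pairs in `l` have been chosen. -/
structure BackForth (P : PreStr O) (P' : PreStr O') (B : ℕ → List (O × O') → Prop) : Prop where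
  mono : ∀ {r s l}, B r l → s ≤ r → B s l
  eq : ∀ {r l}, B r l → ∀ a ∈ l, ∀ b ∈ l, P.EQ a.1 b.1 ↔ P'.EQ a.2 b.2
  hd : ∀ {r l}, B r l → ∀ h, ∀ acc ⊆ l, ∀ y : Option (O × O'), (∀ z ∈ y, z ∈ l) →
    (P.HD h (acc.map Prod.fst) (y.map Prod.fst) ↔ P'.HD h (acc.map Prod.snd) (y.map Prod.snd))
  forth : ∀ {r l}, B (r + 1) l → ∀ x, P.Ob x → ∃ x', P'.Ob x' ∧ B r ((x, x') :: l)
  back : ∀ {r l}, B (r + 1) l → ∀ x', P'.Ob x' → ∃ x, P.Ob x ∧ B r ((x, x') :: l)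

variable {P} {P' : PreStr O'} {B : ℕ → List (O × O') → Prop}

namespace BackForth

theorem exists_iff (hB : BackForth P P' B) {r : ℕ} {l : List (O × O')} (hl : B (r + 1) l)
    {p : O → Prop} {p' : O' → Prop} (hp : ∀ x x', B r ((x, x') :: l) → (p x ↔ p' x')) :
    (∃ x, P.Ob x ∧ p x) ↔ ∃ x', P'.Ob x' ∧ p' x' := by
  constructor
  · rintro ⟨x, hx, h⟩
    obtain ⟨x', hx', h'⟩ := hB.forth hl x hx
    exact ⟨x', hx', (hp _ _ h').1 h⟩
  · rintro ⟨x', hx', h⟩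
    obtain ⟨x, hx, h'⟩ := hB.back hl x' hx'
    exact ⟨x, hx, (hp _ _ h').2 h⟩

theorem forall_iff (hB : BackForth P P' B) {r : ℕ} {l : List (O × O')} (hl : B (r + 1) l)
    {p : O → Prop} {p' : O' → Prop} (hp : ∀ x x', B r ((x, x') :: l) → (p x ↔ p' x')) :
    (∀ x, P.Ob x → p x) ↔ ∀ x', P'.Ob x' → p' x' := by
  have := not_congr (hB.exists_iff hl (p := fun x => ¬ p x) (p' := fun x => ¬ p' x)
    fun x x' h => not_congr (hp x x' h))
  push Not at this
  exact this

theorem var_iff (hB : BackForth P P' B) {r : ℕ} {l env : List (O × O')} (hl : B r l)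
    (henv : env ⊆ l) {x : O × O'} (hx : x ∈ l) (i : ℕ) :
    (∃ z ∈ (env.map Prod.fst)[i]?, P.EQ z x.1) ↔ ∃ z ∈ (env.map Prod.snd)[i]?, P'.EQ z x.2 := by
  rw [List.getElem?_map, List.getElem?_map]
  rcases h : env[i]? with _ | z
  · simp
  · simpa using hB.eq hl z (henv (List.mem_of_getElem? h)) x hx

/-- Again the code bounds the number of rounds: each object chosen for an argument is paid for by
passing to the code of that argument's own arguments or of the remaining list, both strictly
smaller. The two conjuncts do not share the budget, since each continues from the same position. -/
theorem satArgs_iff (hB : BackForth P P' B) (c : ℕ) : ∀ {r : ℕ} {l env acc : List (O × O')}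
    {h : ℕ} {y : Option (O × O')}, c ≤ r → B r l → env ⊆ l → acc ⊆ l → (∀ z ∈ y, z ∈ l) →
    (P.satArgs c (env.map Prod.fst) (acc.map Prod.fst) h (y.map Prod.fst) ↔
      P'.satArgs c (env.map Prod.snd) (acc.map Prod.snd) h (y.map Prod.snd)) := by
  induction c using Nat.strong_induction_on with
  | _ c ih =>
    intro r l env acc h y hr hl henv hacc hy
    rcases c with _ | c
    · rw [satArgs_zero, satArgs_zero]
      exact hB.hd hl h acc hacc y hy
    · rw [satArgs_succ, satArgs_succ]
      refine hB.exists_iff (r := c) (hB.mono hl hr) fun x x' hx => ?_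
      have henv' : env ⊆ (x, x') :: l := fun _ hz => List.mem_cons_of_mem _ (henv hz)
      refine and_congr ?_ ?_
      · rw [satTerm, satTerm]
        split_ifs with h0
        · exact hB.var_iff hx henv' (x := (x, x')) (by simp) _
        · have := ih _ (term_args_lt c) (Nat.le_of_lt_succ (term_args_lt c)) hx henv'
            (acc := []) (h := c.unpair.1.unpair.2.unpair.1) (List.nil_subset _)
            (y := some (x, x')) (by simp)
          simpa using this
      · have := ih c.unpair.2 (Nat.lt_succ_of_le (Nat.unpair_right_le _)) (Nat.unpair_right_le _)
          hx henv' (acc := acc ++ [(x, x')]) (h := h) (y := y)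
          (by
            intro z hz
            rw [List.mem_append, List.mem_singleton] at hz
            rcases hz with hz | rfl
            · exact List.mem_cons_of_mem _ (hacc hz)
            · simp)
          (fun z hz => List.mem_cons_of_mem _ (hy z hz))
        simpa using this

theorem satTerm_iff (hB : BackForth P P' B) {a r : ℕ} {l env : List (O × O')} (hr : a ≤ r)
    (hl : B r l) (henv : env ⊆ l) {x : O × O'} (hx : x ∈ l) :
    P.satTerm a (env.map Prod.fst) x.1 ↔ P'.satTerm a (env.map Prod.snd) x.2 := by
  rw [satTerm, satTerm]
  split_ifs
  · exact hB.var_iff hl henv hx _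
  · have := hB.satArgs_iff a.unpair.2.unpair.2 (((Nat.unpair_right_le _).trans
      (Nat.unpair_right_le _)).trans hr) hl henv (acc := []) (h := a.unpair.2.unpair.1)
      (List.nil_subset _) (y := some x) (by simpa using hx)
    simpa using this

/-- The list `l` records every pair played, and `env` only the current values of the variables.
Asking for `env ⊆ l` rather than equality lets a move be added without regard to order. -/
theorem satForm_iff (hB : BackForth P P' B) (k : ℕ) : ∀ {r : ℕ} {l env : List (O × O')},
    k ≤ r → B r l → env ⊆ l →
    (P.satForm k (env.map Prod.fst) ↔ P'.satForm k (env.map Prod.snd)) := by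
  induction k using Nat.strong_induction_on with
  | _ k ih =>
    intro r l env hr hl henv
    rw [satForm.eq_def P k, satForm.eq_def P' k]
    split_ifs with h1 h2 h3 h4 h5
    · have l1 := unpair_snd_fst_lt (c := k) (by omega)
      rw [List.getElem?_map, List.getElem?_map]
      rcases h : env[k.unpair.2.unpair.2.unpair.2 / 2]? with _ | z
      · simp
      · simpa using hB.satTerm_iff (l1.le.trans hr) hl henv (henv (List.mem_of_getElem? h))
    · have l1 := unpair_snd_fst_lt (c := k) (by omega)
      have l2 := unpair_snd_snd_lt (c := k) (by omega)
      refine hB.exists_iff (r := k - 1) (hB.mono hl (by omega)) fun x x' hx => ?_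
      have henv' : env ⊆ (x, x') :: l := fun _ hz => List.mem_cons_of_mem _ (henv hz)
      exact and_congr
        (hB.satTerm_iff (Nat.le_pred_of_lt l1) hx henv' (x := (x, x')) (by simp))
        (hB.satTerm_iff (Nat.le_pred_of_lt l2) hx henv' (x := (x, x')) (by simp))
    · have l2 := unpair_snd_snd_lt (c := k) (by omega)
      simpa using hB.satArgs_iff k.unpair.2.unpair.2 (l2.le.trans hr) hl henv (acc := [])
        (h := k.unpair.2.unpair.1) (List.nil_subset _) (y := none) (by simp)
    · have l1 := unpair_snd_fst_lt (c := k) (by omega)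
      have l2 := unpair_snd_snd_lt (c := k) (by omega)
      rw [ih _ l1 (l1.le.trans hr) hl henv, ih _ l2 (l2.le.trans hr) hl henv]
    · have l1 := unpair_snd_lt (c := k) (by omega)
      refine hB.forall_iff (r := k - 1) (hB.mono hl (by omega)) fun x x' hx => ?_
      have := ih _ l1 (Nat.le_pred_of_lt l1) hx (env := env ++ [(x, x')]) (by
            intro z hz
            rw [List.mem_append, List.mem_singleton] at hz
            rcases hz with hz | rfl
            · exact List.mem_cons_of_mem _ (henv hz)
            · simp)
      simpa using this
    · rfl

end BackForth

end PreStr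

/-! ### Coded translations -/

/-- A finite table of numbers. -/
abbrev Table : Type := List (List ℕ × ℕ)

/-- The entry of a table, `0` if there is none. -/
def Table.get (t : Table) (key : List ℕ) : ℕ := (t.lookup key).getD 0

/-- The sum of all entries of a table. -/
def Table.sum (t : Table) : ℕ := (t.map Prod.snd).sum

/-- Makes `TrCode.bound` dominate whatever the tables return, including the default `0` at a missing
key. -/
theorem Table.get_le_sum (t : Table) (key : List ℕ) : t.get key ≤ t.sum := by
  induction t with
  | nil => simp [Table.get]
  | cons a t ih =>
    obtain ⟨k, v⟩ := a
    simp only [Table.get, Table.sum, List.lookup_cons, List.map_cons, List.sum_cons] at ih ⊢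
    split
    · simp
    · exact ih.trans (Nat.le_add_left _ _)

/-- The code of a translation into the language of equivalence relations: the number of pieces, the
number of parameters, the formula for the admissible parameters, and tables for the dimensions, the
domains, identity, relation symbols and function symbols. -/
abbrev TrCode : Type := (ℕ × ℕ × ℕ) × Table × Table × Table × Table × Table

namespace TrCode

variable (e : TrCode)

/-- the number of pieces -/
def npieces : ℕ := e.1.1
/-- the number of parameters -/
def npar : ℕ := e.1.2.1
/-- the formula for the admissible parameters -/
def par : ℕ := e.1.2.2
/-- the dimensions -/
def dim : Table := e.2.1
/-- the domains of the pieces -/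
def dom : Table := e.2.2.1
/-- identity -/
def eq : Table := e.2.2.2.1
/-- relation symbols -/
def rel : Table := e.2.2.2.2.1
/-- function symbols -/
def fn : Table := e.2.2.2.2.2

/-- A bound for all numbers in the code. -/
def bound : ℕ := e.npar + e.par + (e.dim.sum + (e.dom.sum + (e.eq.sum + (e.rel.sum + e.fn.sum))))

/-- The prestructure that the translation defines in `S` with parameters `p`. -/
def pre (S : Set ℕ) (p : List ℕ) : PreStr (ℕ × List ℕ) where
  Ob o := o.1 < e.npieces ∧ o.2.length = e.dim.get [o.1] ∧ (∀ x ∈ o.2, x ∈ S) ∧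
    satK S (e.dom.get [o.1]) (p ++ o.2)
  EQ o o' := satK S (e.eq.get [o.1, o'.1]) (p ++ (o.2 ++ o'.2))
  HD h acc y := match y with
    | none => satK S (e.rel.get (h :: acc.map Prod.fst)) (p ++ (acc.map Prod.snd).flatten)
    | some y => satK S (e.fn.get (h :: y.1 :: acc.map Prod.fst))
        (p ++ ((acc.map Prod.snd).flatten ++ y.2))

/-- `p` is an admissible tuple of parameters in `S`. -/
def Admissible (S : Set ℕ) (p : List ℕ) : Prop :=
  p.length = e.npar ∧ (∀ x ∈ p, x ∈ S) ∧ satK S e.par p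

/-- There are admissible parameters in `S`, and for all of them the formula with code `k` holds in
the sense of the translation. -/
def Hold (S : Set ℕ) (k : ℕ) : Prop :=
  (∃ p, e.Admissible S p) ∧ ∀ p, e.Admissible S p → (e.pre S p).satForm k []

/-- The formula with code `k` depends, in the sense of the translation, only on the classes below
this bound. -/
def use (k : ℕ) : ℕ := (e.bound + 1) * (k + 3)

variable {d : ℕ} {X S S' : Set ℕ}

/-- A position between objects is a position between points containing the parameters and all
coordinates. Each of the `r` remaining rounds costs at most `e.bound` moves, as this bounds every
dimension. The last `e.bound` is reserved for evaluating a formula of the translation, whose code it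
also bounds. -/
theorem backForth (hS : Good d X S) (hS' : Good d X S') (p p' : List ℕ) :
    (e.pre S p).BackForth (e.pre S' p') fun r l => ∃ W, Position d X S S' W ∧
      List.Forall₂ (fun a b => (a, b) ∈ W) p p' ∧
      (∀ o ∈ l, o.1.1 = o.2.1 ∧ List.Forall₂ (fun a b => (a, b) ∈ W) o.1.2 o.2.2) ∧
      W.length + r * e.bound + e.bound ≤ d := by
  have hacc : ∀ {W : List (ℕ × ℕ)} {l acc : List ((ℕ × List ℕ) × (ℕ × List ℕ))}, acc ⊆ l →
      (∀ o ∈ l, o.1.1 = o.2.1 ∧ List.Forall₂ (fun a b => (a, b) ∈ W) o.1.2 o.2.2) →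
      (acc.map Prod.fst).map Prod.fst = (acc.map Prod.snd).map Prod.fst ∧
      List.Forall₂ (fun a b => (a, b) ∈ W) ((acc.map Prod.fst).map Prod.snd).flatten
        ((acc.map Prod.snd).map Prod.snd).flatten := by
    intro W l acc h1 h2
    constructor
    · simpa using fun a b c d h => (h2 _ (h1 h)).1
    · refine List.rel_flatten ?_
      rw [List.map_map, List.map_map, List.forall₂_map_left_iff, List.forall₂_map_right_iff,
        List.forall₂_same]
      exact fun o ho => (h2 o (h1 ho)).2
  have hdom : ∀ {W : List (ℕ × ℕ)} {o o' : ℕ × List ℕ}, Position d X S S' W →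
      List.Forall₂ (fun a b => (a, b) ∈ W) p p' →
      List.Forall₂ (fun a b => (a, b) ∈ W) o.2 o'.2 → o.1 = o'.1 → W.length + e.bound ≤ d →
      (satK S (e.dom.get [o.1]) (p ++ o.2) ↔ satK S' (e.dom.get [o'.1]) (p' ++ o'.2)) := by
    intro W o o' h1 h2 h3 h4 h5
    have := e.dom.get_le_sum [o.1]
    rw [← h4]
    exact satK_congr hS hS' _ h1 (List.rel_append h2 h3) (by unfold bound at h5; omega)
  constructor
  · rintro r s l ⟨W, h1, h2, h3, h4⟩ hrs
    have := Nat.mul_le_mul_right e.bound hrs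
    exact ⟨W, h1, h2, h3, by omega⟩
  · rintro r l ⟨W, h1, h2, h3, h4⟩ a ha b hb
    obtain ⟨ha1, ha2⟩ := h3 a ha
    obtain ⟨hb1, hb2⟩ := h3 b hb
    have := e.eq.get_le_sum [a.1.1, b.1.1]
    simp only [pre, ← ha1, ← hb1]
    exact satK_congr hS hS' _ h1 (List.rel_append h2 (List.rel_append ha2 hb2))
      (by unfold bound at h4; omega)
  · rintro r l ⟨W, h1, h2, h3, h4⟩ h acc hl y hy
    obtain ⟨e1, e2⟩ := hacc hl h3
    rcases y with _ | y
    · simp only [pre, Option.map_none, e1]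
      have := e.rel.get_le_sum (h :: (acc.map Prod.snd).map Prod.fst)
      exact satK_congr hS hS' _ h1 (List.rel_append h2 e2) (by unfold bound at h4; omega)
    · obtain ⟨hy1, hy2⟩ := h3 y (hy y rfl)
      simp only [pre, Option.map_some, e1, hy1]
      have := e.fn.get_le_sum (h :: y.2.1 :: (acc.map Prod.snd).map Prod.fst)
      exact satK_congr hS hS' _ h1 (List.rel_append h2 (List.rel_append e2 hy2))
        (by unfold bound at h4; omega)
  · rintro r l ⟨W, h1, h2, h3, h4⟩ x ⟨hx1, hx2, hx3, hx4⟩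
    have hb : x.2.length ≤ e.bound := by
      have := e.dim.get_le_sum [x.1]
      unfold bound
      omega
    rw [Nat.succ_mul] at h4
    obtain ⟨xs', W', g1, g2, g3, g4, g5⟩ := h1.forth_list hS hS' x.2 (by omega) hx3
    refine ⟨(x.1, xs'), ⟨hx1, g5.length_eq ▸ hx2, g4, ?_⟩, W', g3, forall₂_mem_mono h2 g1, ?_,
      by omega⟩
    · exact (hdom (o := x) (o' := (x.1, xs')) g3 (forall₂_mem_mono h2 g1) g5 rfl (by omega)).1 hx4
    · rw [List.forall_mem_cons]
      exact ⟨⟨rfl, g5⟩, fun o ho => ⟨(h3 o ho).1, forall₂_mem_mono (h3 o ho).2 g1⟩⟩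
  · rintro r l ⟨W, h1, h2, h3, h4⟩ x ⟨hx1, hx2, hx3, hx4⟩
    have hb : x.2.length ≤ e.bound := by
      have := e.dim.get_le_sum [x.1]
      unfold bound
      omega
    rw [Nat.succ_mul] at h4
    obtain ⟨xs', W', g1, g2, g3, g4, g5⟩ := h1.back_list hS hS' x.2 (by omega) hx3
    refine ⟨(x.1, xs'), ⟨hx1, g5.length_eq ▸ hx2, g4, ?_⟩, W', g3, forall₂_mem_mono h2 g1, ?_,
      by omega⟩
    · exact (hdom (o := (x.1, xs')) (o' := x) g3 (forall₂_mem_mono h2 g1) g5 rfl (by omega)).2 hx4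
    · rw [List.forall_mem_cons]
      exact ⟨⟨rfl, g5⟩, fun o ho => ⟨(h3 o ho).1, forall₂_mem_mono (h3 o ho).2 g1⟩⟩

/-- The parameters are the first moves of the game, made from the empty position. After them the
back-and-forth system on objects has enough moves left for a sentence with code `k`. -/
theorem hold_congr {k : ℕ} (hd : e.use k ≤ d) (hS : Good d X S) (hS' : Good d X S') :
    e.Hold S k ↔ e.Hold S' k := by
  -- The cost is at most `e.bound` for the parameters, `k` rounds of at most `e.bound` each, and
  -- `e.bound` for a formula of the translation. The third `e.bound` is slack.
  have hd' : e.bound * k + 3 * e.bound ≤ d := by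
    unfold use at hd
    nlinarith
  have hpar : e.npar + e.par ≤ e.bound := by
    unfold bound
    omega
  have key : ∀ {p p' W}, Position d X S S' W → List.Forall₂ (fun a b => (a, b) ∈ W) p p' →
      W.length = e.npar → (satK S e.par p ↔ satK S' e.par p') ∧
      ((e.pre S p).satForm k [] ↔ (e.pre S' p').satForm k []) := by
    intro p p' W h1 h2 h3
    refine ⟨satK_congr hS hS' _ h1 h2 (by omega), ?_⟩
    exact (e.backForth hS hS' p p').satForm_iff k le_rfl (l := []) (env := [])
      ⟨W, h1, h2, by simp, by rw [mul_comm]; omega⟩ (List.nil_subset _)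
  have forth : ∀ p, e.Admissible S p → ∃ p', e.Admissible S' p' ∧
      ((e.pre S p).satForm k [] ↔ (e.pre S' p').satForm k []) := by
    rintro p ⟨h1, h2, h3⟩
    obtain ⟨p', W, g1, g2, g3, g4, g5⟩ := Position.nil.forth_list hS hS' p
      (by rw [List.length_nil]; omega) h2
    obtain ⟨k1, k2⟩ := key g3 g5 (by simpa [h1] using g2)
    exact ⟨p', ⟨g5.length_eq ▸ h1, g4, k1.1 h3⟩, k2⟩
  have back : ∀ p', e.Admissible S' p' → ∃ p, e.Admissible S p ∧
      ((e.pre S p).satForm k [] ↔ (e.pre S' p').satForm k []) := by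
    rintro p ⟨h1, h2, h3⟩
    obtain ⟨p', W, g1, g2, g3, g4, g5⟩ := Position.nil.back_list hS hS' p
      (by rw [List.length_nil]; omega) h2
    obtain ⟨k1, k2⟩ := key g3 g5 (by simpa [h1] using g2)
    exact ⟨p', ⟨g5.length_eq ▸ h1, g4, k1.2 h3⟩, k2⟩
  constructor
  · rintro ⟨⟨p, hp⟩, H⟩
    refine ⟨(forth p hp).imp fun _ h => h.1, fun p' hp' => ?_⟩
    obtain ⟨p, hp, h⟩ := back p' hp'
    exact h.1 (H p hp)
  · rintro ⟨⟨p, hp⟩, H⟩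
    refine ⟨(back p hp).imp fun _ h => h.1, fun p' hp' => ?_⟩
    obtain ⟨p, hp, h⟩ := forth p' hp'
    exact h.2 (H p hp)

end TrCode

/-! ### The equivalence structures `points Y` and their finite parts -/

/-- The equivalence structure whose class `n` has `n + 1` elements if `n ∈ Y`, and is infinite
otherwise. -/
def points (Y : Set ℕ) : Set ℕ := {x | cls x ∈ Y → x.unpair.2 ≤ cls x}

/-- The finite part of `points Y` in a square of side `b`. -/
def pointsBelow (Y : Set ℕ) (b : ℕ) : Set ℕ := {x | x ∈ points Y ∧ cls x < b ∧ x.unpair.2 < b}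

/-- A class with number `n ≥ d` has at least `n + 1 > d` elements whether or not `n ∈ Y`, so it
counts as large. Only the part of `Y` below `d` matters. -/
theorem good_points {Y : Set ℕ} (h : ∀ n < d, n ∈ X ↔ n ∈ Y) : Good d X (points Y) where
  small n hn hX j := by simp [points, (h n hn).1 hX]
  large x hx hX j hj := by
    simp only [points, Set.mem_ofPred_eq, cls_pair, Nat.unpair_pair]
    intro hY
    by_contra hlt
    exact hX ⟨by omega, (h _ (by omega)).2 hY⟩
  zero n _ := by simp [points]

/-- The side `2 * d` keeps the small classes whole, leaves at least `d` points in the others, and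
retains the `d` classes from `d` on. This is how truth in an infinite structure becomes a finite
computation. -/
theorem good_pointsBelow {Y : Set ℕ} (h : ∀ n < d, n ∈ X ↔ n ∈ Y) :
    Good d X (pointsBelow Y (2 * d)) where
  small n hn hX j := by
    rw [← (good_points h).small n hn hX j]
    simp only [pointsBelow, Set.mem_ofPred_eq, cls_pair, Nat.unpair_pair, and_iff_left_iff_imp]
    intro hj
    rw [(good_points h).small n hn hX j] at hj
    omega
  large x hx hX j hj := by
    refine ⟨(good_points h).large x hx.1 hX j hj, by simpa using hx.2.1, ?_⟩
    rw [Nat.unpair_pair]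
    change j < 2 * d
    omega
  zero n hn := by
    refine ⟨(good_points h).zero n hn, by simpa using hn, ?_⟩
    rw [Nat.unpair_pair]
    change 0 < 2 * d
    omega

end Evaluation

end Interp

namespace Interp

/-! ### Evaluation over finite sets is primitive recursive -/

section PrimitiveRecursion

theorem PrimrecPred_connective {α : Type*} [Primcodable α] (C : Prop → Prop → Prop)
    {p q : α → Prop} (hp : PrimrecPred p) (hq : PrimrecPred q) :
    PrimrecPred fun a => C (p a) (q a) := by
  classical
  refine Primrec.primrecPred (((Primrec.dom_bool₂ fun x y => decide (C (x = true) (y = true))).comp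
    hp.decide hq.decide).of_eq fun a => ?_)
  simp

theorem PrimrecPred_imp {α : Type*} [Primcodable α] {p q : α → Prop} (hp : PrimrecPred p)
    (hq : PrimrecPred q) : PrimrecPred fun a => p a → q a :=
  (hp.not.or hq).of_eq fun _ => imp_iff_not_or.symm

theorem PrimrecPred_ite {α : Type*} [Primcodable α] {c p q : α → Prop} [DecidablePred c]
    (hc : PrimrecPred c) (hp : PrimrecPred p) (hq : PrimrecPred q) :
    PrimrecPred fun a => if c a then p a else q a :=
  ((hc.and hp).or (hc.not.and hq)).of_eq fun a => by by_cases h : c a <;> simp [h]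

theorem PrimrecPred_exists_mem {α β : Type*} [Primcodable α] [Primcodable β] {L : α → List β}
    (hL : Primrec L) {R : α → β → Prop} (hR : PrimrecPred fun q : α × β => R q.1 q.2) :
    PrimrecPred fun a => ∃ b ∈ L a, R a b :=
  PrimrecRel.comp (PrimrecRel.exists_mem_list (R := fun b a => R a b)
    (hR.comp (Primrec.snd.pair Primrec.fst))) hL Primrec.id

theorem PrimrecPred_forall_mem {α β : Type*} [Primcodable α] [Primcodable β] {L : α → List β}
    (hL : Primrec L) {R : α → β → Prop} (hR : PrimrecPred fun q : α × β => R q.1 q.2) :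
    PrimrecPred fun a => ∀ b ∈ L a, R a b :=
  PrimrecRel.comp (PrimrecRel.forall_mem_list (R := fun b a => R a b)
    (hR.comp (Primrec.snd.pair Primrec.fst))) hL Primrec.id

theorem primrec_unpair_fst : Primrec fun n : ℕ => n.unpair.1 := Primrec.fst.comp Primrec.unpair

theorem primrec_unpair_snd : Primrec fun n : ℕ => n.unpair.2 := Primrec.snd.comp Primrec.unpair

theorem primrec_cls : Primrec cls := primrec_unpair_fst

/-- A predicate that is defined by recursion on codes of formulas is primitive recursive, if the
quantifiers range over finite lists. Here `i` and `j` are the tags of implications and universal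
quantifications, and `C` is the way in which the values for the two parts of an implication are
combined. -/
theorem primrecPred_of_formula_rec {Γ O : Type*} [Primcodable Γ] [Primcodable O] {i j : ℕ}
    (C : Prop → Prop → Prop) (hi : i ≠ 0) (hj : j ≠ 0) {L : Γ → List O} (hL : Primrec L)
      {At : Γ × ℕ × List O → Prop}
    (hAt : PrimrecPred At) {F : Γ → ℕ → List O → Prop}
    (hF : ∀ γ k env, F γ k env ↔
      if k.unpair.1 = i then C (F γ k.unpair.2.unpair.1 env) (F γ k.unpair.2.unpair.2 env)
      else if k.unpair.1 = j then ∀ x ∈ L γ, F γ k.unpair.2 (env ++ [x])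
      else At (γ, k, env)) :
    PrimrecPred fun q : Γ × ℕ × List O => F q.1 q.2.1 q.2.2 := by
  classical
  let f : Γ → ℕ × List O → Bool := fun γ b => decide (F γ b.1 b.2)
  -- Course-of-values recursion with the code as measure: `l` lists the subproblems, and `G`
  -- combines their answers, which arrive in the same order.
  let l : Γ → ℕ × List O → List (ℕ × List O) := fun γ b =>
    if b.1.unpair.1 = i then [(b.1.unpair.2.unpair.1, b.2), (b.1.unpair.2.unpair.2, b.2)]
    else if b.1.unpair.1 = j then (L γ).map fun x => (b.1.unpair.2, b.2 ++ [x])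
    else []
  let G : Γ × (ℕ × List O) × List Bool → Prop := fun q =>
    if q.2.1.1.unpair.1 = i then C (q.2.2[0]? = some true) (q.2.2[1]? = some true)
    else if q.2.1.1.unpair.1 = j then ∀ x ∈ q.2.2, x = true
    else At (q.1, q.2.1.1, q.2.1.2)
  have tag : ∀ n, PrimrecPred fun q : Γ × ℕ × List O => q.2.1.unpair.1 = n := fun n =>
    Primrec.eq.comp (primrec_unpair_fst.comp (Primrec.fst.comp Primrec.snd)) (Primrec.const n)
  have arg : Primrec fun q : Γ × ℕ × List O => q.2.1.unpair.2 :=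
    primrec_unpair_snd.comp (Primrec.fst.comp Primrec.snd)
  have env : Primrec fun q : Γ × ℕ × List O => q.2.2 := Primrec.snd.comp Primrec.snd
  have hl : Primrec₂ l := by
    refine Primrec.ite (tag i) ?_ (Primrec.ite (tag j) ?_ (Primrec.const []))
    · exact Primrec.list_cons.comp ((primrec_unpair_fst.comp arg).pair env)
        (Primrec.list_cons.comp ((primrec_unpair_snd.comp arg).pair env) (Primrec.const []))
    · refine Primrec.list_map (hL.comp Primrec.fst) ?_
      exact (arg.comp Primrec.fst).pair (Primrec.list_concat.comp (env.comp Primrec.fst)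
        Primrec.snd)
  have pr : Primrec fun q : Γ × (ℕ × List O) × List Bool => (q.1, q.2.1) :=
    Primrec.fst.pair (Primrec.fst.comp Primrec.snd)
  have res : Primrec fun q : Γ × (ℕ × List O) × List Bool => q.2.2 := Primrec.snd.comp Primrec.snd
  have hG : PrimrecPred G := by
    refine PrimrecPred_ite ((tag i).comp pr) (PrimrecPred_connective C ?_ ?_)
      (PrimrecPred_ite ((tag j).comp pr) ?_ (hAt.comp pr))
    · exact Primrec.eq.comp (Primrec.list_getElem?.comp res (Primrec.const 0)) (Primrec.const _)
    · exact Primrec.eq.comp (Primrec.list_getElem?.comp res (Primrec.const 1)) (Primrec.const _)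
    · exact PrimrecPred_forall_mem res (R := fun _ b => b = true)
        (Primrec.eq.comp Primrec.snd (Primrec.const true))
  have := Primrec.nat_omega_rec (α := Γ) (β := ℕ × List O) f (m := fun _ b => b.1) (l := l)
    (g := fun γ q => some (decide (G (γ, q)))) (Primrec.fst.comp Primrec.snd) hl
    (Primrec.option_some.comp hG.decide) ?_ ?_
  · exact (Primrec.primrecPred (p := fun q : Γ × ℕ × List O => F q.1 q.2.1 q.2.2) this)
  · rintro γ ⟨k, env⟩ ⟨k', env'⟩ h
    simp only [l] at h ⊢
    split_ifs at h with h1 h2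
    · have l1 := unpair_snd_fst_lt (c := k) (by omega)
      have l2 := unpair_snd_snd_lt (c := k) (by omega)
      simp only [List.mem_cons, Prod.mk.injEq, List.not_mem_nil, or_false] at h
      omega
    · have l1 := unpair_snd_lt (c := k) (by omega)
      simp only [List.mem_map, Prod.mk.injEq] at h
      obtain ⟨x, -, h, -⟩ := h
      omega
    · simp at h
  · rintro γ ⟨k, env⟩
    simp only [Option.some.injEq, f, decide_eq_decide, G, l]
    rw [hF γ k env]
    split_ifs <;> simp

variable {γ : Type*} [Primcodable γ]

theorem primrecPred_satK :
    PrimrecPred fun q : List ℕ × ℕ × List ℕ => satK {x | x ∈ q.1} q.2.1 q.2.2 := by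
  have v : Primrec fun q : List ℕ × ℕ × List ℕ => q.2.2 := Primrec.snd.comp Primrec.snd
  have tag : ∀ n, PrimrecPred fun q : List ℕ × ℕ × List ℕ => q.2.1.unpair.1 = n := fun n =>
    Primrec.eq.comp (primrec_unpair_fst.comp (Primrec.fst.comp Primrec.snd)) (Primrec.const n)
  have arg : Primrec fun q : List ℕ × ℕ × List ℕ => q.2.1.unpair.2 :=
    primrec_unpair_snd.comp (Primrec.fst.comp Primrec.snd)
  have v1 := Primrec.list_getElem?.comp v (primrec_unpair_fst.comp arg)
  have v2 := Primrec.list_getElem?.comp v (primrec_unpair_snd.comp arg)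
  refine primrecPred_of_formula_rec (Γ := List ℕ) (O := ℕ) (i := 2) (j := 3)
    (fun p q => p → q) (by simp) (by simp)
    (L := id) Primrec.id (At := fun q => if q.2.1.unpair.1 = 0 then
      q.2.2[q.2.1.unpair.2.unpair.1]? = q.2.2[q.2.1.unpair.2.unpair.2]? else
      q.2.1.unpair.1 = 1 ∧ q.2.2[q.2.1.unpair.2.unpair.1]?.map cls =
        q.2.2[q.2.1.unpair.2.unpair.2]?.map cls) ?_ (F := fun els => satK {x | x ∈ els}) ?_
  · refine PrimrecPred_ite (tag 0) (Primrec.eq.comp v1 v2) ((tag 1).and (Primrec.eq.comp ?_ ?_))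
    · exact Primrec.option_map v1 (primrec_cls.comp Primrec.snd)
    · exact Primrec.option_map v2 (primrec_cls.comp Primrec.snd)
  · intro els k env
    rw [satK]
    by_cases h2 : k.unpair.1 = 2
    · simp [h2]
    by_cases h3 : k.unpair.1 = 3
    · simp [h3]
    by_cases h0 : k.unpair.1 = 0
    · simp [h0]
    by_cases h1 : k.unpair.1 = 1
    · simp [h1]
    simp [h0, h1, h2, h3]

theorem primrecPred_satK_comp {els : γ → List ℕ} {c : γ → ℕ} {v : γ → List ℕ} (hels : Primrec els)
    (hc : Primrec c) (hv : Primrec v) : PrimrecPred fun a => satK {x | x ∈ els a} (c a) (v a) :=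
  primrecPred_satK.comp (hels.pair (hc.pair hv))

theorem primrec_tableGet : Primrec₂ Table.get := by
  have h := Primrec.option_getD.comp (Primrec.listLookup.comp (α := Table × List ℕ)
    Primrec.snd Primrec.fst) (Primrec.const 0)
  -- The lookup theorem and `Table.get` compare keys by two different Boolean equalities on `List
  -- ℕ`. Both are lawful and therefore equal.
  rw [lawful_beq_subsingleton (instBEqOfDecidableEq : BEq (List ℕ)) inferInstance] at h
  exact h

theorem primrec_idxOf :
    Primrec₂ fun (x : ℕ × List ℕ) (l : List (ℕ × List ℕ)) => l.idxOf x := by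
  have h := Primrec.list_idxOf (α := ℕ × List ℕ)
  rw [lawful_beq_subsingleton (instBEqOfDecidableEq : BEq (ℕ × List ℕ)) inferInstance] at h
  exact h

theorem primrec_list_sum : Primrec (List.sum : List ℕ → ℕ) := by
  refine Primrec.of_eq (Primrec.list_foldr (f := fun l : List ℕ => l) (g := fun _ => 0)
    (h := fun _ (q : ℕ × ℕ) => q.1 + q.2) Primrec.id (Primrec.const 0) ?_) fun l => ?_
  · exact Primrec.nat_add.comp (Primrec.fst.comp Primrec.snd) (Primrec.snd.comp Primrec.snd)
  · rw [List.sum_eq_foldr]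

theorem primrec_tableSum : Primrec Table.sum :=
  primrec_list_sum.comp (Primrec.list_map Primrec.id (Primrec.snd.comp Primrec.snd))

/-! ### Finite search over tuples and objects -/

/-- The lists of length `n` with entries in `els`. -/
def tuples (els : List ℕ) (n : ℕ) : List (List ℕ) :=
  Nat.rec [[]] (fun _ acc => els.flatMap fun x => acc.map (x :: ·)) n

theorem primrec_tuples : Primrec₂ tuples := by
  refine Primrec.nat_rec (f := fun _ : List ℕ => [[]]) (g := fun els (q : ℕ × List (List ℕ)) =>
    els.flatMap fun x => q.2.map (x :: ·)) (Primrec.const [[]]) ?_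
  refine Primrec.list_flatMap Primrec.fst ?_
  refine Primrec.list_map (Primrec.snd.comp (Primrec.snd.comp Primrec.fst)) ?_
  exact Primrec.list_cons.comp (Primrec.snd.comp Primrec.fst) Primrec.snd

theorem mem_tuples {els : List ℕ} {n : ℕ} {xs : List ℕ} :
    xs ∈ tuples els n ↔ xs.length = n ∧ ∀ x ∈ xs, x ∈ els := by
  induction n generalizing xs with
  | zero =>
    change xs ∈ [[]] ↔ _
    simp only [List.mem_singleton, List.length_eq_zero_iff]
    exact ⟨fun h => ⟨h, by simp [h]⟩, fun h => h.1⟩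
  | succ n ih =>
    have : tuples els (n + 1) = els.flatMap fun x => (tuples els n).map (x :: ·) := rfl
    rw [this]
    simp only [List.mem_flatMap, List.mem_map, ih]
    constructor
    · rintro ⟨x, hx, ys, ⟨h1, h2⟩, rfl⟩
      exact ⟨by simp [h1], by simpa [hx] using h2⟩
    · rcases xs with _ | ⟨x, xs⟩
      · simp
      · rintro ⟨h1, h2⟩
        exact ⟨x, h2 x (by simp), xs, ⟨by simpa using h1, fun y hy => h2 y (by simp [hy])⟩, rfl⟩

namespace TrCode

theorem primrec_npieces : Primrec npieces := Primrec.fst.comp Primrec.fst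
theorem primrec_npar : Primrec npar := Primrec.fst.comp (Primrec.snd.comp Primrec.fst)
theorem primrec_par : Primrec par := Primrec.snd.comp (Primrec.snd.comp Primrec.fst)
theorem primrec_dim : Primrec dim := Primrec.fst.comp Primrec.snd
theorem primrec_dom : Primrec dom := Primrec.fst.comp (Primrec.snd.comp Primrec.snd)
theorem primrec_eq : Primrec eq :=
  Primrec.fst.comp (Primrec.snd.comp (Primrec.snd.comp Primrec.snd))
theorem primrec_rel : Primrec rel :=
  Primrec.fst.comp (Primrec.snd.comp (Primrec.snd.comp (Primrec.snd.comp Primrec.snd)))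
theorem primrec_fn : Primrec fn :=
  Primrec.snd.comp (Primrec.snd.comp (Primrec.snd.comp (Primrec.snd.comp Primrec.snd)))

theorem primrec_bound : Primrec bound :=
  Primrec.nat_add.comp (Primrec.nat_add.comp primrec_npar primrec_par)
    (Primrec.nat_add.comp (primrec_tableSum.comp primrec_dim)
    (Primrec.nat_add.comp (primrec_tableSum.comp primrec_dom)
    (Primrec.nat_add.comp (primrec_tableSum.comp primrec_eq)
    (Primrec.nat_add.comp (primrec_tableSum.comp primrec_rel)
    (primrec_tableSum.comp primrec_fn)))))

theorem primrec_use : Primrec₂ use :=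
  Primrec.nat_mul.comp (Primrec.succ.comp (primrec_bound.comp Primrec.fst))
    (Primrec.nat_add.comp Primrec.snd (Primrec.const 3))

/-- A finite set, a coded translation and parameters. -/
abbrev Ctx : Type := List ℕ × TrCode × List ℕ

/-- The prestructure given by a finite set, a coded translation and parameters. -/
abbrev ctxPre (γ : Ctx) : PreStr (ℕ × List ℕ) := γ.2.1.pre {x | x ∈ γ.1} γ.2.2

/-- The objects of the prestructure. -/
noncomputable def objs (γ : Ctx) : List (ℕ × List ℕ) :=
  open Classical in
  (List.range γ.2.1.npieces).flatMap fun a =>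
    ((tuples γ.1 (γ.2.1.dim.get [a])).filter fun xs =>
      satK {x | x ∈ γ.1} (γ.2.1.dom.get [a]) (γ.2.2 ++ xs)).map fun xs => (a, xs)

theorem mem_objs {γ : Ctx} {o : ℕ × List ℕ} : o ∈ objs γ ↔ (ctxPre γ).Ob o := by
  obtain ⟨a, xs⟩ := o
  simp [objs, pre, mem_tuples, and_assoc]

theorem primrec_singleton {f : γ → ℕ} (hf : Primrec f) : Primrec fun a => [f a] :=
  Primrec.list_cons.comp hf (Primrec.const [])

theorem primrec_objs : Primrec objs := by
  classical
  refine Primrec.list_flatMap (Primrec.list_range.comp (primrec_npieces.comp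
    (Primrec.fst.comp Primrec.snd))) ?_
  refine Primrec.list_map ?_ ((Primrec.snd.comp Primrec.fst).pair Primrec.snd)
  have els : Primrec fun q : Ctx × ℕ => q.1.1 := Primrec.fst.comp Primrec.fst
  have he : Primrec fun q : Ctx × ℕ => q.1.2.1 :=
    Primrec.fst.comp (Primrec.snd.comp Primrec.fst)
  have hp : Primrec fun q : Ctx × ℕ => q.1.2.2 :=
    Primrec.snd.comp (Primrec.snd.comp Primrec.fst)
  have key := primrec_singleton (Primrec.snd (α := Ctx) (β := ℕ))
  have hR : PrimrecRel fun (xs : List ℕ) (q : Ctx × ℕ) =>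
      satK {x | x ∈ q.1.1} (q.1.2.1.dom.get [q.2]) (q.1.2.2 ++ xs) :=
    primrecPred_satK_comp (els.comp Primrec.snd)
      (primrec_tableGet.comp (primrec_dom.comp (he.comp Primrec.snd)) (key.comp Primrec.snd))
      (Primrec.list_append.comp (hp.comp Primrec.snd) Primrec.fst)
  refine Primrec.of_eq (hR.listFilter.comp (primrec_tuples.comp els
    (primrec_tableGet.comp (primrec_dim.comp he) key)) Primrec.id) ?_
  intro q
  rfl

variable {ctx : γ → Ctx} (hctx : Primrec ctx)
include hctx

theorem primrecPred_EQ {o o' : γ → ℕ × List ℕ} (ho : Primrec o) (ho' : Primrec o') :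
    PrimrecPred fun a => (ctxPre (ctx a)).EQ (o a) (o' a) :=
  primrecPred_satK_comp (Primrec.fst.comp hctx)
    (primrec_tableGet.comp (primrec_eq.comp (Primrec.fst.comp (Primrec.snd.comp hctx)))
      (Primrec.list_cons.comp (Primrec.fst.comp ho) (primrec_singleton (Primrec.fst.comp ho'))))
    (Primrec.list_append.comp (Primrec.snd.comp (Primrec.snd.comp hctx))
      (Primrec.list_append.comp (Primrec.snd.comp ho) (Primrec.snd.comp ho')))
omit hctx

theorem primrecPred_HD : PrimrecPred fun q : Ctx × ℕ × List (ℕ × List ℕ) × Option (ℕ × List ℕ) =>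
    (ctxPre q.1).HD q.2.1 q.2.2.1 q.2.2.2 := by
  have els : Primrec fun q : Ctx × ℕ × List (ℕ × List ℕ) × Option (ℕ × List ℕ) => q.1.1 :=
    Primrec.fst.comp Primrec.fst
  have he : Primrec fun q : Ctx × ℕ × List (ℕ × List ℕ) × Option (ℕ × List ℕ) => q.1.2.1 :=
    Primrec.fst.comp (Primrec.snd.comp Primrec.fst)
  have hp : Primrec fun q : Ctx × ℕ × List (ℕ × List ℕ) × Option (ℕ × List ℕ) => q.1.2.2 :=
    Primrec.snd.comp (Primrec.snd.comp Primrec.fst)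
  have hh : Primrec fun q : Ctx × ℕ × List (ℕ × List ℕ) × Option (ℕ × List ℕ) => q.2.1 :=
    Primrec.fst.comp Primrec.snd
  have hacc : Primrec fun q : Ctx × ℕ × List (ℕ × List ℕ) × Option (ℕ × List ℕ) => q.2.2.1 :=
    Primrec.fst.comp (Primrec.snd.comp Primrec.snd)
  have hy : Primrec fun q : Ctx × ℕ × List (ℕ × List ℕ) × Option (ℕ × List ℕ) => q.2.2.2 :=
    Primrec.snd.comp (Primrec.snd.comp Primrec.snd)
  have hkey := Primrec.list_map hacc (g := fun _ o => o.1) (Primrec.fst.comp Primrec.snd).to₂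
  have hval := Primrec.list_flatten.comp
    (Primrec.list_map hacc (g := fun _ o => o.2) (Primrec.snd.comp Primrec.snd).to₂)
  have h1 := primrecPred_satK_comp els
    (primrec_tableGet.comp (primrec_rel.comp he) (Primrec.list_cons.comp hh hkey))
    (Primrec.list_append.comp hp hval)
  have h2 := primrecPred_satK_comp (γ := (Ctx × ℕ × List (ℕ × List ℕ) × Option (ℕ × List ℕ)) ×
      (ℕ × List ℕ)) (els.comp Primrec.fst)
    (primrec_tableGet.comp (primrec_fn.comp (he.comp Primrec.fst))
      (Primrec.list_cons.comp (hh.comp Primrec.fst) (Primrec.list_cons.comp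
        (Primrec.fst.comp Primrec.snd) (hkey.comp Primrec.fst))))
    (Primrec.list_append.comp (hp.comp Primrec.fst)
      (Primrec.list_append.comp (hval.comp Primrec.fst) (Primrec.snd.comp Primrec.snd)))
  classical
  refine Primrec.primrecPred ((Primrec.option_casesOn hy h1.decide h2.decide.to₂).of_eq ?_)
  rintro ⟨γ, h, acc, _ | y⟩ <;> rfl

/-- Over a finite domain the choice of an argument is a search through `objs`. The recursive calls
form two blocks indexed by `objs`: one for the arguments of the head term with value `x`, one for
the tail after appending `x`. The answers for `x` sit at its index, shifted in the second block by
the length of `objs`. If the head is a variable, its entry in the first block is computed but not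
read. -/
theorem primrecPred_satArgs :
    PrimrecPred fun q : Ctx × (ℕ × List (ℕ × List ℕ)) × (List (ℕ × List ℕ) × ℕ ×
      Option (ℕ × List ℕ)) =>
      (ctxPre q.1).satArgs q.2.1.1 q.2.1.2 q.2.2.1 q.2.2.2.1 q.2.2.2.2 := by
  classical
  let O := ℕ × List ℕ
  let β := (ℕ × List O) × (List O × ℕ × Option O)
  let f : Ctx → β → Bool := fun γ b => decide
    ((ctxPre γ).satArgs b.1.1 b.1.2 b.2.1 b.2.2.1 b.2.2.2)
  let l : Ctx → β → List β := fun γ b => if b.1.1 = 0 then [] else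
    ((objs γ).map fun x => (((b.1.1 - 1).unpair.1.unpair.2.unpair.2, b.1.2),
      ([], (b.1.1 - 1).unpair.1.unpair.2.unpair.1, some x))) ++
    (objs γ).map fun x => (((b.1.1 - 1).unpair.2, b.1.2), (b.2.1 ++ [x], b.2.2))
  let G : Ctx × β × List Bool → Prop := fun q =>
    if q.2.1.1.1 = 0 then (ctxPre q.1).HD q.2.1.2.2.1 q.2.1.2.1 q.2.1.2.2.2
    else ∃ x ∈ objs q.1, (if (q.2.1.1.1 - 1).unpair.1.unpair.1 = 0 then
        ∃ z ∈ (q.2.1.1.2[(q.2.1.1.1 - 1).unpair.1.unpair.2 / 2]?).toList, (ctxPre q.1).EQ z x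
        else q.2.2[(objs q.1).idxOf x]? = some true) ∧
      q.2.2[(objs q.1).length + (objs q.1).idxOf x]? = some true
  have hc : Primrec fun b : β => b.1.1 := Primrec.fst.comp Primrec.fst
  have hcp : Primrec fun b : β => b.1.1 - 1 := Primrec.pred.comp hc
  have henv : Primrec fun b : β => b.1.2 := Primrec.snd.comp Primrec.fst
  have hl : Primrec₂ l := by
    refine Primrec.ite (Primrec.eq.comp (hc.comp Primrec.snd) (Primrec.const 0)) (Primrec.const [])
      (Primrec.list_append.comp ?_ ?_)
    · refine Primrec.list_map (primrec_objs.comp Primrec.fst) ?_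
      have hb : Primrec fun q : (Ctx × β) × O => q.1.2 := Primrec.snd.comp Primrec.fst
      have ht := primrec_unpair_snd.comp (primrec_unpair_fst.comp (hcp.comp hb))
      exact ((primrec_unpair_snd.comp ht).pair (henv.comp hb)).pair
        ((Primrec.const []).pair ((primrec_unpair_fst.comp ht).pair
          (Primrec.option_some.comp Primrec.snd)))
    · refine Primrec.list_map (primrec_objs.comp Primrec.fst) ?_
      have hb : Primrec fun q : (Ctx × β) × O => q.1.2 := Primrec.snd.comp Primrec.fst
      exact ((primrec_unpair_snd.comp (hcp.comp hb)).pair (henv.comp hb)).pair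
        ((Primrec.list_concat.comp (Primrec.fst.comp (Primrec.snd.comp hb)) Primrec.snd).pair
          (Primrec.snd.comp (Primrec.snd.comp hb)))
  have hG : PrimrecPred G := by
    have hb : Primrec fun q : Ctx × β × List Bool => q.2.1 := Primrec.fst.comp Primrec.snd
    have ho : Primrec fun q : Ctx × β × List Bool => objs q.1 := primrec_objs.comp Primrec.fst
    refine PrimrecPred_ite (Primrec.eq.comp (hc.comp hb) (Primrec.const 0)) ?_ ?_
    · exact primrecPred_HD.comp (Primrec.fst.pair ((Primrec.fst.comp (Primrec.snd.comp
        (Primrec.snd.comp hb))).pair ((Primrec.fst.comp (Primrec.snd.comp hb)).pair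
        (Primrec.snd.comp (Primrec.snd.comp (Primrec.snd.comp hb))))))
    · refine PrimrecPred_exists_mem ho ?_
      have hb' : Primrec fun a : (Ctx × β × List Bool) × O => a.1.2.1 := hb.comp Primrec.fst
      have hr : Primrec fun a : (Ctx × β × List Bool) × O => a.1.2.2 :=
        Primrec.snd.comp (Primrec.snd.comp Primrec.fst)
      have hi : Primrec fun a : (Ctx × β × List Bool) × O => (objs a.1.1).idxOf a.2 :=
        primrec_idxOf.comp Primrec.snd (ho.comp Primrec.fst)
      have ha := primrec_unpair_fst.comp (hcp.comp hb')
      refine (PrimrecPred_ite (Primrec.eq.comp (primrec_unpair_fst.comp ha) (Primrec.const 0))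
        ?_ ?_).and ?_
      · refine PrimrecPred_exists_mem (Primrec.optionToList.comp (Primrec.list_getElem?.comp
          (henv.comp hb') (Primrec.nat_div.comp (primrec_unpair_snd.comp ha) (Primrec.const 2)))) ?_
        exact primrecPred_EQ (Primrec.fst.comp (Primrec.fst.comp Primrec.fst)) Primrec.snd
          (Primrec.snd.comp Primrec.fst)
      · exact Primrec.eq.comp (Primrec.list_getElem?.comp hr hi) (Primrec.const _)
      · exact Primrec.eq.comp (Primrec.list_getElem?.comp hr (Primrec.nat_add.comp
          (Primrec.list_length.comp (ho.comp Primrec.fst)) hi)) (Primrec.const _)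
  have := Primrec.nat_omega_rec (α := Ctx) (β := β) f (m := fun _ b => b.1.1) (l := l)
    (g := fun γ q => some (decide (G (γ, q)))) (hc.comp Primrec.snd) hl
    (Primrec.option_some.comp hG.decide) ?_ ?_
  · exact (Primrec.primrecPred (p := fun q : Ctx × β =>
      (ctxPre q.1).satArgs q.2.1.1 q.2.1.2 q.2.2.1 q.2.2.2.1 q.2.2.2.2) this)
  · rintro γ ⟨⟨_ | c, env⟩, acc, h, y⟩ b hb
    · simp [l] at hb
    · simp only [l, Nat.add_eq_zero_iff, one_ne_zero, and_false, if_false, List.mem_append,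
        List.mem_map, Nat.add_sub_cancel] at hb
      rcases hb with ⟨x, -, rfl⟩ | ⟨x, -, rfl⟩
      · exact PreStr.term_args_lt c
      · exact Nat.lt_succ_of_le (Nat.unpair_right_le _)
  · rintro γ ⟨⟨_ | c, env⟩, acc, h, y⟩
    · simp [G, f, PreStr.satArgs_zero]
    · simp only [Option.some.injEq, f, decide_eq_decide]
      rw [PreStr.satArgs_succ]
      simp only [G, l, Nat.add_eq_zero_iff, one_ne_zero, and_false, if_false, Nat.add_sub_cancel,
        ← mem_objs]
      refine exists_congr fun x => and_congr_right fun hx => ?_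
      have hlt : (objs γ).idxOf x < (objs γ).length := List.idxOf_lt_length_of_mem hx
      refine and_congr ?_ ?_
      · rw [PreStr.satTerm]
        split_ifs with h0
        · simp only [Option.mem_toList]
          rfl
        · rw [List.map_append, List.getElem?_append_left (by simpa using hlt), List.map_map,
            List.getElem?_map, List.getElem?_eq_getElem hlt]
          simp
      · rw [List.map_append, List.getElem?_append_right (by simp)]
        simp [List.getElem?_eq_getElem hlt]

theorem primrecPred_satTerm :
    PrimrecPred fun q : Ctx × ℕ × List (ℕ × List ℕ) × (ℕ × List ℕ) =>
      (ctxPre q.1).satTerm q.2.1 q.2.2.1 q.2.2.2 := by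
  have ha : Primrec fun q : Ctx × ℕ × List (ℕ × List ℕ) × (ℕ × List ℕ) => q.2.1 :=
    Primrec.fst.comp Primrec.snd
  have henv : Primrec fun q : Ctx × ℕ × List (ℕ × List ℕ) × (ℕ × List ℕ) => q.2.2.1 :=
    Primrec.fst.comp (Primrec.snd.comp Primrec.snd)
  have hx : Primrec fun q : Ctx × ℕ × List (ℕ × List ℕ) × (ℕ × List ℕ) => q.2.2.2 :=
    Primrec.snd.comp (Primrec.snd.comp Primrec.snd)
  refine PrimrecPred_ite (Primrec.eq.comp (primrec_unpair_fst.comp ha) (Primrec.const 0)) ?_ ?_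
  · refine (PrimrecPred_exists_mem (R := fun (q : Ctx × ℕ × List (ℕ × List ℕ) × (ℕ × List ℕ)) z =>
      (ctxPre q.1).EQ z q.2.2.2) (Primrec.optionToList.comp (Primrec.list_getElem?.comp henv
        (Primrec.nat_div.comp (primrec_unpair_snd.comp ha) (Primrec.const 2)))) ?_).of_eq
        fun _ => by simp
    exact primrecPred_EQ (Primrec.fst.comp Primrec.fst) Primrec.snd (hx.comp Primrec.fst)
  · have ht := primrec_unpair_snd.comp ha
    exact primrecPred_satArgs.comp (Primrec.fst.pair (((primrec_unpair_snd.comp ht).pair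
      henv).pair ((Primrec.const []).pair ((primrec_unpair_fst.comp ht).pair
        (Primrec.option_some.comp hx)))))

theorem primrecPred_satForm :
    PrimrecPred fun q : Ctx × ℕ × List (ℕ × List ℕ) => (ctxPre q.1).satForm q.2.1 q.2.2 := by
  have tag : ∀ n, PrimrecPred fun q : Ctx × ℕ × List (ℕ × List ℕ) => q.2.1.unpair.1 = n := fun n =>
    Primrec.eq.comp (primrec_unpair_fst.comp (Primrec.fst.comp Primrec.snd)) (Primrec.const n)
  have arg : Primrec fun q : Ctx × ℕ × List (ℕ × List ℕ) => q.2.1.unpair.2 :=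
    primrec_unpair_snd.comp (Primrec.fst.comp Primrec.snd)
  have henv : Primrec fun q : Ctx × ℕ × List (ℕ × List ℕ) => q.2.2 := Primrec.snd.comp Primrec.snd
  have fst : Primrec fun q : (Ctx × ℕ × List (ℕ × List ℕ)) × (ℕ × List ℕ) => q.1.1 :=
    Primrec.fst.comp Primrec.fst
  have t1 : PrimrecPred fun q : (Ctx × ℕ × List (ℕ × List ℕ)) × (ℕ × List ℕ) =>
      (ctxPre q.1.1).satTerm q.1.2.1.unpair.2.unpair.1 q.1.2.2 q.2 :=
    (primrecPred_satTerm.comp (fst.pair ((primrec_unpair_fst.comp (arg.comp Primrec.fst)).pair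
      ((henv.comp Primrec.fst).pair Primrec.snd))) :)
  have t2 : PrimrecPred fun q : (Ctx × ℕ × List (ℕ × List ℕ)) × (ℕ × List ℕ) =>
      (ctxPre q.1.1).satTerm q.1.2.1.unpair.2.unpair.2 q.1.2.2 q.2 :=
    (primrecPred_satTerm.comp (fst.pair ((primrec_unpair_snd.comp (arg.comp Primrec.fst)).pair
      ((henv.comp Primrec.fst).pair Primrec.snd))) :)
  have hs := primrec_unpair_snd.comp arg
  have hvar : PrimrecPred fun q : Ctx × ℕ × List (ℕ × List ℕ) =>
      ∃ y ∈ (q.2.2[q.2.1.unpair.2.unpair.2.unpair.2 / 2]?).toList,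
        (ctxPre q.1).satTerm q.2.1.unpair.2.unpair.1 q.2.2 y := PrimrecPred_exists_mem
          (Primrec.optionToList.comp (Primrec.list_getElem?.comp henv
    (Primrec.nat_div.comp (primrec_unpair_snd.comp hs) (Primrec.const 2)))) t1
  have hcomp : PrimrecPred fun q : Ctx × ℕ × List (ℕ × List ℕ) => ∃ y ∈ objs q.1,
      (ctxPre q.1).satTerm q.2.1.unpair.2.unpair.1 q.2.2 y ∧
      (ctxPre q.1).satTerm q.2.1.unpair.2.unpair.2 q.2.2 y := PrimrecPred_exists_mem
        (primrec_objs.comp Primrec.fst) (t1.and t2)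
  have hrel : PrimrecPred fun q : Ctx × ℕ × List (ℕ × List ℕ) => (ctxPre q.1).satArgs
      q.2.1.unpair.2.unpair.2 q.2.2 [] q.2.1.unpair.2.unpair.1 none :=
    (primrecPred_satArgs.comp (Primrec.fst.pair ((hs.pair henv).pair ((Primrec.const []).pair
      ((primrec_unpair_fst.comp arg).pair (Primrec.const none))))) :)
  have hAt := PrimrecPred_ite (tag 1) (PrimrecPred_ite (Primrec.eq.comp
    (primrec_unpair_fst.comp hs) (Primrec.const 0)) hvar hcomp) ((tag 2).and hrel)
  refine (primrecPred_of_formula_rec (Γ := Ctx) (O := ℕ × List ℕ) (i := 3) (j := 4)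
    (F := fun γ => (ctxPre γ).satForm) (fun p q => p → q) (by simp) (by simp) primrec_objs hAt
    fun γ k env => ?_ :)
  rw [PreStr.satForm]
  by_cases h3 : k.unpair.1 = 3
  · simp [h3]
  by_cases h4 : k.unpair.1 = 4
  · simp [h4, mem_objs]
  by_cases h1 : k.unpair.1 = 1
  · simp [h1, mem_objs]
  by_cases h2 : k.unpair.1 = 2
  · simp [h2]
  simp [h1, h2, h3, h4]

/-! ### Deciding translated sentences in finite structures -/

/-- The points of `pointsBelow X b`. -/
def pointsList (X : List ℕ) (b : ℕ) : List ℕ :=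
  ((List.range b).flatMap fun n => (List.range b).map fun j => Nat.pair n j).filter fun x =>
    cls x ∉ X ∨ x.unpair.2 ≤ cls x

theorem mem_pointsList (X : List ℕ) (b : ℕ) :
    {x | x ∈ pointsList X b} = pointsBelow {x | x ∈ X} b := by
  ext x
  simp only [pointsList, List.mem_filter, List.mem_flatMap, List.mem_range, List.mem_map,
    decide_eq_true_eq, Set.mem_ofPred_eq, pointsBelow, points, ← imp_iff_not_or]
  constructor
  · rintro ⟨⟨n, hn, j, hj, rfl⟩, h⟩
    exact ⟨h, by simpa using hn, by simpa using hj⟩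
  · rintro ⟨h1, h2, h3⟩
    exact ⟨⟨_, h2, _, h3, Nat.pair_unpair x⟩, h1⟩

theorem primrec_pointsList : Primrec₂ pointsList := by
  have hR : PrimrecRel fun (x : ℕ) (q : List ℕ × ℕ) => cls x ∉ q.1 ∨ x.unpair.2 ≤ cls x := by
    refine PrimrecPred.or (PrimrecPred.not ?_) (Primrec.nat_le.comp
      (primrec_unpair_snd.comp Primrec.fst) (primrec_cls.comp Primrec.fst))
    refine (PrimrecPred_exists_mem (R := fun (a : ℕ × List ℕ × ℕ) n => n = cls a.1)
      (Primrec.fst.comp Primrec.snd) (Primrec.eq.comp Primrec.snd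
        (primrec_cls.comp (Primrec.fst.comp Primrec.fst)))).of_eq fun a => by simp
  have hr : Primrec fun q : List ℕ × ℕ => List.range q.2 := Primrec.list_range.comp Primrec.snd
  refine Primrec.of_eq (hR.listFilter.comp (Primrec.list_flatMap hr (Primrec.list_map
    (hr.comp Primrec.fst) (g := fun (p : (List ℕ × ℕ) × ℕ) j => Nat.pair p.2 j)
    (Primrec₂.natPair.comp (Primrec.snd.comp Primrec.fst) Primrec.snd).to₂).to₂) Primrec.id) ?_
  intro q
  rfl

/-- All quantifiers in `Hold` range over lists: parameters over `tuples`, objects over `objs`. The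
side `2 * use` is what `good_pointsBelow` needs for transferring the answer to the infinite
structure by `hold_congr`. -/
theorem primrecPred_hold : PrimrecPred fun q : (TrCode × List ℕ) × ℕ =>
    q.1.1.Hold (pointsBelow {x | x ∈ q.1.2} (2 * q.1.1.use q.2)) q.2 := by
  let Q := (TrCode × List ℕ) × ℕ
  let els : Q → List ℕ := fun q => pointsList q.1.2 (2 * q.1.1.use q.2)
  have he : Primrec fun q : Q => q.1.1 := Primrec.fst.comp Primrec.fst
  have hels : Primrec els := primrec_pointsList.comp (Primrec.snd.comp Primrec.fst)
    (Primrec.nat_mul.comp (Primrec.const 2) (primrec_use.comp he Primrec.snd))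
  have hL : Primrec fun q : Q => tuples (els q) q.1.1.npar :=
    primrec_tuples.comp hels (primrec_npar.comp he)
  have hR : PrimrecPred fun a : Q × List ℕ => satK {x | x ∈ els a.1} a.1.1.1.par a.2 :=
    (primrecPred_satK_comp (hels.comp Primrec.fst) (primrec_par.comp (he.comp Primrec.fst))
      Primrec.snd :)
  have hT : PrimrecPred fun a : Q × List ℕ =>
      (ctxPre (els a.1, a.1.1.1, a.2)).satForm a.1.2 [] :=
    (primrecPred_satForm.comp (((hels.comp Primrec.fst).pair ((he.comp Primrec.fst).pair
      Primrec.snd)).pair ((Primrec.snd.comp Primrec.fst).pair (Primrec.const []))) :)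
  have h1 := PrimrecPred_exists_mem (R := fun q p => satK {x | x ∈ els q} q.1.1.par p) hL hR
  have h2 := PrimrecPred_forall_mem (R := fun q p => satK {x | x ∈ els q} q.1.1.par p →
    (ctxPre (els q, q.1.1, p)).satForm q.2 []) hL (PrimrecPred_imp hR hT)
  refine (h1.and h2).of_eq fun q => ?_
  have e : {x | x ∈ els q} = pointsBelow {x | x ∈ q.1.2} (2 * q.1.1.use q.2) :=
    mem_pointsList _ _
  simp only [Hold, Admissible, mem_tuples, ← e]
  refine and_congr ?_ ?_
  · simp [and_assoc]
  · simp

end TrCode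

end PrimitiveRecursion

end Interp

namespace Interp

open FirstOrder FirstOrder.Language

section Codes

variable {L : FirstOrder.Language.{0, 0}} [FiniteSignature L]

/-! ### Unique readability -/

theorem functionNumber_injective :
    Function.Injective (functionNumber : (Σ n, L.Functions n) → ℕ) :=
  fun _ _ h => (Finite.equivFin _).injective (Fin.val_injective h)

theorem relationNumber_injective :
    Function.Injective (relationNumber : (Σ n, L.Relations n) → ℕ) :=
  fun _ _ h => (Finite.equivFin _).injective (Fin.val_injective h)

theorem termCode_injective {α : Type} [Encodable α] :
    Function.Injective (termCode : L.Term α → ℕ) := by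
  intro t
  induction t with
  | var x =>
    intro s h
    rcases s with y | ⟨f, ts⟩
    · simpa [termCode] using h
    · simp [termCode] at h
  | func f ts ih =>
    intro s h
    rcases s with y | ⟨g, ss⟩
    · simp [termCode] at h
    · simp only [termCode, Nat.pair_eq_pair, true_and, Encodable.encode_inj] at h
      obtain ⟨h1, h2⟩ := h
      cases functionNumber_injective h1
      rw [List.ofFn_inj] at h2
      congr
      funext i
      exact ih i (congrFun h2 i)

/-- Needed to pass from a code that belongs to `codes` of a theory back to the sentence it came
from. -/
theorem formulaCode_injective {α : Type} [Encodable α] {n : ℕ} :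
    Function.Injective (formulaCode : L.BoundedFormula α n → ℕ) := by
  intro φ
  induction φ with
  | falsum =>
    intro ψ h
    cases ψ <;> simp [formulaCode] at h ⊢
  | equal t s =>
    intro ψ h
    cases ψ <;> simp [formulaCode] at h ⊢
    exact ⟨termCode_injective h.1, termCode_injective h.2⟩
  | rel R ts =>
    intro ψ h
    cases ψ with
    | rel R' ts' =>
      simp only [formulaCode, Nat.pair_eq_pair, true_and, Encodable.encode_inj] at h
      obtain ⟨h1, h2⟩ := h
      cases relationNumber_injective h1
      rw [List.ofFn_inj] at h2
      congr
      funext i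
      exact termCode_injective (congrFun h2 i)
    | _ => simp [formulaCode] at h
  | imp φ₁ φ₂ ih1 ih2 =>
    intro ψ h
    cases ψ <;> simp [formulaCode] at h ⊢
    exact ⟨ih1 h.1, ih2 h.2⟩
  | all φ ih =>
    intro ψ h
    cases ψ <;> simp [formulaCode] at h ⊢
    exact ih h

/-! ### Being a code of a formula is primitive recursive -/

/-- The arity of the function symbol with number `r`. -/
noncomputable def functionArity (L : FirstOrder.Language.{0, 0}) [FiniteSignature L] (r : ℕ) :
    Option ℕ :=
  (List.ofFn fun i => ((Finite.equivFin (Σ n, L.Functions n)).symm i).1)[r]?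

/-- The arity of the relation symbol with number `r`. -/
noncomputable def relationArity (L : FirstOrder.Language.{0, 0}) [FiniteSignature L] (r : ℕ) :
    Option ℕ :=
  (List.ofFn fun i => ((Finite.equivFin (Σ n, L.Relations n)).symm i).1)[r]?

theorem primrec_functionArity : Primrec (functionArity L) :=
  Primrec.list_getElem?.comp (Primrec.const _) Primrec.id

theorem primrec_relationArity : Primrec (relationArity L) :=
  Primrec.list_getElem?.comp (Primrec.const _) Primrec.id

theorem functionArity_eq_some {r l : ℕ} :
    functionArity L r = some l ↔ ∃ f : L.Functions l, functionNumber ⟨l, f⟩ = r := by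
  simp only [functionArity, List.getElem?_eq_some_iff, List.length_ofFn, List.getElem_ofFn]
  constructor
  · rintro ⟨h, rfl⟩
    exact ⟨((Finite.equivFin (Σ n, L.Functions n)).symm ⟨r, h⟩).2, by simp [functionNumber]⟩
  · rintro ⟨f, rfl⟩
    exact ⟨(Finite.equivFin (Σ n, L.Functions n) ⟨l, f⟩).2, by simp [functionNumber]⟩

theorem relationArity_eq_some {r l : ℕ} :
    relationArity L r = some l ↔ ∃ R : L.Relations l, relationNumber ⟨l, R⟩ = r := by
  simp only [relationArity, List.getElem?_eq_some_iff, List.length_ofFn, List.getElem_ofFn]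
  constructor
  · rintro ⟨h, rfl⟩
    exact ⟨((Finite.equivFin (Σ n, L.Relations n)).symm ⟨r, h⟩).2, by simp [relationNumber]⟩
  · rintro ⟨f, rfl⟩
    exact ⟨(Finite.equivFin (Σ n, L.Relations n) ⟨l, f⟩).2, by simp [relationNumber]⟩

/-- `c` codes a list of `l` terms in the variables `0, …, n - 1`. -/
def IsTermsCode (L : FirstOrder.Language.{0, 0}) [FiniteSignature L] (n c l : ℕ) : Prop :=
  ∃ ts : Fin l → L.Term (Empty ⊕ Fin n), Encodable.encode (List.ofFn fun i => termCode (ts i)) = c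

/-- `a` codes a term in the variables `0, …, n - 1`. -/
def IsTermCode (L : FirstOrder.Language.{0, 0}) [FiniteSignature L] (n a : ℕ) : Prop :=
  ∃ t : L.Term (Empty ⊕ Fin n), termCode t = a

theorem isTermsCode_zero {n l : ℕ} : IsTermsCode L n 0 l ↔ l = 0 := by
  constructor
  · rintro ⟨ts, h⟩
    have h' : Encodable.encode (List.ofFn fun i => termCode (ts i)) =
      Encodable.encode ([] : List ℕ) := h
    rw [Encodable.encode_inj] at h'
    simpa using congrArg List.length h'
  · rintro rfl
    exact ⟨Fin.elim0, rfl⟩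

theorem isTermsCode_succ {n c l : ℕ} : IsTermsCode L n (c + 1) l ↔
    l ≠ 0 ∧ IsTermCode L n c.unpair.1 ∧ IsTermsCode L n c.unpair.2 (l - 1) := by
  constructor
  · rintro ⟨ts, h⟩
    rcases l with _ | l
    · simp at h
    · rw [List.ofFn_succ, Encodable.encode_list_cons, Nat.succ_inj] at h
      rw [← h]
      exact ⟨by simp, ⟨ts 0, by simp⟩, fun i => ts i.succ, by simp⟩
  · rintro ⟨h, ⟨t, ht⟩, h'⟩
    obtain ⟨l, rfl⟩ := Nat.exists_eq_succ_of_ne_zero h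
    obtain ⟨ts, hts⟩ : IsTermsCode L n c.unpair.2 l := h'
    refine ⟨Fin.cons t ts, ?_⟩
    rw [List.ofFn_succ, Encodable.encode_list_cons]
    simp only [Fin.cons_zero, Fin.cons_succ, ht]
    rw [hts]
    simp

/-- The parity condition comes from the encoding of `Empty ⊕ Fin n`: the variable `i` is coded by `2
* i + 1`, and an even number would code an element of `Empty`. -/
theorem isTermCode_iff {n a : ℕ} : IsTermCode L n a ↔
    a.unpair.1 = 0 ∧ a.unpair.2 % 2 = 1 ∧ a.unpair.2 / 2 < n ∨
    a.unpair.1 = 1 ∧ (functionArity L a.unpair.2.unpair.1).isSome = true ∧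
      IsTermsCode L n a.unpair.2.unpair.2 ((functionArity L a.unpair.2.unpair.1).getD 0) := by
  constructor
  · rintro ⟨t, rfl⟩
    rcases t with (x | x) | ⟨f, ts⟩
    · exact x.elim
    · left
      simp only [termCode, Nat.unpair_pair, Encodable.encode_inr]
      have : Encodable.encode x = x := rfl
      have := x.2
      exact ⟨trivial, by omega, by omega⟩
    · right
      have h := functionArity_eq_some.2 ⟨f, rfl⟩
      simp only [termCode, Nat.unpair_pair, h]
      exact ⟨trivial, rfl, ts, rfl⟩
  · rintro (⟨h0, h1, h2⟩ | ⟨h0, h1, hts⟩)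
    · refine ⟨.var (.inr ⟨_, h2⟩), ?_⟩
      have e1 : Encodable.encode (⟨a.unpair.2 / 2, h2⟩ : Fin n) = a.unpair.2 / 2 := rfl
      have e2 : 2 * (a.unpair.2 / 2) + 1 = a.unpair.2 := by omega
      rw [termCode, Encodable.encode_inr, e1, e2, ← h0, Nat.pair_unpair]
    · obtain ⟨l, hl⟩ := Option.isSome_iff_exists.1 h1
      obtain ⟨f, hf⟩ := functionArity_eq_some.1 hl
      rw [hl, Option.getD_some] at hts
      obtain ⟨ts, hts⟩ := hts
      refine ⟨.func f ts, ?_⟩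
      rw [termCode, hf]
      rw [hts, Nat.pair_unpair, ← h0, Nat.pair_unpair]

/-- The recursion runs on lists of terms, because the list of arguments of the head and the tail
both have smaller codes. For a number that belongs to no function symbol the arity defaults to `0`,
and the `isSome` test discards that answer. -/
theorem primrecPred_isTermsCode : PrimrecPred fun q : ℕ × ℕ × ℕ => IsTermsCode L q.1 q.2.1 q.2.2 :=
    by
  classical
  let f : ℕ → ℕ × ℕ → Bool := fun n b => decide (IsTermsCode L n b.1 b.2)
  let l : ℕ → ℕ × ℕ → List (ℕ × ℕ) := fun _ b => if b.1 = 0 then [] else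
    [((b.1 - 1).unpair.1.unpair.2.unpair.2,
      (functionArity L (b.1 - 1).unpair.1.unpair.2.unpair.1).getD 0),
    ((b.1 - 1).unpair.2, b.2 - 1)]
  let G : ℕ × (ℕ × ℕ) × List Bool → Prop := fun q => if q.2.1.1 = 0 then q.2.1.2 = 0 else
    q.2.1.2 ≠ 0 ∧
    ((q.2.1.1 - 1).unpair.1.unpair.1 = 0 ∧ (q.2.1.1 - 1).unpair.1.unpair.2 % 2 = 1 ∧
      (q.2.1.1 - 1).unpair.1.unpair.2 / 2 < q.1 ∨
    (q.2.1.1 - 1).unpair.1.unpair.1 = 1 ∧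
      (functionArity L (q.2.1.1 - 1).unpair.1.unpair.2.unpair.1).isSome = true ∧
      q.2.2[0]? = some true) ∧ q.2.2[1]? = some true
  have hcp : Primrec fun b : ℕ × ℕ => b.1 - 1 := Primrec.pred.comp Primrec.fst
  have ha : Primrec fun b : ℕ × ℕ => (b.1 - 1).unpair.1 := primrec_unpair_fst.comp hcp
  have ht : Primrec fun b : ℕ × ℕ => (b.1 - 1).unpair.1.unpair.2 := primrec_unpair_snd.comp ha
  have har : Primrec fun b : ℕ × ℕ => functionArity L (b.1 - 1).unpair.1.unpair.2.unpair.1 :=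
    primrec_functionArity.comp (primrec_unpair_fst.comp ht)
  have hl : Primrec₂ l := by
    refine Primrec.ite (Primrec.eq.comp (Primrec.fst.comp Primrec.snd) (Primrec.const 0))
      (Primrec.const []) ?_
    refine Primrec.list_cons.comp (Primrec.pair ?_ ?_) (Primrec.list_cons.comp
      (Primrec.pair ?_ ?_) (Primrec.const []))
    · exact (primrec_unpair_snd.comp ht).comp Primrec.snd
    · exact (Primrec.option_getD.comp har (Primrec.const 0)).comp Primrec.snd
    · exact (primrec_unpair_snd.comp hcp).comp Primrec.snd
    · exact Primrec.pred.comp (Primrec.snd.comp Primrec.snd)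
  have hb : Primrec fun q : ℕ × (ℕ × ℕ) × List Bool => q.2.1 := Primrec.fst.comp Primrec.snd
  have hr : Primrec fun q : ℕ × (ℕ × ℕ) × List Bool => q.2.2 := Primrec.snd.comp Primrec.snd
  have hG : PrimrecPred G := by
    refine PrimrecPred_ite (Primrec.eq.comp (Primrec.fst.comp hb) (Primrec.const 0))
      (Primrec.eq.comp (Primrec.snd.comp hb) (Primrec.const 0)) (PrimrecPred.and (PrimrecPred.not
      (Primrec.eq.comp (Primrec.snd.comp hb) (Primrec.const 0))) (PrimrecPred.and (PrimrecPred.or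
      (PrimrecPred.and ?_ (PrimrecPred.and ?_ ?_)) (PrimrecPred.and ?_ (PrimrecPred.and ?_ ?_)))
      ?_))
    · exact Primrec.eq.comp (primrec_unpair_fst.comp (ha.comp hb)) (Primrec.const 0)
    · exact Primrec.eq.comp (Primrec.nat_mod.comp (ht.comp hb) (Primrec.const 2)) (Primrec.const 1)
    · exact Primrec.nat_lt.comp (Primrec.nat_div.comp (ht.comp hb) (Primrec.const 2)) Primrec.fst
    · exact Primrec.eq.comp (primrec_unpair_fst.comp (ha.comp hb)) (Primrec.const 1)
    · exact Primrec.eq.comp (Primrec.option_isSome.comp (har.comp hb)) (Primrec.const true)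
    · exact Primrec.eq.comp (Primrec.list_getElem?.comp hr (Primrec.const 0)) (Primrec.const _)
    · exact Primrec.eq.comp (Primrec.list_getElem?.comp hr (Primrec.const 1)) (Primrec.const _)
  have := Primrec.nat_omega_rec (α := ℕ) (β := ℕ × ℕ) f (m := fun _ b => b.1) (l := l)
    (g := fun n q => some (decide (G (n, q)))) (Primrec.fst.comp Primrec.snd) hl
    (Primrec.option_some.comp hG.decide) ?_ ?_
  · exact Primrec.primrecPred (p := fun q : ℕ × ℕ × ℕ => IsTermsCode L q.1 q.2.1 q.2.2) this
  · rintro n ⟨_ | c, r⟩ b hb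
    · simp [l] at hb
    · simp only [l, Nat.add_eq_zero_iff, one_ne_zero, and_false, if_false, List.mem_cons,
        List.not_mem_nil, or_false, Nat.add_sub_cancel] at hb
      rcases hb with rfl | rfl
      · exact PreStr.term_args_lt c
      · exact Nat.lt_succ_of_le (Nat.unpair_right_le _)
  · rintro n ⟨_ | c, r⟩
    · simp [G, f, isTermsCode_zero]
    · simp only [Option.some.injEq, f, decide_eq_decide]
      rw [isTermsCode_succ, isTermCode_iff]
      simp [G, l]

theorem primrecPred_isTermCode : PrimrecPred fun q : ℕ × ℕ => IsTermCode L q.1 q.2 := by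
  have ht : Primrec fun q : ℕ × ℕ => q.2.unpair.2 := primrec_unpair_snd.comp Primrec.snd
  have har : Primrec fun q : ℕ × ℕ => functionArity L q.2.unpair.2.unpair.1 :=
    primrec_functionArity.comp (primrec_unpair_fst.comp ht)
  have h1 : PrimrecPred fun q : ℕ × ℕ => IsTermsCode L q.1 q.2.unpair.2.unpair.2
      ((functionArity L q.2.unpair.2.unpair.1).getD 0) :=
    ((primrecPred_isTermsCode (L := L)).comp (Primrec.fst.pair ((primrec_unpair_snd.comp ht).pair
      (Primrec.option_getD.comp har (Primrec.const 0)))) :)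
  refine PrimrecPred.of_eq (PrimrecPred.or (PrimrecPred.and ?_ (PrimrecPred.and ?_ ?_))
    (PrimrecPred.and ?_ (PrimrecPred.and ?_ h1))) fun _ => isTermCode_iff.symm
  · exact Primrec.eq.comp (primrec_unpair_fst.comp Primrec.snd) (Primrec.const 0)
  · exact Primrec.eq.comp (Primrec.nat_mod.comp ht (Primrec.const 2)) (Primrec.const 1)
  · exact Primrec.nat_lt.comp (Primrec.nat_div.comp ht (Primrec.const 2)) Primrec.fst
  · exact Primrec.eq.comp (primrec_unpair_fst.comp Primrec.snd) (Primrec.const 1)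
  · exact Primrec.eq.comp (Primrec.option_isSome.comp har) (Primrec.const true)

/-- `k` codes a formula in the variables `0, …, n - 1`. -/
def IsFormulaCode (L : FirstOrder.Language.{0, 0}) [FiniteSignature L] (n k : ℕ) : Prop :=
  ∃ φ : L.BoundedFormula Empty n, formulaCode φ = k

theorem isFormulaCode_iff {n k : ℕ} : IsFormulaCode L n k ↔
    if k.unpair.1 = 3 then
      IsFormulaCode L n k.unpair.2.unpair.1 ∧ IsFormulaCode L n k.unpair.2.unpair.2
    else if k.unpair.1 = 4 then IsFormulaCode L (n + 1) k.unpair.2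
    else k.unpair.1 = 0 ∧ k.unpair.2 = 0 ∨
      k.unpair.1 = 1 ∧ IsTermCode L n k.unpair.2.unpair.1 ∧ IsTermCode L n k.unpair.2.unpair.2 ∨
      k.unpair.1 = 2 ∧ (relationArity L k.unpair.2.unpair.1).isSome = true ∧
        IsTermsCode L n k.unpair.2.unpair.2 ((relationArity L k.unpair.2.unpair.1).getD 0) := by
  constructor
  · rintro ⟨φ, rfl⟩
    cases φ with
    | falsum => simp [formulaCode]
    | equal t s => simpa [formulaCode] using ⟨⟨t, rfl⟩, ⟨s, rfl⟩⟩
    | @rel _ l R ts =>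
      have h := relationArity_eq_some.2 ⟨R, rfl⟩
      simpa [formulaCode, h] using ⟨ts, rfl⟩
    | imp φ ψ => simpa [formulaCode] using ⟨⟨φ, rfl⟩, ⟨ψ, rfl⟩⟩
    | all φ => simpa [formulaCode] using ⟨φ, rfl⟩
  · split_ifs with h3 h4
    · rintro ⟨⟨φ, hφ⟩, ψ, hψ⟩
      exact ⟨φ.imp ψ, by rw [formulaCode, hφ, hψ, Nat.pair_unpair, ← h3, Nat.pair_unpair]⟩
    · rintro ⟨φ, hφ⟩
      exact ⟨φ.all, by rw [formulaCode, hφ, ← h4, Nat.pair_unpair]⟩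
    · rintro (⟨h1, h2⟩ | ⟨h1, ⟨t, ht⟩, s, hs⟩ | ⟨h0, h1, hts⟩)
      · exact ⟨.falsum, by rw [formulaCode, ← Nat.pair_unpair k, h1, h2]⟩
      · exact ⟨.equal t s, by rw [formulaCode, ht, hs, Nat.pair_unpair, ← h1, Nat.pair_unpair]⟩
      · obtain ⟨l, hl⟩ := Option.isSome_iff_exists.1 h1
        obtain ⟨R, hR⟩ := relationArity_eq_some.1 hl
        rw [hl, Option.getD_some] at hts
        obtain ⟨ts, hts⟩ := hts
        refine ⟨.rel R ts, ?_⟩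
        rw [formulaCode, hR]
        rw [hts, Nat.pair_unpair, ← h0, Nat.pair_unpair]

/-- The recursion principle for formulas is reused with environments of units: the length of the
environment counts the bound variables, and the quantifier clause has a single instance `()`. -/
theorem primrecPred_isSentenceCode :
    PrimrecPred fun k => ∃ φ : L.Sentence, formulaCode φ = k := by
  have arg : Primrec fun q : Unit × ℕ × List Unit => q.2.1.unpair.2 :=
    primrec_unpair_snd.comp (Primrec.fst.comp Primrec.snd)
  have tag : ∀ n, PrimrecPred fun q : Unit × ℕ × List Unit => q.2.1.unpair.1 = n := fun n =>
    Primrec.eq.comp (primrec_unpair_fst.comp (Primrec.fst.comp Primrec.snd)) (Primrec.const n)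
  have len : Primrec fun q : Unit × ℕ × List Unit => q.2.2.length :=
    Primrec.list_length.comp (Primrec.snd.comp Primrec.snd)
  have har : Primrec fun q : Unit × ℕ × List Unit => relationArity L q.2.1.unpair.2.unpair.1 :=
    primrec_relationArity.comp (primrec_unpair_fst.comp arg)
  have h1 : PrimrecPred fun q : Unit × ℕ × List Unit =>
      IsTermCode L q.2.2.length q.2.1.unpair.2.unpair.1 :=
    ((primrecPred_isTermCode (L := L)).comp (len.pair (primrec_unpair_fst.comp arg)) :)
  have h2 : PrimrecPred fun q : Unit × ℕ × List Unit =>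
      IsTermCode L q.2.2.length q.2.1.unpair.2.unpair.2 :=
    ((primrecPred_isTermCode (L := L)).comp (len.pair (primrec_unpair_snd.comp arg)) :)
  have h3 : PrimrecPred fun q : Unit × ℕ × List Unit => IsTermsCode L q.2.2.length
      q.2.1.unpair.2.unpair.2 ((relationArity L q.2.1.unpair.2.unpair.1).getD 0) :=
    ((primrecPred_isTermsCode (L := L)).comp (len.pair ((primrec_unpair_snd.comp arg).pair
      (Primrec.option_getD.comp har (Primrec.const 0)))) :)
  have hAt := PrimrecPred.or ((tag 0).and (Primrec.eq.comp arg (Primrec.const 0))) (PrimrecPred.or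
    ((tag 1).and (h1.and h2)) ((tag 2).and (PrimrecPred.and
      (Primrec.eq.comp (Primrec.option_isSome.comp har) (Primrec.const true)) h3)))
  have := primrecPred_of_formula_rec (Γ := Unit) (O := Unit) (i := 3) (j := 4)
    (F := fun _ k env => IsFormulaCode L env.length k) (L := fun _ => [()]) And (by simp) (by simp)
    (Primrec.const _) hAt fun _ k env => by
      rw [isFormulaCode_iff]
      simp
  exact (this.comp ((Primrec.const ()).pair (Primrec.id.pair (Primrec.const []))) :)

end Codes

end Interp

namespace Interp

open FirstOrder FirstOrder.Language

section IdentityAxioms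

variable {L : FirstOrder.Language.{0, 0}}

/-! ### The axioms of identity -/

/-- `x i = x j` -/
def varEq {n : ℕ} (i j : Fin n) : L.BoundedFormula Empty n :=
  .equal (.var (.inr i)) (.var (.inr j))

/-- `f (x (i 0), …, x (i (l - 1))) = x j` -/
def valueEq {n l : ℕ} (f : L.Functions l) (i : Fin l → Fin n) (j : Fin n) :
    L.BoundedFormula Empty n :=
  .equal (.func f fun k => .var (.inr (i k))) (.var (.inr j))

/-- The axioms of identity that involve the function symbol `f`. -/
def functionAxioms {l : ℕ} (f : L.Functions l) : Set L.Sentence :=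
  {(((valueEq f Fin.castSucc (Fin.last l)).imp .falsum).all.imp .falsum).alls,
    ((valueEq f (Fin.castAdd 2) (Fin.natAdd l 0)).imp
      ((varEq (Fin.natAdd l 0) (Fin.natAdd l 1)).imp
        (valueEq f (Fin.castAdd 2) (Fin.natAdd l 1)))).alls,
    ((valueEq f (Fin.castAdd 2) (Fin.natAdd l 0)).imp
      ((valueEq f (Fin.castAdd 2) (Fin.natAdd l 1)).imp
        (varEq (Fin.natAdd l 0) (Fin.natAdd l 1)))).alls}

/-- The axioms of identity, which are valid. -/
def identityAxioms (L : FirstOrder.Language.{0, 0}) : Set L.Sentence :=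
  {((varEq (0 : Fin 1) 0).imp .falsum).all.imp .falsum, (varEq (0 : Fin 1) 0).alls,
    ((varEq (0 : Fin 2) 1).imp (varEq 1 0)).alls,
    ((varEq (0 : Fin 3) 1).imp ((varEq 1 2).imp (varEq 0 2))).alls} ∪
  ⋃ f : Σ l, L.Functions l, functionAxioms f.2

theorem realize_varEq {M : Type*} [L.Structure M] {n : ℕ} (i j : Fin n) (v : Empty → M)
    (xs : Fin n → M) :
    (varEq i j : L.BoundedFormula Empty n).Realize v xs ↔ xs i = xs j := by
  simp [varEq, BoundedFormula.Realize]

theorem realize_valueEq {M : Type*} [L.Structure M] {n l : ℕ} (f : L.Functions l)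
    (i : Fin l → Fin n) (j : Fin n) (v : Empty → M) (xs : Fin n → M) :
    (valueEq f i j).Realize v xs ↔ Structure.funMap f (fun k => xs (i k)) = xs j := by
  simp [valueEq, BoundedFormula.Realize]

theorem realize_of_mem_identityAxioms {φ : L.Sentence} (h : φ ∈ identityAxioms L) (M : Type*)
    [L.Structure M] [Nonempty M] : M ⊨ φ := by
  have key : ∀ {n : ℕ} {ψ : L.BoundedFormula Empty n}, (∀ xs : Fin n → M, ψ.Realize default xs) →
      M ⊨ (ψ.alls : L.Sentence) := fun h => BoundedFormula.realize_alls.2 h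
  simp only [identityAxioms, functionAxioms, Set.mem_union, Set.mem_insert_iff,
    Set.mem_singleton_iff, Set.mem_iUnion] at h
  rcases h with (rfl | rfl | rfl | rfl) | ⟨f, rfl | rfl | rfl⟩
  · rw [Sentence.Realize, Formula.Realize, BoundedFormula.realize_imp, BoundedFormula.realize_all]
    exact fun h => h (Classical.arbitrary M) rfl
  all_goals
    refine key fun xs => ?_
    simp only [BoundedFormula.realize_imp, realize_varEq, realize_valueEq]
  · exact Eq.symm
  · exact Eq.trans
  · rw [BoundedFormula.realize_all]
    intro h
    refine h (Structure.funMap f.2 xs) ?_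
    rw [realize_valueEq]
    simp
  · exact Eq.trans
  · exact fun h1 h2 => h1.symm.trans h2

theorem models_identityAxioms {φ : L.Sentence} (h : φ ∈ identityAxioms L) (T : L.Theory) :
    T.ModelsBoundedFormula φ :=
  Theory.models_sentence_iff.2 fun M => realize_of_mem_identityAxioms h M

theorem finite_identityAxioms [FiniteSignature L] : (identityAxioms L).Finite := by
  refine .union (by simp) (Set.finite_iUnion fun f => ?_)
  simp [functionAxioms]

end IdentityAxioms

section Quotient

variable {L : FirstOrder.Language.{0, 0}} [FiniteSignature L]

/-! ### Prestructures that satisfy the axioms of identity -/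

namespace PreStr

variable {O : Type*} (P : PreStr O)

/-- Unwinds the recursion along a coded list into one quantifier over tuples, the form in which
`satArgs` is compared with translations and structures. -/
theorem satArgs_ofFn {l : ℕ} (cs : Fin l → ℕ) (env acc : List O) (h : ℕ) (y : Option O) :
    P.satArgs (Encodable.encode (List.ofFn cs)) env acc h y ↔
      ∃ xs : Fin l → O, (∀ i, P.Ob (xs i) ∧ P.satTerm (cs i) env (xs i)) ∧
        P.HD h (acc ++ List.ofFn xs) y := by
  induction l generalizing acc with
  | zero => simp [satArgs_zero]
  | succ l ih =>
    rw [List.ofFn_succ, Encodable.encode_list_cons, satArgs_succ, Fin.exists_fin_succ_pi]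
    refine exists_congr fun x => ?_
    simp only [Nat.unpair_pair, Encodable.encode_nat, ih, Fin.forall_fin_succ, Fin.cons_zero,
      Fin.cons_succ, List.ofFn_succ, List.append_assoc, List.singleton_append]
    constructor
    · rintro ⟨h1, h2, xs, h3, h4⟩
      exact ⟨xs, ⟨⟨h1, h2⟩, h3⟩, h4⟩
    · rintro ⟨xs, ⟨⟨h1, h2⟩, h3⟩, h4⟩
      exact ⟨h1, h2, xs, h3, h4⟩

theorem satTerm_var {n : ℕ} (v : Fin n → O) (i : Fin n) (x : O) :
    P.satTerm (termCode (.var (.inr i) : L.Term (Empty ⊕ Fin n))) (List.ofFn v) x ↔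
      P.EQ (v i) x := by
  -- Halving recovers `i` from the code `2 * i + 1` of the variable.
  have h : (2 * (i : ℕ) + 1) / 2 = i := by omega
  have h' : Encodable.encode i = (i : ℕ) := rfl
  simp [satTerm, termCode, h', h]

theorem satTerm_func {n l : ℕ} (env : List O) (f : L.Functions l)
    (ts : Fin l → L.Term (Empty ⊕ Fin n)) (x : O) :
    P.satTerm (termCode (.func f ts)) env x ↔
      ∃ xs : Fin l → O, (∀ i, P.Ob (xs i) ∧ P.satTerm (termCode (ts i)) env (xs i)) ∧
        P.HD (functionNumber ⟨l, f⟩) (List.ofFn xs) (some x) := by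
  simp [satTerm, termCode, satArgs_ofFn]

theorem satForm_falsum {n : ℕ} (env : List O) :
    ¬ P.satForm (formulaCode (.falsum : L.BoundedFormula Empty n)) env := by
  rw [satForm]
  simp [formulaCode]

theorem satForm_imp {n : ℕ} (φ ψ : L.BoundedFormula Empty n) (env : List O) :
    P.satForm (formulaCode (φ.imp ψ)) env ↔
      (P.satForm (formulaCode φ) env → P.satForm (formulaCode ψ) env) := by
  rw [satForm]
  simp [formulaCode]

theorem satForm_all {n : ℕ} (φ : L.BoundedFormula Empty (n + 1)) (env : List O) :
    P.satForm (formulaCode φ.all) env ↔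
      ∀ x, P.Ob x → P.satForm (formulaCode φ) (env ++ [x]) := by
  rw [satForm]
  simp [formulaCode]

theorem satForm_rel {n l : ℕ} (R : L.Relations l) (ts : Fin l → L.Term (Empty ⊕ Fin n))
    (env : List O) : P.satForm (formulaCode (.rel R ts)) env ↔
      ∃ xs : Fin l → O, (∀ i, P.Ob (xs i) ∧ P.satTerm (termCode (ts i)) env (xs i)) ∧
        P.HD (relationNumber ⟨l, R⟩) (List.ofFn xs) none := by
  rw [satForm]
  simp [formulaCode, satArgs_ofFn]

/-- Like `equalTr`, the evaluation treats a variable on the right without introducing a further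
object. For the axioms of identity this yields `EQ` and `Val` directly. -/
theorem satForm_equal_var {n : ℕ} (t : L.Term (Empty ⊕ Fin n)) (i : Fin n) (v : Fin n → O) :
    P.satForm (formulaCode (.equal t (.var (.inr i)))) (List.ofFn v) ↔
      P.satTerm (termCode t) (List.ofFn v) (v i) := by
  have h : (2 * (i : ℕ) + 1) / 2 = i := by omega
  rw [satForm]
  have h' : Encodable.encode i = (i : ℕ) := rfl
  simp [formulaCode, termCode, h', h]

theorem satForm_equal_func {n l : ℕ} (t : L.Term (Empty ⊕ Fin n)) (f : L.Functions l)
    (ts : Fin l → L.Term (Empty ⊕ Fin n)) (env : List O) :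
    P.satForm (formulaCode (.equal t (.func f ts))) env ↔
      ∃ y, P.Ob y ∧ P.satTerm (termCode t) env y ∧ P.satTerm (termCode (.func f ts)) env y := by
  rw [satForm]
  simp [formulaCode, termCode]

theorem ofFn_snoc {n : ℕ} (v : Fin n → O) (x : O) :
    List.ofFn (Fin.snoc v x : Fin (n + 1) → O) = List.ofFn v ++ [x] := by
  rw [List.ofFn_succ', List.concat_eq_append]
  simp

theorem satForm_alls {n : ℕ} (φ : L.BoundedFormula Empty n) :
    P.satForm (formulaCode φ.alls) [] ↔
      ∀ v : Fin n → O, (∀ i, P.Ob (v i)) → P.satForm (formulaCode φ) (List.ofFn v) := by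
  induction n with
  | zero => simp [BoundedFormula.alls]
  | succ n ih =>
    simp only [BoundedFormula.alls, ih, satForm_all]
    constructor
    · intro h v hv
      induction v using Fin.snocCases with
      | snoc v x =>
        rw [ofFn_snoc]
        exact h v (fun i => by simpa using hv i.castSucc) x (by simpa using hv (Fin.last n))
    · intro h v hv x hx
      rw [← ofFn_snoc]
      refine h _ fun i => ?_
      induction i using Fin.lastCases with
      | last => simpa using hx
      | cast i => simpa using hv i

/-- Some objects identical to `xs` are mapped to `y` by the function symbol `f`. -/
def Val {l : ℕ} (f : L.Functions l) (xs : Fin l → O) (y : O) : Prop :=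
  ∃ zs : Fin l → O, (∀ i, P.Ob (zs i) ∧ P.EQ (xs i) (zs i)) ∧
    P.HD (functionNumber ⟨l, f⟩) (List.ofFn zs) (some y)

/-- The prestructure gives rise to a structure for `L`. -/
structure HasQuotient (L : FirstOrder.Language.{0, 0}) [FiniteSignature L] : Prop where
  nonempty : ∃ x, P.Ob x
  refl : ∀ x, P.Ob x → P.EQ x x
  symm : ∀ x y, P.Ob x → P.Ob y → P.EQ x y → P.EQ y x
  trans : ∀ x y z, P.Ob x → P.Ob y → P.Ob z → P.EQ x y → P.EQ y z → P.EQ x z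
  total : ∀ {l} (f : L.Functions l) (xs : Fin l → O), (∀ i, P.Ob (xs i)) →
    ∃ y, P.Ob y ∧ P.Val f xs y
  congr : ∀ {l} (f : L.Functions l) (xs : Fin l → O) (y y'), (∀ i, P.Ob (xs i)) → P.Ob y →
    P.Ob y' → P.Val f xs y → P.EQ y y' → P.Val f xs y'
  functional : ∀ {l} (f : L.Functions l) (xs : Fin l → O) (y y'), (∀ i, P.Ob (xs i)) → P.Ob y →
    P.Ob y' → P.Val f xs y → P.Val f xs y' → P.EQ y y'

namespace HasQuotient

variable {P} (hP : P.HasQuotient L)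

/-- Identity of objects. -/
def setoid : Setoid {x // P.Ob x} where
  r x y := P.EQ x y
  iseqv :=
    { refl := fun x => hP.refl x x.2
      symm := fun {x y} => hP.symm x y x.2 y.2
      trans := fun {x y z} => hP.trans x y z x.2 y.2 z.2 }

/-- The structure given by a prestructure. -/
def Quot : Type _ := Quotient hP.setoid

/-- The element given by an object. -/
def toQuot (x : {x // P.Ob x}) : hP.Quot := Quotient.mk hP.setoid x

theorem toQuot_eq_toQuot {x y : {x // P.Ob x}} : hP.toQuot x = hP.toQuot y ↔ P.EQ x y :=
  Quotient.eq (r := hP.setoid)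

theorem toQuot_surjective : Function.Surjective hP.toQuot := Quotient.mk_surjective (s := hP.setoid)

instance : Nonempty hP.Quot :=
  let ⟨x, hx⟩ := hP.nonempty
  ⟨hP.toQuot ⟨x, hx⟩⟩

/-- `Val` already replaces the arguments by identical objects, so it depends only on their classes.
This is why no congruence axiom for arguments is needed: totality, invariance of the value and
uniqueness of the value give exactly one class of values. -/
theorem exists_value {l : ℕ} (f : L.Functions l) (q : Fin l → hP.Quot) :
    ∃ r : hP.Quot, ∀ y : {x // P.Ob x}, r = hP.toQuot y ↔
      ∃ xs : Fin l → {x // P.Ob x}, (∀ i, q i = hP.toQuot (xs i)) ∧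
        P.HD (functionNumber ⟨l, f⟩) (List.ofFn fun i => (xs i).1) (some y.1) := by
  choose xs hxs using fun i => hP.toQuot_surjective (q i)
  have key : ∀ y : {x // P.Ob x}, P.Val f (fun i => (xs i).1) y.1 ↔
      ∃ xs : Fin l → {x // P.Ob x}, (∀ i, q i = hP.toQuot (xs i)) ∧
        P.HD (functionNumber ⟨l, f⟩) (List.ofFn fun i => (xs i).1) (some y.1) := by
    intro y
    constructor
    · rintro ⟨zs, h1, h2⟩
      exact ⟨fun i => ⟨zs i, (h1 i).1⟩,
        fun i => (hxs i).symm.trans (hP.toQuot_eq_toQuot.2 (h1 i).2), h2⟩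
    · rintro ⟨zs, h1, h2⟩
      exact ⟨fun i => zs i, fun i => ⟨(zs i).2, hP.toQuot_eq_toQuot.1 ((hxs i).trans (h1 i))⟩, h2⟩
  obtain ⟨r, hr, h⟩ := hP.total f (fun i => (xs i).1) fun i => (xs i).2
  refine ⟨hP.toQuot ⟨r, hr⟩, fun y => ?_⟩
  rw [← key, toQuot_eq_toQuot]
  exact ⟨hP.congr f _ _ _ (fun i => (xs i).2) hr y.2 h,
    hP.functional f _ _ _ (fun i => (xs i).2) hr y.2 h⟩

/-- Quantifying over representatives makes the relations well defined with no congruence axiom. It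
agrees with the translation of atomic formulas, which also passes to identical objects first. -/
noncomputable instance : L.Structure hP.Quot where
  funMap f q := (hP.exists_value f q).choose
  RelMap {l} R q := ∃ xs : Fin l → {x // P.Ob x}, (∀ i, q i = hP.toQuot (xs i)) ∧
    P.HD (relationNumber ⟨l, R⟩) (List.ofFn fun i => (xs i).1) none

theorem funMap_eq_toQuot {l : ℕ} (f : L.Functions l) (q : Fin l → hP.Quot) (y : {x // P.Ob x}) :
    Structure.funMap f q = hP.toQuot y ↔
      ∃ xs : Fin l → {x // P.Ob x}, (∀ i, q i = hP.toQuot (xs i)) ∧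
        P.HD (functionNumber ⟨l, f⟩) (List.ofFn fun i => (xs i).1) (some y.1) :=
  (hP.exists_value f q).choose_spec y

theorem exists_args {l : ℕ} {p : Fin l → O → Prop} {q : (Fin l → O) → Prop} :
    (∃ xs : Fin l → O, (∀ i, P.Ob (xs i) ∧ p i (xs i)) ∧ q xs) ↔
      ∃ xs : Fin l → {x // P.Ob x}, (∀ i, p i (xs i)) ∧ q fun i => (xs i).1 := by
  constructor
  · rintro ⟨xs, h1, h2⟩
    exact ⟨fun i => ⟨xs i, (h1 i).1⟩, fun i => (h1 i).2, h2⟩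
  · rintro ⟨xs, h1, h2⟩
    exact ⟨fun i => xs i, fun i => ⟨(xs i).2, h1 i⟩, h2⟩

theorem realize_term {n : ℕ} (t : L.Term (Empty ⊕ Fin n)) (v : Fin n → {x // P.Ob x})
    (y : {x // P.Ob x}) :
    t.realize (Sum.elim default fun i => hP.toQuot (v i)) = hP.toQuot y ↔
      P.satTerm (termCode t) (List.ofFn fun i => (v i).1) y.1 := by
  induction t generalizing y with
  | var x =>
    rcases x with x | i
    · exact x.elim
    · rw [satTerm_var, Term.realize_var, Sum.elim_inr, toQuot_eq_toQuot]
  | func f ts ih =>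
    rw [satTerm_func, Term.realize_func, funMap_eq_toQuot, exists_args]
    simp only [ih]

theorem realize_iff {n : ℕ} (φ : L.BoundedFormula Empty n) (v : Fin n → {x // P.Ob x}) :
    φ.Realize default (fun i => hP.toQuot (v i)) ↔
      P.satForm (formulaCode φ) (List.ofFn fun i => (v i).1) := by
  induction φ with
  | falsum => exact iff_of_false id (P.satForm_falsum _)
  | equal t s =>
    rcases s with (e | i) | ⟨f, ts⟩
    · exact e.elim
    · rw [satForm_equal_var, ← hP.realize_term]
      simp [BoundedFormula.Realize]
    · rw [satForm_equal_func]
      constructor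
      · intro h
        -- A representative of the common value is the intermediate object `y` of the translated
        -- equation.
        obtain ⟨y, hy⟩ := hP.toQuot_surjective (t.realize
            (Sum.elim default fun i => hP.toQuot (v i)))
        exact ⟨y, y.2, (hP.realize_term _ _ _).1 hy.symm,
          (hP.realize_term _ _ _).1 ((hy.trans h).symm)⟩
      · rintro ⟨y, hy, h1, h2⟩
        exact ((hP.realize_term _ _ ⟨y, hy⟩).2 h1).trans ((hP.realize_term _ _ ⟨y, hy⟩).2 h2).symm
  | rel R ts =>
    rw [satForm_rel, exists_args]
    simp only [← hP.realize_term]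
    rfl
  | imp φ ψ ih1 ih2 => rw [satForm_imp, BoundedFormula.realize_imp, ih1, ih2]
  | all φ ih =>
    rw [satForm_all, BoundedFormula.realize_all, hP.toQuot_surjective.forall, Subtype.forall]
    refine forall₂_congr fun x hx => ?_
    rw [← ofFn_snoc]
    have := ih (Fin.snoc v ⟨x, hx⟩)
    convert this using 2
    · funext i
      induction i using Fin.lastCases <;> simp
    · congr 1
      funext i
      induction i using Fin.lastCases <;> simp

theorem realize_sentence (φ : L.Sentence) : hP.Quot ⊨ φ ↔ P.satForm (formulaCode φ) [] := by
  have := hP.realize_iff φ (fun i => i.elim0)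
  rw [List.ofFn_zero] at this
  rw [← this, Sentence.Realize, Formula.Realize]
  exact iff_of_eq (congrArg₂ _ (Subsingleton.elim _ _) (Subsingleton.elim _ _))

end HasQuotient

end PreStr

/-! ### The axioms of identity give a quotient structure -/

namespace PreStr

variable {O : Type*} {P : PreStr O}

theorem satForm_varEq {n : ℕ} (v : Fin n → O) (i j : Fin n) :
    P.satForm (formulaCode (varEq i j : L.BoundedFormula Empty n)) (List.ofFn v) ↔
      P.EQ (v i) (v j) := by
  rw [varEq, satForm_equal_var, satTerm_var]

theorem satForm_valueEq {n l : ℕ} (f : L.Functions l) (v : Fin n → O) (i : Fin l → Fin n)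
    (j : Fin n) : P.satForm (formulaCode (valueEq f i j)) (List.ofFn v) ↔
      P.Val f (fun k => v (i k)) (v j) := by
  rw [valueEq, satForm_equal_var, satTerm_func]
  simp only [satTerm_var, Val]

/-- Each field is the evaluated form of one of the axioms. Existentials in them are written as
negated universals, so the clauses for implication, falsity and universal quantification suffice to
unfold them. -/
theorem hasQuotient (h : ∀ φ ∈ identityAxioms L, P.satForm (formulaCode φ) []) :
    P.HasQuotient L := by
  have hf : ∀ {l} (f : L.Functions l), ∀ φ ∈ functionAxioms f, P.satForm (formulaCode φ) [] :=
    fun f φ hφ => h φ (.inr (Set.mem_iUnion.2 ⟨⟨_, f⟩, hφ⟩))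
  have hn := h _ (.inl (.inl rfl))
  have hr := h _ (.inl (.inr (.inl rfl)))
  have hs := h _ (.inl (.inr (.inr (.inl rfl))))
  have ht := h _ (.inl (.inr (.inr (.inr rfl))))
  have append : ∀ {l} {xs : Fin l → O} {y y'}, (∀ i, P.Ob (xs i)) → P.Ob y → P.Ob y' →
      ∀ i, P.Ob (Fin.append xs ![y, y'] i) := by
    intro l xs y y' h1 h2 h3 i
    induction i using Fin.addCases with
    | left i => simpa using h1 i
    | right i => fin_cases i <;> simp [*]
  rw [satForm_alls] at hr hs ht
  simp only [satForm_imp, satForm_varEq] at hr hs ht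
  constructor
  -- If there were no objects, the negated universal sentence would be vacuously contradicted.
  · rw [satForm_imp, satForm_all] at hn
    by_contra! hne
    exact satForm_falsum P _ (hn fun x hx => absurd hx (hne x))
  · exact fun x hx => hr ![x] (by simpa using hx)
  · exact fun x y hx hy => hs ![x, y] (by simp [Fin.forall_fin_succ, hx, hy])
  · exact fun x y z hx hy hz => ht ![x, y, z] (by simp [Fin.forall_fin_succ, hx, hy, hz])
  · intro l f xs hxs
    have := hf f _ (.inl rfl)
    rw [satForm_alls] at this
    have := this xs hxs
    rw [satForm_imp, satForm_all] at this
    by_contra! hne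
    refine satForm_falsum P _ (this fun y hy => ?_)
    rw [← ofFn_snoc, satForm_imp, satForm_valueEq]
    intro hv
    exact absurd (by simpa using hv) (hne y hy)
  · intro l f xs y y' hxs hy hy' h1 h2
    have := hf f _ (.inr (.inl rfl))
    simp only [satForm_alls, satForm_imp, satForm_varEq, satForm_valueEq] at this
    simpa using this (Fin.append xs ![y, y']) (append hxs hy hy') (by simpa using h1)
      (by simpa using h2)
  · intro l f xs y y' hxs hy hy' h1 h2
    have := hf f _ (.inr (.inr rfl))
    simp only [satForm_alls, satForm_imp, satForm_varEq, satForm_valueEq] at this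
    simpa using this (Fin.append xs ![y, y']) (append hxs hy hy') (by simpa using h1)
      (by simpa using h2)

end PreStr

/-! ### A translation into a decidable structure -/

/-- In an equivalence structure with finitely many classes of specified finite sizes, no
translation makes the axioms of an essentially undecidable theory true. -/
theorem exists_not_hold {U A : L.Theory} (hU : EssentiallyUndecidable U)
    (hA : theorems A = theorems U) (e : TrCode) (X : List ℕ) :
    ∃ k ∈ codes (A ∪ identityAxioms L), ¬ e.Hold (points {x | x ∈ X}) k := by
  by_contra! H
  have HA : ∀ φ ∈ A ∪ identityAxioms L, e.Hold (points {x | x ∈ X}) (formulaCode φ) :=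
    fun φ hφ => H _ ⟨φ, hφ, rfl⟩
  -- Any single axiom yields admissible parameters, since their existence is part of `Hold`.
  obtain ⟨p, hp⟩ := (HA _ (.inr (.inl (.inl rfl)))).1
  have quot : ∀ p, e.Admissible (points {x | x ∈ X}) p →
      (e.pre (points {x | x ∈ X}) p).HasQuotient L :=
    fun p hp => PreStr.hasQuotient fun φ hφ => (HA φ (.inr hφ)).2 p hp
  -- As parameters vary, `T` is the intersection of the complete theories of the quotient
  -- structures. It is therefore deductively closed, and it is consistent because admissible
  -- parameters exist.
  let T : L.Theory := {φ | e.Hold (points {x | x ∈ X}) (formulaCode φ)}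
  have model : ∀ p (hp : e.Admissible (points {x | x ∈ X}) p), (quot p hp).Quot ⊨ T := by
    intro p hp
    rw [Theory.model_iff]
    exact fun φ hφ => ((quot p hp).realize_sentence φ).2 (hφ.2 p hp)
  have closed : theorems T = T := by
    ext φ
    constructor
    · intro h
      refine ⟨⟨p, hp⟩, fun p hp => ?_⟩
      have := model p hp
      exact ((quot p hp).realize_sentence φ).1 (Theory.ModelsBoundedFormula.realize_sentence h _)
    · exact fun h => Theory.models_sentence_of_mem h
  have sub : theorems U ⊆ theorems T := by
    intro φ h
    rw [← hA] at h
    rw [closed]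
    refine ⟨⟨p, hp⟩, fun p hp => ?_⟩
    have := model p hp
    have : (quot p hp).Quot ⊨ A := (model p hp).mono fun φ hφ => HA φ (.inl hφ)
    exact ((quot p hp).realize_sentence φ).1 (Theory.ModelsBoundedFormula.realize_sentence h _)
  have := model p hp
  refine hU T sub (Theory.Model.isSatisfiable (quot p hp).Quot) ?_
  rw [IsDecidable, closed]
  -- The decision procedure for `T` tests whether `k` codes a sentence and then evaluates it in a
  -- finite structure whose size depends on `k`. Locality transfers the answer to `points X`.
  have hold : PrimrecPred fun k => e.Hold (pointsBelow {x | x ∈ X} (2 * e.use k)) k :=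
    (TrCode.primrecPred_hold :).comp (Primrec.pair (Primrec.const (e, X)) Primrec.id)
  refine ((primrecPred_isSentenceCode (L := L)).and hold).computablePred.of_eq fun k => ?_
  rw [e.hold_congr le_rfl (good_pointsBelow (Y := {x | x ∈ X}) fun n _ => Iff.rfl)
    (good_points (Y := {x | x ∈ X}) fun n _ => Iff.rfl)]
  constructor
  · rintro ⟨⟨φ, rfl⟩, h⟩
    exact ⟨φ, h, rfl⟩
  · rintro ⟨φ, h, rfl⟩
    exact ⟨⟨φ, rfl⟩, h⟩

end Quotient

end Interp

namespace Interp

open FirstOrder FirstOrder.Language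

/-! ### The language of equivalence relations -/

/-- The relation symbols of the language of equivalence relations. -/
inductive EquivSymbol : ℕ → Type
  | rel : EquivSymbol 2

/-- The language of equivalence relations, with one binary relation symbol. -/
def equivLang : FirstOrder.Language.{0, 0} := ⟨fun _ => Empty, EquivSymbol⟩

instance : FiniteSignature equivLang where
  finite_functions := Finite.of_injective (β := Empty) (fun s => s.2) fun s => s.2.elim
  finite_relations := by
    refine Finite.of_injective (β := Unit) (fun _ => ()) ?_
    rintro ⟨_, ⟨⟩⟩ ⟨_, ⟨⟩⟩ _
    rfl

instance (S : Set ℕ) : equivLang.Structure S where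
  funMap f := Empty.elim f
  RelMap R := match R with
    | .rel => fun x => cls (x 0) = cls (x 1)

/-! ### Coding formulas of equivalence relations -/

/-- The values of a list of variables. -/
def vals {S : Set ℕ} {n : ℕ} (x : Fin n → S) : List ℕ := List.ofFn fun i => (x i : ℕ)

@[simp] theorem length_vals {S : Set ℕ} {n : ℕ} (x : Fin n → S) : (vals x).length = n := by
  simp [vals]

theorem getElem?_vals {S : Set ℕ} {n : ℕ} (x : Fin n → S) (i : Fin n) :
    (vals x)[(i : ℕ)]? = some (x i : ℕ) := by
  simp [vals]

theorem getElem?_append_vals {S : Set ℕ} {n b : ℕ} {l : List ℕ} (hl : l.length = b)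
    (x : Fin n → S) (i : Fin n) : (l ++ vals x)[b + i]? = some (x i : ℕ) := by
  rw [List.getElem?_append_right (by omega), ← hl, Nat.add_sub_cancel_left, getElem?_vals]

theorem mem_of_mem_vals {S : Set ℕ} {n : ℕ} {x : Fin n → S} {y : ℕ} (h : y ∈ vals x) : y ∈ S := by
  obtain ⟨i, rfl⟩ := List.mem_ofFn.1 h
  exact (x i).2

theorem exists_vals_eq {S : Set ℕ} {n : ℕ} {l : List ℕ} (h : ∀ y ∈ l, y ∈ S) (hl : l.length = n) :
    ∃ x : Fin n → S, vals x = l := by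
  subst hl
  exact ⟨fun i => ⟨l[i], h _ (List.getElem_mem _)⟩, by simp [vals]⟩

theorem vals_snoc {S : Set ℕ} {n : ℕ} (x : Fin n → S) (y : S) :
    vals (Fin.snoc x y : Fin (n + 1) → S) = vals x ++ [(y : ℕ)] := by
  rw [vals, List.ofFn_succ', List.concat_eq_append]
  simp [vals]

/-- Free variables are read from a prefix `l` at the positions `pos`, and the bound variable `i` at
`b + i`. The length of the prefix is fixed in advance so that one code works for all structures and
values. -/
theorem exists_code_boundedFormula {α : Type} {b : ℕ} (pos : α → ℕ) {n : ℕ}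
    (φ : equivLang.BoundedFormula α n) : ∃ c, ∀ (S : Set ℕ) (l : List ℕ) (v : α → S)
      (x : Fin n → S), l.length = b → (∀ a, l[pos a]? = some (v a : ℕ)) →
      (satK S c (l ++ vals x) ↔ φ.Realize v x) := by
  have hvar : ∀ {n : ℕ} (t : equivLang.Term (α ⊕ Fin n)), ∃ i : ℕ, ∀ (S : Set ℕ) (l : List ℕ)
      (v : α → S) (x : Fin n → S), l.length = b → (∀ a, l[pos a]? = some (v a : ℕ)) →
      (l ++ vals x)[i]? = some ((t.realize (Sum.elim v x) : S) : ℕ) := by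
    intro n t
    rcases t with (a | i) | ⟨f, _⟩
    · refine ⟨pos a, fun S l v x hb h => ?_⟩
      rw [List.getElem?_append_left (List.getElem?_eq_some_iff.1 (h a)).1, h]
      rfl
    · refine ⟨b + i, fun S l v x hb h => ?_⟩
      rw [getElem?_append_vals hb]
      rfl
    · exact Empty.elim f
  induction φ with
  | falsum =>
    -- Every tag above `3` is evaluated as false by `satK`.
    refine ⟨Nat.pair 4 0, fun S l v x hb h => ?_⟩
    rw [satK]
    simp [BoundedFormula.Realize]
  | equal t s =>
    obtain ⟨i, hi⟩ := hvar t
    obtain ⟨j, hj⟩ := hvar s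
    refine ⟨Nat.pair 0 (Nat.pair i j), fun S l v x hb h => ?_⟩
    rw [satK]
    simp [BoundedFormula.Realize, hi S l v x hb h, hj S l v x hb h, Subtype.ext_iff]
  | rel R ts =>
    cases R
    obtain ⟨i, hi⟩ := hvar (ts 0)
    obtain ⟨j, hj⟩ := hvar (ts 1)
    refine ⟨Nat.pair 1 (Nat.pair i j), fun S l v x hb h => ?_⟩
    rw [satK]
    simp only [Nat.unpair_pair, hi S l v x hb h, hj S l v x hb h]
    simp
    rfl
  | imp φ ψ ih1 ih2 =>
    obtain ⟨c, hc⟩ := ih1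
    obtain ⟨d, hd⟩ := ih2
    refine ⟨Nat.pair 2 (Nat.pair c d), fun S l v x hb h => ?_⟩
    rw [satK]
    simp [hc S l v x hb h, hd S l v x hb h]
  | all φ ih =>
    obtain ⟨c, hc⟩ := ih
    refine ⟨Nat.pair 3 c, fun S l v x hb h => ?_⟩
    rw [satK]
    simp only [Nat.unpair_pair, List.append_assoc, BoundedFormula.realize_all,
      Subtype.forall]
    simp
    refine forall₂_congr fun y hy => ?_
    rw [← hc S l v _ hb h, vals_snoc]

theorem exists_code {r : ℕ} {X : Type} {b : ℕ} (pos : X → ℕ) (φ : equivLang.Formula (Fin r ⊕ X)) :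
    ∃ c, ∀ (S : Set ℕ) (p : Fin r → S) (l : List ℕ) (g : X → S), l.length = b →
      (∀ a, l[pos a]? = some (g a : ℕ)) →
      (satK S c (vals p ++ l) ↔ φ.Realize (Sum.elim p g)) := by
  obtain ⟨c, hc⟩ := exists_code_boundedFormula (b := r + b) 
    (Sum.elim (fun i : Fin r => (i : ℕ)) fun a => r + pos a) φ
  refine ⟨c, fun S p l g hb h => ?_⟩
  rw [← List.append_nil (vals p ++ l)]
  refine hc S _ _ default (by simp [hb]) ?_
  rintro (i | a)
  · rw [Sum.elim_inl, List.getElem?_append_left (by simp), getElem?_vals]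
    rfl
  · rw [Sum.elim_inr, List.getElem?_append_right (by simp)]
    simpa using h a

theorem getElem?_flatten {A : Type*} (ls : List (List A)) {i j : ℕ} (hi : i < ls.length)
    (hj : j < ls[i].length) : ls.flatten[((ls.take i).map List.length).sum + j]? = ls[i][j]? := by
  induction ls generalizing i with
  | nil => simp at hi
  | cons l ls ih =>
    rcases i with _ | i
    · simp only [List.getElem_cons_zero] at hj
      simp [List.getElem?_append_left, hj]
    · simp only [List.getElem_cons_succ] at hj ⊢
      rw [← ih (by simpa using hi) hj]
      simp [List.getElem?_append_right, add_assoc]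

/-! ### Coding translations -/

theorem Table.exists_get {ι : Type*} [Finite ι] {key : ι → List ℕ} (hkey : Function.Injective key)
    (val : ι → ℕ) : ∃ t : Table, ∀ i, t.get (key i) = val i := by
  classical
  cases nonempty_fintype ι
  have : ∀ l : List ι, ∀ i ∈ l, (l.map fun i => (key i, val i)).lookup (key i) = some (val i) := by
    intro l
    induction l with
    | nil => simp
    | cons j l ih =>
      intro i hi
      rw [List.map_cons, List.lookup_cons]
      by_cases h : i = j
      · simp [h]
      · have : (key i == key j) = false := by simpa using fun e => h (hkey e)
        rw [this]
        exact ih i ((List.mem_cons.1 hi).resolve_left h)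
  refine ⟨Finset.univ.toList.map fun i => (key i, val i), fun i => ?_⟩
  rw [Table.get, this _ i (by simp)]
  rfl

variable {L : FirstOrder.Language.{0, 0}} [FiniteSignature L]

/-- The code `e` represents the translation `τ`. -/
structure TrCode.Represents (e : TrCode) (τ : Translation L equivLang) : Prop where
  npieces : e.npieces = τ.npieces
  npar : e.npar = τ.npar
  dim : ∀ a : Fin τ.npieces, e.dim.get [(a : ℕ)] = τ.dim a
  par : ∀ (S : Set ℕ) (p : Fin τ.npar → S), satK S e.par (vals p) ↔ τ.par.Realize p
  dom : ∀ (S : Set ℕ) (p : Fin τ.npar → S) a (x : Fin (τ.dim a) → S),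
    satK S (e.dom.get [(a : ℕ)]) (vals p ++ vals x) ↔ (τ.dom a).Realize (Sum.elim p x)
  eq : ∀ (S : Set ℕ) (p : Fin τ.npar → S) a b (x : Fin (τ.dim a) → S) (y : Fin (τ.dim b) → S),
    satK S (e.eq.get [(a : ℕ), (b : ℕ)]) (vals p ++ (vals x ++ vals y)) ↔
      (τ.eq a b).Realize (Sum.elim p (Sum.elim x y))
  rel : ∀ (S : Set ℕ) (p : Fin τ.npar → S) {l} (R : L.Relations l) (a : Fin l → Fin τ.npieces)
    (x : ∀ i, Fin (τ.dim (a i)) → S),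
    satK S (e.rel.get (relationNumber ⟨l, R⟩ :: List.ofFn fun i => (a i : ℕ)))
        (vals p ++ (List.ofFn fun i => vals (x i)).flatten) ↔
      (τ.rel R a).Realize (Sum.elim p fun q => x q.1 q.2)
  fn : ∀ (S : Set ℕ) (p : Fin τ.npar → S) {l} (f : L.Functions l) (a : Fin l → Fin τ.npieces)
    (b : Fin τ.npieces) (x : ∀ i, Fin (τ.dim (a i)) → S) (y : Fin (τ.dim b) → S),
    satK S (e.fn.get (functionNumber ⟨l, f⟩ :: (b : ℕ) :: List.ofFn fun i => (a i : ℕ)))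
        (vals p ++ ((List.ofFn fun i => vals (x i)).flatten ++ vals y)) ↔
      (τ.fn f a b).Realize (Sum.elim p (Sum.elim (fun q => x q.1 q.2) y))

theorem length_flatten_vals {S : Set ℕ} {l : ℕ} {d : Fin l → ℕ} (x : ∀ i, Fin (d i) → S) :
    (List.ofFn fun i => vals (x i)).flatten.length = (List.ofFn d).sum := by
  simp [List.length_flatten, List.map_ofFn, Function.comp_def]

theorem getElem?_flatten_vals {S : Set ℕ} {l : ℕ} {d : Fin l → ℕ} (x : ∀ i, Fin (d i) → S)
    (q : Σ i, Fin (d i)) :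
    (List.ofFn fun i => vals (x i)).flatten[((List.ofFn d).take q.1).sum + q.2]? =
      some (x q.1 q.2 : ℕ) := by
  have := getElem?_flatten (List.ofFn fun i => vals (x i)) (i := q.1) (j := q.2) (by simp)
    (by simp)
  rw [List.map_take, List.map_ofFn] at this
  simpa [Function.comp_def, vals] using this

/-- The signature and the number of pieces are finite, so a translation consists of finitely many
formulas and fits into finite tables. The key of an entry is the number of the symbol followed by
the pieces of its value, if it has one, and of its arguments. -/
theorem exists_represents (τ : Translation L equivLang) : ∃ e : TrCode, e.Represents τ := by
  -- Injectivity of the keys: the number of the symbol determines the arity, after which the list of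
  -- pieces determines the function.
  have inj : ∀ {l l' : ℕ} {a : Fin l → Fin τ.npieces} {a' : Fin l' → Fin τ.npieces},
      (List.ofFn fun i => (a i : ℕ)) = List.ofFn (fun i => (a' i : ℕ)) → l = l' → HEq a a' := by
    rintro l _ a a' h rfl
    rw [List.ofFn_inj] at h
    exact heq_of_eq (funext fun i => Fin.ext (congrFun h i))
  obtain ⟨par, hpar⟩ := exists_code_boundedFormula (b := τ.npar) (fun i : Fin _ => (i : ℕ)) τ.par
  obtain ⟨dim, hdim⟩ := Table.exists_get (key := fun a : Fin τ.npieces => [(a : ℕ)])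
    (fun a b h => Fin.ext (by simpa using h)) τ.dim
  choose cdom hdom using fun a => exists_code (b := τ.dim a) (fun i : Fin _ => (i : ℕ)) (τ.dom a)
  obtain ⟨dom, hdom'⟩ := Table.exists_get (key := fun a : Fin τ.npieces => [(a : ℕ)])
    (fun a b h => Fin.ext (by simpa using h)) cdom
  choose ceq heq using fun q : Fin τ.npieces × Fin τ.npieces =>
    exists_code (b := τ.dim q.1 + τ.dim q.2)
      (Sum.elim (fun i : Fin _ => (i : ℕ)) fun i : Fin _ => τ.dim q.1 + (i : ℕ)) (τ.eq q.1 q.2)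
  obtain ⟨eq, heq'⟩ := Table.exists_get
    (key := fun q : Fin τ.npieces × Fin τ.npieces => [(q.1 : ℕ), (q.2 : ℕ)])
    (fun a b h => by simpa [Prod.ext_iff, Fin.ext_iff] using h) ceq
  choose crel hrel using fun q : Σ R : (Σ l, L.Relations l), (Fin R.1 → Fin τ.npieces) =>
    exists_code (b := (List.ofFn fun i => τ.dim (q.2 i)).sum)
      (fun k : Σ i : Fin q.1.1, Fin (τ.dim (q.2 i)) => ((List.ofFn fun i => τ.dim (q.2 i)).take
        k.1).sum + k.2) (τ.rel q.1.2 q.2)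
  obtain ⟨rel, hrel'⟩ := Table.exists_get
    (key := fun q : Σ R : (Σ l, L.Relations l), (Fin R.1 → Fin τ.npieces) =>
      relationNumber q.1 :: List.ofFn fun i => (q.2 i : ℕ))
    (by
      rintro ⟨R, a⟩ ⟨R', a'⟩ h
      simp only [List.cons.injEq] at h
      obtain rfl := relationNumber_injective h.1
      rw [eq_of_heq (inj h.2 rfl)]) crel
  choose cfn hfn using fun q : Σ f : (Σ l, L.Functions l),
      (Fin f.1 → Fin τ.npieces) × Fin τ.npieces =>
    exists_code (b := (List.ofFn fun i => τ.dim (q.2.1 i)).sum + τ.dim q.2.2)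
      (Sum.elim (fun k : Σ i : Fin q.1.1, Fin (τ.dim (q.2.1 i)) =>
        ((List.ofFn fun i => τ.dim (q.2.1 i)).take k.1).sum + k.2) fun k : Fin _ =>
        (List.ofFn fun i => τ.dim (q.2.1 i)).sum + (k : ℕ)) (τ.fn q.1.2 q.2.1 q.2.2)
  obtain ⟨fn, hfn'⟩ := Table.exists_get
    (key := fun q : Σ f : (Σ l, L.Functions l), (Fin f.1 → Fin τ.npieces) × Fin τ.npieces =>
      functionNumber q.1 :: (q.2.2 : ℕ) :: List.ofFn fun i => (q.2.1 i : ℕ))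
    (by
      rintro ⟨R, a, b⟩ ⟨R', a', b'⟩ h
      simp only [List.cons.injEq] at h
      obtain rfl := functionNumber_injective h.1
      rw [eq_of_heq (inj h.2.2 rfl), Fin.ext h.2.1]) cfn
  refine ⟨((τ.npieces, τ.npar, par), dim, dom, eq, rel, fn), rfl, rfl, hdim, ?_, ?_, ?_, ?_, ?_⟩
  · intro S p
    have := hpar S (vals p) p default (by simp) (getElem?_vals p)
    rw [Formula.Realize, ← this]
    exact iff_of_eq (congrArg _ (List.append_nil _).symm)
  · intro S p a x
    refine (iff_of_eq (congrArg (satK S · _) (hdom' a))).trans ?_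
    exact hdom a S p _ x (by simp) (getElem?_vals x)
  · intro S p a b x y
    refine (iff_of_eq (congrArg (satK S · _) (heq' (a, b)))).trans ?_
    refine heq (a, b) S p _ _ (by simp) ?_
    rintro (i | i)
    · rw [Sum.elim_inl, List.getElem?_append_left (by simp), getElem?_vals]
      rfl
    · exact getElem?_append_vals (length_vals x) y i
  · intro S p l R a x
    refine (iff_of_eq (congrArg (satK S · _) (hrel' ⟨⟨l, R⟩, a⟩))).trans ?_
    exact hrel ⟨⟨l, R⟩, a⟩ S p _ _ (length_flatten_vals x) (getElem?_flatten_vals x)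
  · intro S p l f a b x y
    refine (iff_of_eq (congrArg (satK S · _) (hfn' ⟨⟨l, f⟩, a, b⟩))).trans ?_
    refine hfn ⟨⟨l, f⟩, a, b⟩ S p _ _
      (by rw [List.length_append, length_flatten_vals, length_vals]) ?_
    rintro (k | k)
    · rw [Sum.elim_inl, List.getElem?_append_left, getElem?_flatten_vals x]
      · rfl
      · exact (List.getElem?_eq_some_iff.1 (getElem?_flatten_vals x k)).1
    · exact getElem?_append_vals (length_flatten_vals x) y k

end Interp

namespace Interp

open FirstOrder FirstOrder.Language

/-! ### Truth of blocks of quantifiers -/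

section Blocks

variable {K : FirstOrder.Language.{0, 0}} {M α : Type} [K.Structure M] {m : ℕ} {v : α → M}
  {x : Fin m → M}

theorem realize_conj {φs : List (K.BoundedFormula α m)} :
    (conj φs).Realize v x ↔ ∀ φ ∈ φs, φ.Realize v x :=
  BoundedFormula.realize_foldr_inf φs v x

theorem realize_disj {φs : List (K.BoundedFormula α m)} :
    (disj φs).Realize v x ↔ ∃ φ ∈ φs, φ.Realize v x :=
  BoundedFormula.realize_foldr_sup φs v x

theorem realize_allBlock {k : ℕ} {φ : K.BoundedFormula α (m + k)} :
    (allBlock k φ).Realize v x ↔ ∀ y : Fin k → M, φ.Realize v (Fin.append x y) := by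
  induction k with
  | zero =>
    rw [Unique.forall_iff, show Fin.append x (default : Fin 0 → M) = x from
      funext (Fin.append_left x (default : Fin 0 → M))]
    rfl
  | succ k ih =>
    rw [allBlock, ih]
    simp only [BoundedFormula.realize_all]
    constructor
    · intro h y
      induction y using Fin.snocCases with
      | snoc y z =>
        rw [Fin.append_snoc]
        exact h y z
    · intro h y z
      rw [← Fin.append_snoc]
      exact h _

theorem realize_exBlock {k : ℕ} {φ : K.BoundedFormula α (m + k)} :
    (exBlock k φ).Realize v x ↔ ∃ y : Fin k → M, φ.Realize v (Fin.append x y) := by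
  induction k with
  | zero =>
    rw [Unique.exists_iff, show Fin.append x (default : Fin 0 → M) = x from
      funext (Fin.append_left x (default : Fin 0 → M))]
    rfl
  | succ k ih =>
    rw [exBlock, ih]
    simp only [BoundedFormula.realize_ex]
    constructor
    · rintro ⟨y, z, h⟩
      rw [← Fin.append_snoc] at h
      exact ⟨_, h⟩
    · rintro ⟨y, h⟩
      induction y using Fin.snocCases with
      | snoc y z =>
        rw [Fin.append_snoc] at h
        exact ⟨y, z, h⟩

end Blocks

/-! ### The meaning of translations -/

namespace TrCode.Represents

variable {L : FirstOrder.Language.{0, 0}} {τ : Translation L equivLang} {S : Set ℕ} {m : ℕ}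

/-- The object denoted by a variable for objects. -/
def obj (x : τ.Obj m) (v : Fin m → S) : ℕ × List ℕ := (x.1, vals fun j => v (x.2 j))

theorem obj_lift (x : τ.Obj m) {k : ℕ} (v : Fin m → S) (w : Fin k → S) :
    obj (x.lift k) (Fin.append v w) = obj x v := by
  simp only [obj, Translation.Obj.lift, Fin.append_left]

theorem obj_fresh (a : Fin τ.npieces) (v : Fin m → S) (w : Fin (τ.dim a) → S) :
    obj (τ.fresh m a) (Fin.append v w) = ((a : ℕ), vals w) := by
  simp only [obj, Translation.fresh, Fin.append_right]

theorem realize_inst {X : Type} (φ : equivLang.Formula (Fin τ.npar ⊕ X)) (g : X → Fin m)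
    (p : Fin τ.npar → S) (v : Fin m → S) :
    (τ.inst φ g).Realize p v ↔ φ.Realize (Sum.elim p fun j => v (g j)) := by
  rw [Translation.inst, BoundedFormula.realize_relabel, Formula.Realize]
  refine iff_of_eq (congrArg₂ _ ?_ (Subsingleton.elim _ _))
  funext j
  rcases j <;> simp

variable [FiniteSignature L] {e : TrCode}

theorem ob_iff (he : e.Represents τ) (p : Fin τ.npar → S) {o : ℕ × List ℕ} : (e.pre S (vals p)).Ob o
    ↔
    ∃ (a : Fin τ.npieces) (w : Fin (τ.dim a) → S), o = ((a : ℕ), vals w) ∧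
      (τ.dom a).Realize (Sum.elim p w) := by
  constructor
  · rintro ⟨h1, h2, h3, h4⟩
    obtain ⟨a, l⟩ := o
    rw [he.npieces] at h1
    lift a to Fin τ.npieces using h1
    rw [he.dim] at h2
    obtain ⟨w, rfl⟩ := exists_vals_eq h3 h2
    exact ⟨a, w, rfl, (he.dom S p a w).1 h4⟩
  · rintro ⟨a, w, rfl, h⟩
    exact ⟨a.2.trans_eq he.npieces.symm, (length_vals w).trans (he.dim a).symm, fun _ =>
        mem_of_mem_vals,
      (he.dom S p a w).2 h⟩

theorem realize_eqF (he : e.Represents τ) (p : Fin τ.npar → S) (x y : τ.Obj m) (v : Fin m → S) :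
    (τ.eqF x y).Realize p v ↔ (e.pre S (vals p)).EQ (obj x v) (obj y v) := by
  rw [Translation.eqF, realize_inst]
  refine (iff_of_eq ?_).trans (he.eq S p x.1 y.1 (fun j => v (x.2 j)) fun j => v (y.2 j)).symm
  congr 2
  funext j
  rcases j <;> rfl

theorem realize_relF (he : e.Represents τ) (p : Fin τ.npar → S) {l : ℕ} (R : L.Relations l)
    (x : Fin l → τ.Obj m) (v : Fin m → S) :
    (τ.relF R x).Realize p v ↔ (e.pre S (vals p)).HD (relationNumber ⟨l, R⟩)
      (List.ofFn fun i => obj (x i) v) none := by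
  rw [Translation.relF, realize_inst]
  refine (he.rel S p R (fun i => (x i).1) fun i j => v ((x i).2 j)).symm.trans (iff_of_eq ?_)
  simp only [pre, List.map_ofFn]
  rfl

theorem realize_fnF (he : e.Represents τ) (p : Fin τ.npar → S) {l : ℕ} (f : L.Functions l)
    (x : Fin l → τ.Obj m) (y : τ.Obj m)
    (v : Fin m → S) :
    (τ.fnF f x y).Realize p v ↔ (e.pre S (vals p)).HD (functionNumber ⟨l, f⟩)
      (List.ofFn fun i => obj (x i) v) (some (obj y v)) := by
  rw [Translation.fnF, realize_inst]
  refine .trans (iff_of_eq ?_) ((he.fn S p f (fun i => (x i).1) y.1 (fun i j => v ((x i).2 j))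
    fun j => v (y.2 j)).symm.trans (iff_of_eq ?_))
  · congr 2
    funext j
    rcases j <;> rfl
  · simp only [pre, List.map_ofFn]
    rfl

theorem realize_allObj (he : e.Represents τ) (p : Fin τ.npar → S)
    {φ : (a : Fin τ.npieces) → equivLang.BoundedFormula (Fin τ.npar) (m + τ.dim a)}
    {v : Fin m → S} {q : ℕ × List ℕ → Prop} (h : ∀ a (w : Fin (τ.dim a) → S),
      (φ a).Realize p (Fin.append v w) ↔ q ((a : ℕ), vals w)) :
    (τ.allObj φ).Realize p v ↔ ∀ o, (e.pre S (vals p)).Ob o → q o := by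
  rw [Translation.allObj, realize_conj]
  simp only [List.mem_map, List.mem_finRange, true_and, forall_exists_index,
    forall_apply_eq_imp_iff, realize_allBlock, BoundedFormula.realize_imp, h, he.ob_iff,
    Translation.domF, realize_inst, Translation.fresh, Fin.append_right, and_imp]
  constructor
  · rintro H o a w rfl hw
    exact H a w hw
  · exact fun H a w hw => H _ a w rfl hw

theorem realize_exObj (he : e.Represents τ) (p : Fin τ.npar → S)
    {φ : (a : Fin τ.npieces) → equivLang.BoundedFormula (Fin τ.npar) (m + τ.dim a)}
    {v : Fin m → S} {q : ℕ × List ℕ → Prop} (h : ∀ a (w : Fin (τ.dim a) → S),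
      (φ a).Realize p (Fin.append v w) ↔ q ((a : ℕ), vals w)) :
    (τ.exObj φ).Realize p v ↔ ∃ o, (e.pre S (vals p)).Ob o ∧ q o := by
  rw [Translation.exObj, realize_disj]
  simp only [List.mem_map, List.mem_finRange, true_and, exists_exists_eq_and, realize_exBlock,
    BoundedFormula.realize_inf, h, he.ob_iff, Translation.domF, realize_inst, Translation.fresh,
    Fin.append_right]
  constructor
  · rintro ⟨a, w, hw, hq⟩
    exact ⟨_, ⟨a, w, rfl, hw⟩, hq⟩
  · rintro ⟨o, ⟨a, w, rfl, hw⟩, hq⟩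
    exact ⟨a, w, hw, hq⟩

theorem realize_exObjs (he : e.Represents τ) (p : Fin τ.npar → S) {l : ℕ}
    {φ : (a : Fin l → Fin τ.npieces) →
      equivLang.BoundedFormula (Fin τ.npar) (m + ∑ i, τ.dim (a i))}
    {v : Fin m → S} {q : (Fin l → ℕ × List ℕ) → Prop}
    (h : ∀ a (w : Fin (∑ i, τ.dim (a i)) → S), (φ a).Realize p (Fin.append v w) ↔
      q fun i => obj (τ.freshes m a i) (Fin.append v w)) :
    (τ.exObjs l φ).Realize p v ↔
      ∃ o : Fin l → ℕ × List ℕ, (∀ i, (e.pre S (vals p)).Ob (o i)) ∧ q o := by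
  rw [Translation.exObjs, realize_disj]
  simp only [List.mem_map, List.mem_finRange, true_and, exists_exists_eq_and, realize_exBlock,
    BoundedFormula.realize_inf, h, realize_conj, List.forall_mem_ofFn_iff]
  -- The disjunction runs over numbers below `npieces ^ l`. It is turned into a quantifier over all
  -- assignments of pieces.
  rw [finFunctionFinEquiv.symm.surjective.exists (p := fun a => ∃ w : Fin (∑ i, τ.dim (a i)) → S,
    (∀ i, (τ.domF (τ.freshes m a i)).Realize p (Fin.append v w)) ∧
      q fun i => obj (τ.freshes m a i) (Fin.append v w)) |>.symm]
  simp only [he.ob_iff, Translation.domF, realize_inst, Translation.freshes, Fin.append_right,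
    obj]
  constructor
  · rintro ⟨a, w, hw, hq⟩
    exact ⟨_, fun i => ⟨a i, _, rfl, hw i⟩, hq⟩
  · rintro ⟨o, ho, hq⟩
    choose a w ho hw using ho
    obtain rfl := funext ho
    -- The tuples of the separate objects are glued into the single block of variables that the
    -- quantifiers bind.
    let g : (Σ i, Fin (τ.dim (a i))) → S := fun k => w k.1 k.2
    have hg : ∀ i j, g (finSigmaFinEquiv.symm (finSigmaFinEquiv ⟨i, j⟩)) = w i j := fun i j => by
      rw [Equiv.symm_apply_apply]
    refine ⟨a, fun k => g (finSigmaFinEquiv.symm k), ?_⟩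
    simp only [hg]
    exact ⟨hw, hq⟩

theorem realize_termGraph (he : e.Represents τ) (p : Fin τ.npar → S) {n : ℕ}
    (t : L.Term (Empty ⊕ Fin n)) :
    ∀ {m : ℕ} (env : Fin n → τ.Obj m) (y : τ.Obj m) (v : Fin m → S),
    (τ.termGraph t env y).Realize p v ↔ (e.pre S (vals p)).satTerm (termCode t)
      (List.ofFn fun i => obj (env i) v) (obj y v) := by
  induction t with
  | var x =>
    intro m env y v
    rcases x with x | i
    · exact x.elim
    · rw [PreStr.satTerm_var, Translation.termGraph, he.realize_eqF]
  | func f ts ih =>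
    intro m env y v
    rw [Translation.termGraph, PreStr.satTerm_func]
    simp only [forall_and, and_assoc]
    refine he.realize_exObjs p (q := fun o => (∀ i, (e.pre S (vals p)).satTerm
      (termCode (ts i)) (List.ofFn fun i => obj (env i) v) (o i)) ∧
        (e.pre S (vals p)).HD _ (List.ofFn o) (some (obj y v))) fun a w => ?_
    rw [BoundedFormula.realize_inf, realize_conj, List.forall_mem_ofFn_iff, he.realize_fnF]
    simp only [ih, obj_lift]

/-- `satForm` was set up to follow `formulaTr` clause by clause, including the unravelling of nested
terms, so syntactic translation and evaluation of codes agree by induction. -/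
theorem realize_formulaTr (he : e.Represents τ) (p : Fin τ.npar → S) {n : ℕ}
    (φ : L.BoundedFormula Empty n) :
    ∀ {m : ℕ} (env : Fin n → τ.Obj m) (v : Fin m → S),
    (τ.formulaTr φ env).Realize p v ↔ (e.pre S (vals p)).satForm (formulaCode φ)
      (List.ofFn fun i => obj (env i) v) := by
  induction φ with
  | falsum => exact fun env v => iff_of_false id (PreStr.satForm_falsum _ _)
  | equal t s =>
    intro m env v
    rcases s with (x | i) | ⟨f, ts⟩
    · exact x.elim
    · rw [PreStr.satForm_equal_var, Translation.formulaTr, Translation.equalTr,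
        he.realize_termGraph]
    · rw [PreStr.satForm_equal_func, Translation.formulaTr, Translation.equalTr]
      · refine he.realize_exObj p fun a w => ?_
        rw [BoundedFormula.realize_inf, he.realize_termGraph, he.realize_termGraph]
        simp only [obj_lift, obj_fresh]
      · simp
  | rel R ts =>
    intro m env v
    rw [Translation.formulaTr, Translation.relTr, PreStr.satForm_rel]
    simp only [forall_and, and_assoc]
    refine he.realize_exObjs p (q := fun o => (∀ i, (e.pre S (vals p)).satTerm
      (termCode (ts i)) (List.ofFn fun i => obj (env i) v) (o i)) ∧
        (e.pre S (vals p)).HD _ (List.ofFn o) none) fun a w => ?_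
    rw [BoundedFormula.realize_inf, realize_conj, List.forall_mem_ofFn_iff, he.realize_relF]
    simp only [he.realize_termGraph, obj_lift]
  | imp φ ψ ih1 ih2 =>
    intro m env v
    rw [Translation.formulaTr, PreStr.satForm_imp, BoundedFormula.realize_imp, ih1, ih2]
  | all φ ih =>
    intro m env v
    rw [Translation.formulaTr, PreStr.satForm_all]
    refine he.realize_allObj p fun a w => ?_
    rw [ih, ← PreStr.ofFn_snoc]
    refine iff_of_eq (congrArg _ (congrArg _ (funext fun i => ?_)))
    induction i using Fin.lastCases with
    | last => simp [obj_fresh]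
    | cast i => simp [obj_lift]

end TrCode.Represents

/-- The sentences that a theory of equivalence relations proves under a translation hold in the
sense of a coded translation. -/
theorem Interprets.exists_hold {L : FirstOrder.Language.{0, 0}} [FiniteSignature L]
    {V : equivLang.Theory} {U : L.Theory} (h : Interprets V U) :
    ∃ e : TrCode, ∀ S : Set ℕ, S.Nonempty → S ⊨ V → ∀ k ∈ codes (theorems U), e.Hold S k := by
  obtain ⟨τ, h1, h2⟩ := h
  obtain ⟨e, he⟩ := exists_represents τ
  refine ⟨e, ?_⟩
  rintro S hS hV _ ⟨φ, hφ, rfl⟩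
  have := hS.to_subtype
  have adm : ∀ l, e.Admissible S l ↔ ∃ p : Fin τ.npar → S, vals p = l ∧ τ.par.Realize p := by
    intro l
    constructor
    · rintro ⟨g1, g2, g3⟩
      obtain ⟨p, rfl⟩ := exists_vals_eq g2 (g1.trans he.npar)
      exact ⟨p, rfl, (he.par S p).1 g3⟩
    · rintro ⟨p, rfl, hp⟩
      exact ⟨(length_vals p).trans he.npar.symm, fun _ => mem_of_mem_vals, (he.par S p).2 hp⟩
  constructor
  · have := Theory.ModelsBoundedFormula.realize_sentence h1 S
    rw [Sentence.Realize, Translation.parExists, BoundedFormula.realize_exs] at this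
    obtain ⟨p, hp⟩ := this
    rw [BoundedFormula.realize_relabel] at hp
    exact ⟨vals (n := τ.npar) p, (adm _).2 ⟨_, rfl,
      (iff_of_eq (congrArg (BoundedFormula.Realize τ.par _) (Subsingleton.elim _ _))).1 hp⟩⟩
  · intro l hl
    obtain ⟨p, rfl, hp⟩ := (adm l).1 hl
    have := h2 φ hφ |>.realize_boundedFormula S (v := p) (xs := default)
    rw [BoundedFormula.realize_imp] at this
    have := (he.realize_formulaTr p φ _ _).1 (this hp)
    rwa [List.ofFn_zero] at this

end Interp

namespace Interp

open FirstOrder FirstOrder.Language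

/-! ### Sentences about the sizes of classes -/

/-- The variable `x i` is in the same class as `x j`. -/
def sameClass {n : ℕ} (i j : Fin n) : equivLang.BoundedFormula Empty n :=
  .rel EquivSymbol.rel ![.var (.inr i), .var (.inr j)]

/-- The last variable is one of the others, or it is not in the class of the first variable. -/
def notNew (m : ℕ) : equivLang.BoundedFormula Empty (m + 1) :=
  (List.finRange m).foldr (fun i φ => ((varEq i.castSucc (Fin.last m)).imp .falsum).imp φ)
    ((sameClass 0 (Fin.last m)).imp .falsum)

/-- If the variables denote different elements of one class, then there are exactly `j` others. -/
def othersEq : (j m : ℕ) → equivLang.BoundedFormula Empty m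
  | 0, m => (notNew m).all
  | j + 1, m => (((notNew m).imp .falsum).imp ((othersEq j (m + 1)).imp .falsum)).all.imp .falsum

/-- There is a class with `n + 1` elements. -/
def sizeSentence (n : ℕ) : equivLang.Sentence := ((othersEq n 1).imp .falsum).all.imp .falsum

section Realize

variable {S : Set ℕ}

theorem realize_sameClass {n : ℕ} (i j : Fin n) (v : Empty → S) (x : Fin n → S) :
    (sameClass i j).Realize v x ↔ cls (x i) = cls (x j) := Iff.rfl

/-- The formula is a chain of implications from "different from each variable" to "outside the
class". Read contrapositively, a point of the class is among the points already listed. -/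
theorem realize_notNew {m : ℕ} (v : Empty → S) (x : Fin m → S) (y z : S)
    (hz : ∀ h : 0 < m, z = x ⟨0, h⟩) (hm : 0 < m) :
    (notNew m).Realize v (Fin.snoc x y : Fin (m + 1) → S) ↔
      (cls y = cls z → y ∈ Set.range x) := by
  have key : ∀ l : List (Fin m), (l.foldr (fun i φ =>
      ((varEq i.castSucc (Fin.last m)).imp .falsum).imp φ)
      ((sameClass 0 (Fin.last m)).imp .falsum)).Realize v (Fin.snoc x y : Fin (m + 1) → S) ↔
      (cls y = cls z → ∃ i ∈ l, x i = y) := by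
    intro l
    induction l with
    | nil =>
      have h0 : (0 : Fin (m + 1)) = Fin.castSucc ⟨0, hm⟩ := rfl
      rw [List.foldr_nil, BoundedFormula.realize_imp, realize_sameClass, h0, Fin.snoc_castSucc,
        Fin.snoc_last, hz hm]
      simp [BoundedFormula.Realize, eq_comm]
    | cons i l ih =>
      rw [List.foldr_cons, BoundedFormula.realize_imp, ih, BoundedFormula.realize_imp,
        realize_varEq, Fin.snoc_castSucc, Fin.snoc_last]
      simp only [BoundedFormula.Realize, List.exists_mem_cons_iff]
      tauto
  rw [notNew, key]
  simp

/-- Induction on the number `j` of missing points: a new point of the class raises `m` and lowers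
`j` by one, so the asserted size `m + j` is unchanged. When `j = 0`, the listed points exhaust the
class. -/
theorem realize_othersEq (v : Empty → S) (j : ℕ) : ∀ {m : ℕ} (x : Fin m → S) (z : S),
    (∀ h : 0 < m, z = x ⟨0, h⟩) → 0 < m → Function.Injective x → (∀ i, cls (x i) = cls z) →
    ((othersEq j m).Realize v x ↔ {y : S | cls y = cls z}.encard = m + j) := by
  induction j with
  | zero =>
    intro m x z hz hm hx hc
    have hcard : (Set.range x).encard = m := by
      rw [← Set.image_univ, hx.encard_image, Set.encard_univ]
      simp
    have hsub : Set.range x ⊆ {y : S | cls y = cls z} := by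
      rintro _ ⟨i, rfl⟩
      exact hc i
    simp only [othersEq, BoundedFormula.realize_all, realize_notNew v x _ z hz hm,
        CharP.cast_eq_zero,
      add_zero]
    constructor
    · intro h
      rw [← hcard, ← hsub.antisymm h]
    · intro h y hy
      rw [(Set.finite_range x).eq_of_subset_of_encard_le hsub (by rw [h, hcard])]
      exact hy
  | succ j ih =>
    intro m x z hz hm hx hc
    have step : ∀ y : S, cls y = cls z → y ∉ Set.range x →
        ((othersEq j (m + 1)).Realize v (Fin.snoc x y : Fin (m + 1) → S) ↔
          {y : S | cls y = cls z}.encard = m + (j + 1 : ℕ)) := by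
      intro y hy hyx
      rw [ih _ z _ (Nat.succ_pos m) (Fin.snoc_injective_iff.2 ⟨hx, hyx⟩)]
      · rw [Nat.cast_succ, Nat.cast_succ, add_assoc, add_comm (1 : ℕ∞)]
      · intro i
        induction i using Fin.lastCases with
        | last => simpa using hy
        | cast i => simpa using hc i
      · intro _
        rw [hz hm]
        exact (Fin.snoc_castSucc (α := fun _ => S) y x ⟨0, hm⟩).symm
    simp only [othersEq, BoundedFormula.realize_all, BoundedFormula.realize_imp,
      realize_notNew v x _ z hz hm]
    constructor
    · intro h
      by_contra hne
      refine h fun y h1 h2 => ?_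
      by_cases hy : cls y = cls z
      · by_cases hyx : y ∈ Set.range x
        · exact h1 fun _ => hyx
        · exact hne ((step y hy hyx).1 h2)
      · exact h1 fun h => absurd h hy
    · intro h h'
      -- Without a new point the class would have at most `m` elements, too few for `m + (j + 1)`.
      have : ∃ y : S, cls y = cls z ∧ y ∉ Set.range x := by
        by_contra! hsub
        have h1 : {y : S | cls y = cls z}.encard ≤ m := by
          refine (Set.encard_le_encard (t := Set.range x) hsub).trans ?_
          rw [← Set.image_univ, hx.encard_image, Set.encard_univ]
          simp
        rw [h] at h1
        norm_cast at h1
        omega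
      obtain ⟨y, h1, h2⟩ := this
      exact h' y (fun h3 => h2 (h3 h1)) ((step y h1 h2).2 h)

theorem realize_sizeSentence (n : ℕ) :
    S ⊨ sizeSentence n ↔ ∃ z : S, {y : S | cls y = cls z}.encard = n + 1 := by
  rw [sizeSentence, Sentence.Realize, Formula.Realize, BoundedFormula.realize_imp,
    BoundedFormula.realize_all]
  have : ∀ z : S, (othersEq n 1).Realize (default : Empty → S)
      (Fin.snoc (default : Fin 0 → S) z : Fin 1 → S) ↔
        {y : S | cls y = cls z}.encard = n + 1 := by
    intro z
    have hz : ∀ i, (Fin.snoc (default : Fin 0 → S) z : Fin 1 → S) i = z := fun i => by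
      rw [Subsingleton.elim (α := Fin 1) i (Fin.last 0), Fin.snoc_last]
    rw [realize_othersEq _ n _ z (fun _ => (hz _).symm) one_pos
      (fun _ _ _ => Subsingleton.elim (α := Fin 1) _ _) (fun i => by rw [hz]), Nat.cast_one,
        add_comm]
  simp only [BoundedFormula.realize_imp, this]
  simp [BoundedFormula.Realize]

end Realize

theorem points_nonempty (Y : Set ℕ) : (points Y).Nonempty := ⟨Nat.pair 0 0, by simp [points]⟩

/-- The only finite classes are those with number in `Y`, and the size `n + 1` determines the number
`n`. So the sizes that occur record exactly `Y`. -/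
theorem points_realize_sizeSentence (Y : Set ℕ) (n : ℕ) :
    points Y ⊨ sizeSentence n ↔ n ∈ Y := by
  have inj : ∀ i, Function.Injective fun j => Nat.pair i j := fun i j k h => by simpa using h
  have key : ∀ z : points Y, {y : points Y | cls y = cls z}.encard =
      (Nat.pair (cls z) '' {j | cls z ∈ Y → j ≤ cls z}).encard := by
    intro z
    rw [← Subtype.val_injective.encard_image]
    congr 1
    ext y
    simp only [Set.mem_image, Set.mem_ofPred_eq, Subtype.exists, exists_and_left, exists_prop,
      exists_eq_right_right]
    constructor
    · rintro ⟨h1, h2⟩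
      refine ⟨y.unpair.2, fun h => ?_, ?_⟩
      · rw [← h1] at h ⊢
        exact h2 h
      · rw [← h1]
        exact Nat.pair_unpair y
    · rintro ⟨j, h1, rfl⟩
      exact ⟨cls_pair _ _, by simpa [points] using h1⟩
  simp only [realize_sizeSentence, key, (inj _).encard_image]
  constructor
  · rintro ⟨z, h⟩
    by_cases hz : cls z ∈ Y
    · have : {j | cls z ∈ Y → j ≤ cls z} = (Finset.range (cls z + 1) : Set ℕ) := by
        ext j
        simp [hz]
      rw [this, Set.encard_coe_eq_coe_finsetCard, Finset.card_range] at h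
      norm_cast at h
      rwa [← Nat.succ_injective h]
    · have : {j | cls z ∈ Y → j ≤ cls z} = Set.univ := by
        ext j
        simp [hz]
      rw [this, Set.encard_univ] at h
      simp at h
      exact absurd h.symm (ENat.natCast_ne_top (n + 1))
  · intro hn
    refine ⟨⟨Nat.pair n 0, by simp [points]⟩, ?_⟩
    have : {j | n ∈ Y → j ≤ n} = (Finset.range (n + 1) : Set ℕ) := by
      ext j
      simp [hn]
    simp only [cls_pair]
    rw [this, Set.encard_coe_eq_coe_finsetCard, Finset.card_range]
    simp

end Interp

namespace Interp

open FirstOrder FirstOrder.Language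

/-! ### Codes of the sentences about sizes -/

/-- The code of the variable `x i`. -/
def varNumber (i : ℕ) : ℕ := Nat.pair 0 (2 * i + 1)

/-- The code of an implication. -/
def impNumber (a b : ℕ) : ℕ := Nat.pair 3 (Nat.pair a b)

/-- The code of a negation. -/
def notNumber (a : ℕ) : ℕ := impNumber a (Nat.pair 0 0)

/-- The code of a universal quantification. -/
def allNumber (a : ℕ) : ℕ := Nat.pair 4 a

/-- The code of `x i = x j`. -/
def eqNumber (i j : ℕ) : ℕ := Nat.pair 1 (Nat.pair (varNumber i) (varNumber j))

/-- The code of the formula saying that `x i` and `x j` are in one class, where `r` is the number of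
the relation symbol. -/
def classNumber (r i j : ℕ) : ℕ :=
  Nat.pair 2 (Nat.pair r
    (Nat.succ (Nat.pair (varNumber i) (Nat.succ (Nat.pair (varNumber j) 0)))))

/-- The code of `notNew m`. -/
def notNewNumber (r m : ℕ) : ℕ :=
  (List.range m).foldr (fun i c => impNumber (notNumber (eqNumber i m)) c)
    (notNumber (classNumber r 0 m))

/-- The code of `othersEq j (n - j)`. -/
def othersEqNumber (r n j : ℕ) : ℕ :=
  Nat.rec (allNumber (notNewNumber r n)) (fun i c => notNumber (allNumber
    (impNumber (notNumber (notNewNumber r (n - 1 - i))) (notNumber c)))) j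

theorem primrec_varNumber : Primrec varNumber :=
  Primrec₂.natPair.comp (Primrec.const 0)
    (Primrec.succ.comp (Primrec.nat_mul.comp (Primrec.const 2) Primrec.id))

theorem primrec_impNumber : Primrec₂ impNumber :=
  Primrec₂.natPair.comp₂ (Primrec.const 3).to₂ Primrec₂.natPair

theorem primrec_notNumber : Primrec notNumber :=
  primrec_impNumber.comp Primrec.id (Primrec.const _)

theorem primrec_allNumber : Primrec allNumber :=
  Primrec₂.natPair.comp (Primrec.const 4) Primrec.id

theorem primrec_eqNumber : Primrec₂ eqNumber :=
  Primrec₂.natPair.comp₂ (Primrec.const 1).to₂ (Primrec₂.natPair.comp₂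
    (primrec_varNumber.comp₂ Primrec₂.left) (primrec_varNumber.comp₂ Primrec₂.right))

theorem primrec_classNumber (r : ℕ) : Primrec₂ (classNumber r) :=
  Primrec₂.natPair.comp₂ (Primrec.const 2).to₂ (Primrec₂.natPair.comp₂ (Primrec.const r).to₂
    (Primrec.succ.comp₂ (Primrec₂.natPair.comp₂ (primrec_varNumber.comp₂ Primrec₂.left)
      (Primrec.succ.comp₂ (Primrec₂.natPair.comp₂ (primrec_varNumber.comp₂ Primrec₂.right)
        (Primrec.const 0).to₂)))))

theorem primrec_notNewNumber (r : ℕ) : Primrec (notNewNumber r) := by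
  have h1 : Primrec fun m => notNumber (classNumber r 0 m) :=
    primrec_notNumber.comp ((primrec_classNumber r).comp (Primrec.const 0) Primrec.id)
  have h2 : Primrec₂ fun (m : ℕ) (q : ℕ × ℕ) => impNumber (notNumber (eqNumber q.1 m)) q.2 :=
    primrec_impNumber.comp₂ (primrec_notNumber.comp₂ (primrec_eqNumber.comp₂
      (Primrec.fst.comp₂ Primrec₂.right) Primrec₂.left)) (Primrec.snd.comp₂ Primrec₂.right)
  exact (Primrec.list_foldr Primrec.list_range h1 h2 :)

theorem primrec_othersEqNumber (r : ℕ) : Primrec₂ (othersEqNumber r) := by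
  have h1 : Primrec fun n => allNumber (notNewNumber r n) :=
    primrec_allNumber.comp (primrec_notNewNumber r)
  have h2 : Primrec₂ fun (n : ℕ) (q : ℕ × ℕ) => n - 1 - q.1 :=
    Primrec.nat_sub.comp (Primrec.nat_sub.comp Primrec.fst (Primrec.const 1))
      (Primrec.fst.comp Primrec.snd)
  have h3 : Primrec₂ fun (n : ℕ) (q : ℕ × ℕ) => notNumber (allNumber
      (impNumber (notNumber (notNewNumber r (n - 1 - q.1))) (notNumber q.2))) :=
    primrec_notNumber.comp₂ (primrec_allNumber.comp₂ (primrec_impNumber.comp₂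
      (primrec_notNumber.comp₂ ((primrec_notNewNumber r).comp₂ h2))
      (primrec_notNumber.comp₂ (Primrec.snd.comp₂ Primrec₂.right))))
  exact (Primrec.nat_rec h1 h3 :)

/-- The number of the relation symbol. -/
noncomputable def equivNumber : ℕ := relationNumber (L := equivLang) ⟨2, EquivSymbol.rel⟩

theorem formulaCode_notNew (m : ℕ) :
    formulaCode (notNew m) = notNewNumber equivNumber m := by
  have key : ∀ l : List (Fin m), formulaCode (l.foldr (fun i φ =>
      ((varEq i.castSucc (Fin.last m)).imp .falsum).imp φ)
      ((sameClass 0 (Fin.last m)).imp .falsum)) =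
      (l.map Fin.val).foldr (fun i c => impNumber (notNumber (eqNumber i m)) c)
        (notNumber (classNumber equivNumber 0 m)) := by
    intro l
    induction l with
    | nil => rfl
    | cons i l ih =>
      rw [List.foldr_cons, List.map_cons, List.foldr_cons, ← ih]
      rfl
  rw [notNew, key, notNewNumber, List.map_coe_finRange_eq_range]

/-- The sum `m + j` is invariant in the recursion for `othersEq`. Keeping it as a fixed parameter
turns a recursion with varying `m` into ordinary primitive recursion on `j`. -/
theorem formulaCode_othersEq (j : ℕ) : ∀ m, formulaCode (othersEq j m) =
    othersEqNumber equivNumber (m + j) j := by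
  induction j with
  | zero => exact fun m => congrArg allNumber (formulaCode_notNew m)
  | succ j ih =>
    intro m
    have h1 : othersEqNumber equivNumber (m + (j + 1)) (j + 1) =
      notNumber (allNumber (impNumber (notNumber (notNewNumber
        equivNumber (m + (j + 1) - 1 - j))) (notNumber
          (othersEqNumber equivNumber (m + (j + 1)) j)))) := rfl
    rw [h1, show m + (j + 1) - 1 - j = m by omega, show m + (j + 1) = m + 1 + j by omega,
      ← ih, ← formulaCode_notNew]
    rfl

theorem computable_formulaCode_sizeSentence : Computable fun n => formulaCode (sizeSentence n) := by
  refine Primrec.to_comp ((primrec_notNumber.comp (primrec_allNumber.comp (primrec_notNumber.comp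
    ((primrec_othersEqNumber equivNumber).comp
      (Primrec.nat_add.comp (Primrec.const 1) Primrec.id) Primrec.id)))).of_eq fun n => ?_)
  rw [id, ← formulaCode_othersEq]
  rfl

/-! ### Essentially undecidable theories of equivalence relations -/

/-- The theory that says, for `j` in the first of two recursively inseparable sets, that there is a
class with `u j + 1` elements, and for `j` in the second set, that there is none. -/
def sizeTheory (u : ℕ → ℕ) : equivLang.Theory :=
  {φ | ∃ j ∈ selfOutputs 0, sizeSentence (u j) = φ} ∪
    {φ | ∃ j ∈ selfOutputs 1, (sizeSentence (u j)).imp .falsum = φ}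

theorem isRE_sizeTheory {u : ℕ → ℕ} (hu : Computable u) : IsRE (sizeTheory u) := by
  refine ⟨sizeTheory u, ?_, rfl⟩
  have h := computable_formulaCode_sizeSentence.comp hu
  refine (rePred_or (rePred_image (rePred_selfOutputs 0) h) (rePred_image (rePred_selfOutputs 1)
    (primrec_notNumber.to_comp.comp h))).of_eq fun k => ?_
  constructor
  · rintro (⟨j, hj, rfl⟩ | ⟨j, hj, rfl⟩)
    · exact ⟨_, .inl ⟨j, hj, rfl⟩, rfl⟩
    · exact ⟨_, .inr ⟨j, hj, rfl⟩, rfl⟩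
  · rintro ⟨_, ⟨j, hj, rfl⟩ | ⟨j, hj, rfl⟩, rfl⟩
    · exact .inl ⟨j, hj, rfl⟩
    · exact .inr ⟨j, hj, rfl⟩

/-- In a decidable consistent extension, provability of `sizeSentence (u j)` would be a decidable
property of `j`, true on `selfOutputs 0` and, by consistency, false on `selfOutputs 1`. -/
theorem essentiallyUndecidable_sizeTheory {u : ℕ → ℕ} (hu : Computable u) :
    EssentiallyUndecidable (sizeTheory u) := by
  rintro T hT ⟨M⟩ hdec
  have hT' : ∀ φ ∈ sizeTheory u, φ ∈ theorems T :=
    fun φ hφ => hT (Theory.models_sentence_of_mem hφ)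
  refine not_separates_selfOutputs (C := fun j => formulaCode (sizeSentence (u j)) ∈
    codes (theorems T)) ?_ (fun j hj => ⟨_, hT' _ (.inl ⟨j, hj, rfl⟩), rfl⟩) ?_
  · obtain ⟨D, h⟩ := hdec
    exact ⟨fun j => D _, h.comp (computable_formulaCode_sizeSentence.comp hu)⟩
  · rintro j hj ⟨φ, hφ, h⟩
    obtain rfl := formulaCode_injective h
    have h1 := Theory.ModelsBoundedFormula.realize_sentence hφ M
    have h2 := Theory.ModelsBoundedFormula.realize_sentence (hT' _ (.inr ⟨j, hj, rfl⟩)) M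
    exact h2 h1

/-- Injectivity of `u` keeps a size forbidden by an element of `selfOutputs 1` from also being
required by an element of `selfOutputs 0`. -/
theorem points_models_sizeTheory {u : ℕ → ℕ} (hu : Function.Injective u) :
    points (u '' selfOutputs 0) ⊨ sizeTheory u := by
  rw [Theory.model_iff]
  rintro _ (⟨j, hj, rfl⟩ | ⟨j, hj, rfl⟩)
  · rw [points_realize_sizeSentence]
    exact ⟨j, hj, rfl⟩
  · intro h
    obtain ⟨i, hi, hij⟩ := (points_realize_sizeSentence (u '' selfOutputs 0) (u j)).1 h
    exact not_mem_selfOutputs_one (hu hij ▸ hi) hj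

/-! ### No theory is minimal -/

section Minimum

variable {L : FirstOrder.Language.{0, 0}} [FiniteSignature L]

theorem rePred_codes_union_identityAxioms {A : L.Theory} (hA : REPred fun k => k ∈ codes A) :
    REPred fun k => k ∈ codes (A ∪ identityAxioms L) := by
  have hfin : (codes (identityAxioms L)).Finite := finite_identityAxioms.image formulaCode
  have h : PrimrecPred fun k => k ∈ codes (identityAxioms L) :=
    (PrimrecPred_exists_mem (L := fun _ : ℕ => hfin.toFinset.toList) (Primrec.const _)
      (R := fun a b => b = a) (Primrec.eq.comp Primrec.snd Primrec.fst)).of_eq fun k => by simp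
  refine (rePred_or hA h.computablePred.to_re).of_eq fun k => ?_
  constructor
  · rintro (⟨φ, hφ, rfl⟩ | ⟨φ, hφ, rfl⟩)
    exacts [⟨φ, .inl hφ, rfl⟩, ⟨φ, .inr hφ, rfl⟩]
  · rintro ⟨φ, hφ | hφ, rfl⟩
    exacts [.inl ⟨φ, hφ, rfl⟩, .inr ⟨φ, hφ, rfl⟩]

/-- For every recursively enumerable essentially undecidable theory there is one that does not
interpret it. -/
theorem exists_not_interprets {U : L.Theory} (hre : IsRE U) (hU : EssentiallyUndecidable U) :
    ∃ V : equivLang.Theory, IsRE V ∧ EssentiallyUndecidable V ∧ ¬ Interprets V U := by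
  obtain ⟨A, hA, hAU⟩ := hre
  obtain ⟨R, hR, hRk⟩ := exists_primrecPred_of_rePred (rePred_codes_union_identityAxioms hA)
  -- A list of all coded translations. Numbers that decode to nothing receive a harmless default.
  let e : ℕ → TrCode := fun n => (Encodable.decode n).getD default
  have he : Primrec e := Primrec.option_getD.comp Primrec.decode (Primrec.const default)
  -- The number `q.2` packs an axiom `k`, a witness that `k` is enumerated, and a bound for the use
  -- of `k`. Because the last is a component, any bound on `q.2` also bounds the use.
  let B : (ℕ × List ℕ) × ℕ → Prop := fun q =>
    R q.2.unpair.1.unpair ∧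
    ¬ (e q.1.1).Hold (pointsBelow {x | x ∈ q.1.2}
      (2 * (e q.1.1).use q.2.unpair.1.unpair.1)) q.2.unpair.1.unpair.1 ∧
    (e q.1.1).use q.2.unpair.1.unpair.1 ≤ q.2.unpair.2
  have hB : PrimrecPred B := by
    have h1 : Primrec fun q : (ℕ × List ℕ) × ℕ => e q.1.1 :=
      he.comp (Primrec.fst.comp Primrec.fst)
    have h2 : Primrec fun q : (ℕ × List ℕ) × ℕ => q.2.unpair.1.unpair :=
      Primrec.unpair.comp (Primrec.fst.comp (Primrec.unpair.comp Primrec.snd))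
    have h3 : Primrec fun q : (ℕ × List ℕ) × ℕ =>
        (((e q.1.1, q.1.2), q.2.unpair.1.unpair.1) : (TrCode × List ℕ) × ℕ) :=
      (h1.pair (Primrec.snd.comp Primrec.fst)).pair (Primrec.fst.comp h2)
    have h4 := PrimrecPred.comp (TrCode.primrecPred_hold :) h3
    have h5 := Primrec.nat_le.comp (TrCode.primrec_use.comp h1 (Primrec.fst.comp h2))
      (Primrec.snd.comp (Primrec.unpair.comp Primrec.snd))
    have h6 := hR.comp h2
    exact h6.and (h4.not.and h5)
  have good : ∀ {Y : Set ℕ} {X : List ℕ} {d : ℕ}, (∀ y < d, y ∈ X ↔ y ∈ Y) →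
      Good d {x | x ∈ X} (points Y) ∧ Good d {x | x ∈ X} (pointsBelow {x | x ∈ X} (2 * d)) :=
    fun h => ⟨good_points h, good_pointsBelow fun _ _ => Iff.rfl⟩
  obtain ⟨u, hu, hmono, hsparse⟩ := exists_sparse hB fun n X => by
    obtain ⟨k, hk, hnot⟩ := exists_not_hold hU hAU (e n) X
    obtain ⟨s, hs⟩ := (hRk k).1 hk
    refine ⟨Nat.pair (Nat.pair k s) ((e n).use k), ?_⟩
    obtain ⟨g1, g2⟩ := good (Y := {x | x ∈ X}) (X := X) (d := (e n).use k) fun _ _ => Iff.rfl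
    rw [(e n).hold_congr le_rfl g1 g2] at hnot
    simpa [B] using ⟨hs, hnot⟩
  refine ⟨sizeTheory u, isRE_sizeTheory hu, essentiallyUndecidable_sizeTheory hu, fun hint => ?_⟩
  obtain ⟨e₀, he₀⟩ := hint.exists_hold
  have hhold := he₀ _ (points_nonempty _) (points_models_sizeTheory hmono.injective)
  -- The stage devoted to `e₀` is the one numbered by its own code.
  obtain ⟨X, q, hq, hBq, hX⟩ := hsparse _ (Set.image_subset_range u (selfOutputs 0))
    (Encodable.encode e₀)
  have hdec : e (Encodable.encode e₀) = e₀ := by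
    change (Encodable.decode (Encodable.encode e₀)).getD default = e₀
    rw [Encodable.encodek, Option.getD_some]
  obtain ⟨h1, h2, h3⟩ := hBq
  simp only [hdec] at h2 h3
  set k := q.unpair.1.unpair.1
  have hlt : e₀.use k < u (Encodable.encode e₀ + 1) :=
    (h3.trans (Nat.unpair_right_le q)).trans_lt hq
  -- The axiom fails in the finite structure for `X`. Since `X` agrees with `u '' selfOutputs 0`
  -- below the use of `k`, it also fails in `points (u '' selfOutputs 0)`, a model of the
  -- constructed theory.
  obtain ⟨g1, g2⟩ := good fun y (hy : y < e₀.use k) => hX y (hy.trans hlt)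
  rw [← e₀.hold_congr le_rfl g1 g2] at h2
  obtain ⟨φ, hφ, hφk⟩ := (hRk k).2 ⟨_, h1⟩
  refine h2 (hhold k ⟨φ, ?_, hφk⟩)
  rcases hφ with hφ | hφ
  · rw [← hAU]
    exact Theory.models_sentence_of_mem hφ
  · exact models_identityAxioms hφ U

end Minimum

end Interp

theorem lemma2 :
    ¬ ∃ (L : FirstOrder.Language.{0, 0}) (_ : Interp.FiniteSignature L) (U : L.Theory),
      Interp.IsInterpretabilityMinimum U := by
  rintro ⟨L, hL, U, hre, hU, hmin⟩
  obtain ⟨V, h1, h2, h3⟩ := Interp.exists_not_interprets hre hU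
  exact h3 (hmin Interp.equivLang V h1 h2)
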